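/- Let $\mathfrak g$ be a finite-dimensional complex simple Lie algebra with Cartan subalgebra $\mathfrak h$, root system $\Delta$, simple roots $\Pi$ and highest root $\theta$, and let $(\cdot,\cdot)$ be the multiple of the Killing form with $(\theta,\theta)=2$. Let $\Sigma\subset\Pi$, let $\Delta_\Sigma$ be the root subsystem generated by $\Sigma$, and put $\Delta(\mathfrak u)=\Delta^+\setminus\Delta_\Sigma$, $\mathfrak l=\mathfrak h\oplus\bigoplus_{\alpha\in\Delta_\Sigma}\mathfrak g_\alpha$, $\mathfrak u=\bigoplus_{\alpha\in\Delta(\mathfrak u)}\mathfrak g_\alpha$, $\bar{\mathfrak u}=\bigoplus_{\alpha\in\Delta(\mathfrak u)}\mathfrak g_{-\alpha}$, $\mathfrak p=\mathfrak l\oplus\mathfrak u$. Let $\mathcal K=\mathbb C((t))$ and let $\hat{\mathfrak g}=\mathfrak g\otimes\mathcal K\oplus\mathbb Cc$ be the affine Kac--Moody algebra, with $c$ central and $$[a\otimes f,b\otimes g]=[a,b]\otimes fg-(a,b)\operatorname{Res}_{t=0}(f\,dg)\,c .$$ Put $\mathfrak p_{\mathrm{nat}}=\mathfrak p\otimes\mathcal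 K\oplus\mathbb Cc$ and $\bar{\mathfrak u}_{\mathrm{nat}}=\bar{\mathfrak u}\otimes\mathcal K$, so that $\hat{\mathfrak g}=\bar{\mathfrak u}_{\mathrm{nat}}\oplus\mathfrak p_{\mathrm{nat}}$, and write $x=x_{\bar{\mathfrak u}_{\mathrm{nat}}}+x_{\mathfrak p_{\mathrm{nat}}}$ for the components. The field $\mathbb C$ is discrete; $\hat{\mathfrak g}$ carries the $t$-adic topology, in which the subspaces $\mathfrak g\otimes t^N\mathbb C[[t]]$, $N\in\mathbb Z$, form a base of neighbourhoods of $0$, and its subspaces carry the induced topologies. A topological vector space $E$ with an action of a topological Lie algebra $\mathfrak a$ is a continuous $\mathfrak a$-module if $\mathfrak a\times E\to E$ is (jointly) continuous. A topology on a vector space is called linear if it is translation invariant and has a base of neighbourhoods of $0$ consisting of subspaces. Let $k\in\mathbb C$ and let $(\sigma,V)$ be a continuous $\mathfrak p_{\mathrm{nat}}$-module of level $k$, i.e. $\sigma(c)=k\cdot\mathrm{id}_V$. The generalized imaginary Verma module is $$\mathbb M_{\sigma,k,\mathfrak p}(V)=U(\hat{\mathfrak g})\otimes_{U(\mathfrak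 p_{\mathrm{nat}})}V,$$ with $\hat{\mathfrak g}$ acting by left multiplication and with the finest linear topology for which all maps $\hat{\mathfrak g}^n\times V\to\mathbb M_{\sigma,k,\mathfrak p}(V)$, $(a_1,\dots,a_n,v)\mapsto a_1\cdots a_n\otimes v$ ($n\ge0$), are continuous. Let $\operatorname{Pol}\Omega_{\mathcal K}(\bar{\mathfrak u}^*)=S(\bar{\mathfrak u}\otimes\mathcal K)$, and give $\operatorname{Pol}\Omega_{\mathcal K}(\bar{\mathfrak u}^*)\otimes V$ the finest linear topology for which all maps $(\bar{\mathfrak u}_{\mathrm{nat}})^n\times V\to\operatorname{Pol}\Omega_{\mathcal K}(\bar{\mathfrak u}^*)\otimes V$, $(w_1,\dots,w_n,v)\mapsto w_1\cdots w_n\otimes v$ ($n\ge0$), are continuous. Let $D:S(\bar{\mathfrak u}_{\mathrm{nat}})\to S(\bar{\mathfrak u}_{\mathrm{nat}})\otimes\bar{\mathfrak u}_{\mathrm{nat}}$ be the universal derivation ($D(w)=1\otimes w$) and let $\operatorname{ad}u$ be the operator on $S(\bar{\mathfrak u}_{\mathrm{nat}})\otimes\hat{\mathfrak g}$ given by $$(\operatorname{ad}u)(p\otimes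 a)=-\sum_i p_i\otimes[w_i,a],\qquad D(p)=\sum_i p_i\otimes w_i .$$ It is nilpotent, so power series in it make sense. For $a\in\hat{\mathfrak g}$ put $$\pi_{\sigma,k,\mathfrak p}(a)(p\otimes v)=-\,m\!\left(\Big[\tfrac{\operatorname{ad}u\;e^{\operatorname{ad}u}}{e^{\operatorname{ad}u}-1}\,\big(e^{-\operatorname{ad}u}(p\otimes a)\big)_{\bar{\mathfrak u}_{\mathrm{nat}}}\Big]_{\bar{\mathfrak u}_{\mathrm{nat}}}\right)\otimes v+\sigma\!\left(\big(e^{-\operatorname{ad}u}(p\otimes a)\big)_{\mathfrak p_{\mathrm{nat}}}\right)v,$$ where the components are taken in the second tensor factor, $m(q\otimes w)=qw$ for $w\in\bar{\mathfrak u}_{\mathrm{nat}}$, and $\sigma(q\otimes x)v=q\otimes\sigma(x)v$ for $x\in\mathfrak p_{\mathrm{nat}}$. Then $\pi_{\sigma,k,\mathfrak p}$ is a representation of $\hat{\mathfrak g}$ on $\operatorname{Pol}\Omega_{\mathcal K}(\bar{\mathfrak u}^*)\otimes V$ of level $k$, both $\operatorname{Pol}\Omega_{\mathcal K}(\bar{\mathfrak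 u}^*)\otimes V$ and $\mathbb M_{\sigma,k,\mathfrak p}(V)$ are continuous $\hat{\mathfrak g}$-modules (and they are Hausdorff if $V$ is Hausdorff and linearly topologized), and $$\mathbb M_{\sigma,k,\mathfrak p}(V)\simeq\operatorname{Pol}\Omega_{\mathcal K}(\bar{\mathfrak u}^*)\otimes V$$ as continuous $\hat{\mathfrak g}$-modules, i.e. there is a $\hat{\mathfrak g}$-equivariant linear homeomorphism between them. -/

import Mathlib

open scoped TensorProduct

/- The commutator bracket on associative algebras, in particular on `Module.End ℂ V`. -/
attribute [local instance 100] LieRing.ofAssociativeRing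

noncomputable section

namespace FreeField


theorem derivative_mul_aux (f g : HahnSeries ℤ ℂ) :
    LaurentSeries.derivative ℂ (f * g)
      = LaurentSeries.derivative ℂ f * g + f * LaurentSeries.derivative ℂ g := by
  set T : HahnSeries ℤ ℂ := HahnSeries.single 1 1 with hT
  have hθ : ∀ (h : HahnSeries ℤ ℂ) (n : ℤ),
      (T * LaurentSeries.derivative ℂ h).coeff n = (n : ℂ) * h.coeff n := by
    intro h n
    rw [hT, HahnSeries.coeff_single_mul]
    simp
  have hsupp : ∀ h : HahnSeries ℤ ℂ,
      (T * LaurentSeries.derivative ℂ h).support ⊆ h.support := by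
    intro h n hn
    simp only [HahnSeries.mem_support, hθ] at hn ⊢
    exact right_ne_zero_of_mul hn
  have key : T * LaurentSeries.derivative ℂ (f * g)
      = T * (LaurentSeries.derivative ℂ f * g + f * LaurentSeries.derivative ℂ g) := by
    rw [mul_add, ← mul_assoc, mul_left_comm T f]
    ext n
    rw [hθ, HahnSeries.coeff_add, HahnSeries.coeff_mul_left' f.isPWO_support (hsupp f),
      HahnSeries.coeff_mul_right' g.isPWO_support (hsupp g), HahnSeries.coeff_mul,
      Finset.mul_sum, ← Finset.sum_add_distrib]
    refine Finset.sum_congr rfl fun ij hij => ?_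
    have h1 : ij.1 + ij.2 = n := (Finset.mem_antidiagonal.mp hij).2.2
    rw [hθ, hθ, ← h1]
    push_cast
    ring
  have hTu : (HahnSeries.single (-1 : ℤ) (1 : ℂ)) * T = 1 := by
    rw [hT, HahnSeries.single_mul_single]; simp
  have := congrArg (fun h => (HahnSeries.single (-1 : ℤ) (1 : ℂ)) * h) key
  simpa only [← mul_assoc, hTu, one_mul] using this

theorem derivative_coeff_aux (f : HahnSeries ℤ ℂ) (n : ℤ) :
    (LaurentSeries.derivative ℂ f).coeff n = ((n + 1 : ℤ) : ℂ) * f.coeff (n + 1) := by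
  simp

/-- The algebra `𝒦 = ℂ((t))` of formal Laurent series. -/
def Laurent : Type := LaurentSeries ℂ

namespace Laurent

instance : CommRing Laurent := inferInstanceAs (CommRing (HahnSeries ℤ ℂ))

instance : Algebra ℂ Laurent := (HahnSeries.instAlgebra : Algebra ℂ (HahnSeries ℤ ℂ))

/-- The coefficient of `t ^ n`. -/
def coeff (n : ℤ) : Laurent →ₗ[ℂ] ℂ where
  toFun f := HahnSeries.coeff f n
  map_add' _ _ := rfl
  map_smul' _ _ := rfl

/-- The formal derivative `d/dt`. -/
def deriv : Laurent →ₗ[ℂ] Laurent where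
  toFun f := LaurentSeries.derivative ℂ (V := ℂ) f
  map_add' f g := map_add (LaurentSeries.derivative ℂ (V := ℂ)) f g
  map_smul' r f := (LaurentSeries.derivative ℂ (V := ℂ)).map_smul r f

theorem coeff_deriv (f : Laurent) (n : ℤ) :
    coeff n (deriv f) = ((n + 1 : ℤ) : ℂ) * coeff (n + 1) f :=
  derivative_coeff_aux f n

theorem deriv_mul (f g : Laurent) : deriv (f * g) = deriv f * g + f * deriv g :=
  derivative_mul_aux f g

/-- The residue `Res (f dg)`, the coefficient of `t ^ (-1)` in `f g'`. -/
def resPairing : LinearMap.BilinForm ℂ Laurent :=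
  LinearMap.mk₂ ℂ (fun f g => coeff (-1) (f * deriv g))
    (fun f f' g => by rw [add_mul, map_add])
    (fun r f g => by rw [smul_mul_assoc, map_smul])
    (fun f g g' => by rw [map_add, mul_add, map_add])
    (fun r f g => by rw [map_smul, mul_smul_comm, map_smul])

theorem resPairing_apply (f g : Laurent) : resPairing f g = coeff (-1) (f * deriv g) := rfl

theorem resPairing_antisymm (f g : Laurent) : resPairing f g = -resPairing g f := by
  rw [eq_neg_iff_add_eq_zero, resPairing_apply, resPairing_apply, ← map_add, add_comm,
    mul_comm g, ← deriv_mul, coeff_deriv]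
  simp

theorem resPairing_cyclic (f g h : Laurent) :
    resPairing f (g * h) = resPairing (f * g) h + resPairing (f * h) g := by
  simp only [resPairing_apply, ← map_add, deriv_mul]
  congr 1
  ring

end Laurent

section Affine

variable {𝔤 : Type*} [LieRing 𝔤] [LieAlgebra ℂ 𝔤]

/-- The cocycle `(f ⊗ a, g ⊗ b) ↦ -(a, b) Res (f dg)` on `𝔤((t))`, where `(a, b) = r κ(a, b)` for
the Killing form `κ`. -/
def cocycle (𝔤 : Type*) [LieRing 𝔤] [LieAlgebra ℂ 𝔤] (r : ℂ) :
    LinearMap.BilinForm ℂ (Laurent ⊗[ℂ] 𝔤) :=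
  -(LinearMap.BilinForm.tmul Laurent.resPairing (r • killingForm ℂ 𝔤))

@[simp] theorem cocycle_tmul (r : ℂ) (f g : Laurent) (a b : 𝔤) :
    cocycle 𝔤 r (f ⊗ₜ a) (g ⊗ₜ b) = -(r * killingForm ℂ 𝔤 a b * Laurent.resPairing f g) := by
  simp [cocycle]

theorem cocycle_antisymm (r : ℂ) (x y : Laurent ⊗[ℂ] 𝔤) :
    cocycle 𝔤 r x y = -cocycle 𝔤 r y x := by
  induction x with
  | zero => simp
  | add x x' hx hx' => rw [map_add, map_add, LinearMap.add_apply, hx, hx', neg_add]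
  | tmul f a =>
    induction y with
    | zero => simp
    | add y y' hy hy' => rw [map_add, map_add, LinearMap.add_apply, hy, hy', neg_add]
    | tmul g b =>
      rw [cocycle_tmul, cocycle_tmul, Laurent.resPairing_antisymm f g,
        LieModule.traceForm_comm ℂ 𝔤 𝔤 a b]
      ring

theorem cocycle_jacobi (r : ℂ) (x y z : Laurent ⊗[ℂ] 𝔤) :
    cocycle 𝔤 r x ⁅y, z⁆ = cocycle 𝔤 r ⁅x, y⁆ z + cocycle 𝔤 r y ⁅x, z⁆ := by
  induction x with
  | zero => simp
  | add x x' hx hx' => simp only [map_add, LinearMap.add_apply, add_lie, hx, hx']; ring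
  | tmul f a =>
    induction y with
    | zero => simp
    | add y y' hy hy' => simp only [map_add, LinearMap.add_apply, add_lie, lie_add, hy, hy']; ring
    | tmul g b =>
      induction z with
      | zero => simp
      | add z z' hz hz' => simp only [map_add, lie_add, hz, hz']; ring
      | tmul h c =>
        have e : ∀ (f g : Laurent) (a b : 𝔤), ⁅f ⊗ₜ[ℂ] a, g ⊗ₜ[ℂ] b⁆ = (f * g) ⊗ₜ[ℂ] ⁅a, b⁆ :=
          fun f g a b => LieAlgebra.ExtendScalars.bracket_tmul ℂ Laurent 𝔤 𝔤 f g a b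
        rw [e, e, e, cocycle_tmul, cocycle_tmul, cocycle_tmul]
        have h1 : killingForm ℂ 𝔤 ⁅a, b⁆ c = killingForm ℂ 𝔤 a ⁅b, c⁆ :=
          LieModule.traceForm_apply_lie_apply ℂ 𝔤 𝔤 a b c
        have h2 : killingForm ℂ 𝔤 b ⁅a, c⁆ = -killingForm ℂ 𝔤 a ⁅b, c⁆ := by
          rw [← h1, ← lie_skew a b, map_neg, LinearMap.neg_apply, neg_neg]
          exact (LieModule.traceForm_apply_lie_apply ℂ 𝔤 𝔤 b a c).symm
        rw [h1, h2, Laurent.resPairing_cyclic f g h, Laurent.resPairing_antisymm g (f * h)]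
        ring

/-- The affine Kac--Moody algebra `ĝ = 𝔤((t)) ⊕ ℂ c`. -/
def Affine (𝔤 : Type*) [LieRing 𝔤] [LieAlgebra ℂ 𝔤] (_r : ℂ) : Type _ :=
  (Laurent ⊗[ℂ] 𝔤) × ℂ

namespace Affine

variable (r : ℂ)

instance : AddCommGroup (Affine 𝔤 r) := inferInstanceAs (AddCommGroup ((Laurent ⊗[ℂ] 𝔤) × ℂ))

instance : Module ℂ (Affine 𝔤 r) := inferInstanceAs (Module ℂ ((Laurent ⊗[ℂ] 𝔤) × ℂ))

variable (𝔤) in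
/-- The inclusion of `𝔤((t))`, as vector spaces. -/
def incl : Laurent ⊗[ℂ] 𝔤 →ₗ[ℂ] Affine 𝔤 r := LinearMap.inl ℂ (Laurent ⊗[ℂ] 𝔤) ℂ

variable (𝔤) in
/-- The component in `𝔤((t))`. -/
def loop : Affine 𝔤 r →ₗ[ℂ] Laurent ⊗[ℂ] 𝔤 := LinearMap.fst ℂ (Laurent ⊗[ℂ] 𝔤) ℂ

variable (𝔤) in
/-- The coefficient of `c`. -/
def level : Affine 𝔤 r →ₗ[ℂ] ℂ := LinearMap.snd ℂ (Laurent ⊗[ℂ] 𝔤) ℂ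

variable (𝔤) in
/-- The central element `c`. -/
def c : Affine 𝔤 r := ((0 : Laurent ⊗[ℂ] 𝔤), (1 : ℂ))

variable {r}

theorem ext {x y : Affine 𝔤 r} (h : loop 𝔤 r x = loop 𝔤 r y) (h' : level 𝔤 r x = level 𝔤 r y) :
    x = y :=
  Prod.ext h h'

/-- `[x + λ c, y + μ c] = [x, y] + ω(x, y) c` with `ω(a f, b g) = -(a, b) Res (f dg)`. -/
instance : Bracket (Affine 𝔤 r) (Affine 𝔤 r) where
  bracket x y := (⁅loop 𝔤 r x, loop 𝔤 r y⁆, cocycle 𝔤 r (loop 𝔤 r x) (loop 𝔤 r y))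

@[simp] theorem loop_lie (x y : Affine 𝔤 r) :
    loop 𝔤 r ⁅x, y⁆ = ⁅loop 𝔤 r x, loop 𝔤 r y⁆ := rfl

@[simp] theorem level_lie (x y : Affine 𝔤 r) :
    level 𝔤 r ⁅x, y⁆ = cocycle 𝔤 r (loop 𝔤 r x) (loop 𝔤 r y) := rfl

instance : LieRing (Affine 𝔤 r) where
  add_lie x y z := ext (by simp) (by simp)
  lie_add x y z := ext (by simp) (by simp)
  lie_self x := ext (by simp) (by
    have h := cocycle_antisymm r (loop 𝔤 r x) (loop 𝔤 r x)
    simpa using self_eq_neg.mp h)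
  leibniz_lie x y z := ext (by simp) (by
    simpa using cocycle_jacobi r (loop 𝔤 r x) (loop 𝔤 r y) (loop 𝔤 r z))

instance : LieAlgebra ℂ (Affine 𝔤 r) where
  lie_smul t x y := ext (by simp) (by simp)

/-- The subspace `𝔤 ⊗ t ^ n ℂ[[t]]` of `ĝ`. -/
def filtration (r : ℂ) (n : ℤ) : Submodule ℂ (Affine 𝔤 r) :=
  Submodule.span ℂ {x | ∃ (f : Laurent) (a : 𝔤), (∀ m < n, Laurent.coeff m f = 0) ∧
    x = incl 𝔤 r (f ⊗ₜ a)}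

/-- The `t`-adic topology: the subspaces `𝔤 ⊗ t ^ n ℂ[[t]]` are a base of neighbourhoods of zero
(and hence `ℂ c` is discrete). -/
instance : TopologicalSpace (Affine 𝔤 r) :=
  ⨅ n : ℤ, TopologicalSpace.induced (filtration r n).mkQ ⊥

end Affine

end Affine
section Parabolic

open LieAlgebra LieAlgebra.IsKilling LieModule Module

variable {𝔤 : Type*} [LieRing 𝔤] [LieAlgebra ℂ 𝔤] [FiniteDimensional ℂ 𝔤] [LieAlgebra.IsSimple ℂ 𝔤]
  {H : LieSubalgebra ℂ 𝔤} [H.IsCartanSubalgebra]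

/-- `Δ_Σ`: the roots in the root subsystem generated by the set `Σ` of simple roots. -/
def leviRoots (b : (rootSystem H).Base) (S : Set b.support) : Set H.root :=
  {α | (rootSystem H).root α ∈
    Submodule.span ℤ ((fun i : b.support => (rootSystem H).root i) '' S)}

/-- `Δ(𝔲)`: the positive roots outside `Δ_Σ`. -/
def nilRoots (b : (rootSystem H).Base) (S : Set b.support) : Set H.root :=
  {α | b.IsPos α ∧ α ∉ leviRoots b S}

/-- The Levi subalgebra `𝔩 = 𝔥 ⊕ ⨁_{α ∈ Δ_Σ} 𝔤_α`. -/
def levi (b : (rootSystem H).Base) (S : Set b.support) : Submodule ℂ 𝔤 :=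
  H.toSubmodule ⊔ ⨆ α ∈ leviRoots b S, (rootSpace H (α.1 : H → ℂ)).toSubmodule

/-- The nilradical `𝔲 = ⨁_{α ∈ Δ(𝔲)} 𝔤_α`. -/
def nilradical (b : (rootSystem H).Base) (S : Set b.support) : Submodule ℂ 𝔤 :=
  ⨆ α ∈ nilRoots b S, (rootSpace H (α.1 : H → ℂ)).toSubmodule

/-- The opposite nilradical `ū = ⨁_{α ∈ Δ(𝔲)} 𝔤_{-α}`. -/
def oppNilradical (b : (rootSystem H).Base) (S : Set b.support) : Submodule ℂ 𝔤 :=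
  ⨆ α ∈ nilRoots b S, (rootSpace H (-(α.1 : H → ℂ))).toSubmodule

/-- The `Σ`-height, extended linearly to `𝔥^*`. -/
def sigmaHeight (b : (rootSystem H).Base) (S : Set b.support) : Dual ℂ H →ₗ[ℂ] ℂ :=
  open Classical in ∑ i ∈ Finset.univ.filter (fun i => i ∉ S), b.toWeightBasis.coord i

theorem sigmaHeight_root (b : (rootSystem H).Base) (S : Set b.support) (α : H.root) :
    ∃ n : ℤ, sigmaHeight b S ((rootSystem H).root α) = n ∧ (α ∈ leviRoots b S ↔ n = 0) ∧
      (α ∈ nilRoots b S ↔ 0 < n) := by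
  classical
  obtain ⟨f, -, hpos, hf⟩ := b.exists_root_eq_sum_int α
  have hf' : (rootSystem H).root α
      = ∑ i : b.support, f i • (rootSystem H).root (i : H.root) := by
    rw [hf]
    exact (Finset.sum_coe_sort b.support (fun j => f j • (rootSystem H).root j)).symm
  have hcoord : ∀ i : b.support, b.toWeightBasis.coord i ((rootSystem H).root α) = f i := by
    intro i
    rw [hf', map_sum]
    simp only [map_zsmul, Basis.coord_apply, RootPairing.Base.toWeightBasis_repr_root]
    simp [Finsupp.single_apply]
  have hP : b.IsPos α ↔ 0 < f := by
    rw [RootPairing.Base.isPos_iff, RootPairing.Base.height_eq_sum hf]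
    constructor
    · intro h
      rcases hpos with h' | h'
      · exact h'
      · exact absurd h (not_lt.mpr (Finset.sum_nonpos fun i _ => h'.le i))
    · intro h
      have := b.height_ne_zero α
      rw [RootPairing.Base.height_eq_sum hf] at this
      exact lt_of_le_of_ne (Finset.sum_nonneg fun i _ => h.le i) this.symm
  set n : ℤ := ∑ i ∈ Finset.univ.filter (fun i => i ∉ S), f i with hn
  have h0 : α ∈ leviRoots b S ↔ ∀ i : b.support, i ∉ S → f i = 0 := by
    constructor
    · intro h i hi
      have : ∀ x ∈ Submodule.span ℤ ((fun i : b.support => (rootSystem H).root i) '' S),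
          b.toWeightBasis.coord i x = 0 := by
        intro x hx
        induction hx using Submodule.span_induction with
        | mem x hx =>
          obtain ⟨j, hj, rfl⟩ := hx
          have : j ≠ i := fun h => hi (h ▸ hj)
          change b.toWeightBasis.coord i ((rootSystem H).root j) = 0
          rw [Basis.coord_apply, RootPairing.Base.toWeightBasis_repr_root]
          exact Finsupp.single_eq_of_ne this.symm
        | zero => simp
        | add x y _ _ hx hy => rw [map_add, hx, hy, add_zero]
        | smul r x _ hx => rw [map_zsmul, hx, smul_zero]
      have := this _ h
      rw [hcoord] at this
      exact_mod_cast this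
    · intro h
      rw [leviRoots, Set.mem_ofPred_eq]
      rw [hf']
      refine Submodule.sum_mem _ fun i _ => ?_
      by_cases hi : i ∈ S
      · exact Submodule.smul_mem _ _ (Submodule.subset_span ⟨i, hi, rfl⟩)
      · rw [h i hi, zero_smul]; exact Submodule.zero_mem _
  have h0' : α ∈ leviRoots b S ↔ n = 0 := by
    rw [h0, hn]
    rcases hpos with h | h
    · rw [Finset.sum_eq_zero_iff_of_nonneg (f := fun i : b.support => f i) fun i _ => h.le i]; simp
    · rw [Finset.sum_eq_zero_iff_of_nonpos (f := fun i : b.support => f i) fun i _ => h.le i]; simp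
  refine ⟨n, ?_, h0', ?_⟩
  · rw [sigmaHeight, LinearMap.sum_apply, hn, Int.cast_sum]
    exact Finset.sum_congr rfl fun i _ => hcoord i
  · change (b.IsPos α ∧ α ∉ leviRoots b S) ↔ _
    rw [h0', hP]
    constructor
    · rintro ⟨h, h'⟩
      exact lt_of_le_of_ne (Finset.sum_nonneg fun i _ => h.le i) (Ne.symm h')
    · intro h
      refine ⟨?_, h.ne'⟩
      rcases hpos with h' | h'
      · exact h'
      · exact absurd h (not_lt.mpr (Finset.sum_nonpos fun i _ => h'.le i))

/-- The functions on `𝔥` that are linear of `Σ`-height in `A`. -/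
def heightSet (b : (rootSystem H).Base) (S : Set b.support) (A : Set ℤ) : Set (H → ℂ) :=
  {χ | ∃ l : Dual ℂ H, χ = l ∧ ∃ n ∈ A, sigmaHeight b S l = n}

theorem mem_heightSet_root (b : (rootSystem H).Base) (S : Set b.support) (α : H.root) (n : ℤ)
    (h : sigmaHeight b S ((rootSystem H).root α) = n) (A : Set ℤ) (hA : n ∈ A) :
    (α.1 : H → ℂ) ∈ heightSet b S A :=
  ⟨(rootSystem H).root α, rfl, n, hA, h⟩

theorem neg_mem_heightSet_root (b : (rootSystem H).Base) (S : Set b.support) (α : H.root) (n : ℤ)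
    (h : sigmaHeight b S ((rootSystem H).root α) = n) (A : Set ℤ) (hA : -n ∈ A) :
    (-(α.1 : H → ℂ)) ∈ heightSet b S A :=
  ⟨-(rootSystem H).root α, rfl, -n, hA, by rw [map_neg, h]; push_cast; rfl⟩

theorem exists_root_of_ne_bot {χ : H → ℂ} (h : rootSpace H χ ≠ ⊥) (h0 : χ ≠ 0) :
    ∃ α : H.root, (α.1 : H → ℂ) = χ :=
  ⟨⟨⟨χ, h⟩, by
    simp only [LieSubalgebra.root, Finset.mem_filter, Finset.mem_univ, true_and]
    exact fun h' => h0 h'⟩, rfl⟩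

theorem levi_sup_nilradical (b : (rootSystem H).Base) (S : Set b.support) :
    levi b S ⊔ nilradical b S
      = (⨆ χ, ⨆ (_ : χ ∈ heightSet b S {n | 0 ≤ n}), rootSpace H χ).toSubmodule := by
  simp only [LieSubmodule.iSup_toSubmodule]
  apply le_antisymm
  · refine sup_le (sup_le ?_ ?_) ?_
    · refine le_iSup₂_of_le (0 : H → ℂ) ⟨0, rfl, 0, le_refl (0 : ℤ), by simp⟩ ?_
      rw [rootSpace_zero_eq]; exact le_rfl
    · refine iSup₂_le fun α hα => ?_
      obtain ⟨n, hn, h1, h2⟩ := sigmaHeight_root b S α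
      exact le_iSup₂_of_le (α.1 : H → ℂ)
        (mem_heightSet_root b S α n hn _ (h1.mp hα).ge) le_rfl
    · refine iSup₂_le fun α hα => ?_
      obtain ⟨n, hn, h1, h2⟩ := sigmaHeight_root b S α
      exact le_iSup₂_of_le (α.1 : H → ℂ)
        (mem_heightSet_root b S α n hn _ (h2.mp hα).le) le_rfl
  · refine iSup₂_le fun χ hχ => ?_
    by_cases hb : rootSpace H χ = ⊥
    · rw [hb]; simp
    by_cases h0 : χ = 0
    · subst h0
      rw [rootSpace_zero_eq]
      exact le_sup_of_le_left le_sup_left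
    obtain ⟨α, rfl⟩ := exists_root_of_ne_bot hb h0
    obtain ⟨l, hl, m, hm, hlm⟩ := hχ
    obtain ⟨n, hn, h1, h2⟩ := sigmaHeight_root b S α
    have : l = (rootSystem H).root α := by ext x; exact (congrFun hl x).symm
    rw [this, hn] at hlm
    have hnm : n = m := by exact_mod_cast hlm
    rcases (show (0 : ℤ) ≤ n from hnm ▸ hm).eq_or_lt with h | h
    · exact le_sup_of_le_left (le_sup_of_le_right
        (le_iSup₂_of_le α (h1.mpr h.symm) le_rfl))
    · exact le_sup_of_le_right (le_iSup₂_of_le α (h2.mpr h) le_rfl)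

/-- The standard parabolic subalgebra `𝔭 = 𝔩 ⊕ 𝔲`. -/
def parabolic (b : (rootSystem H).Base) (S : Set b.support) : LieSubalgebra ℂ 𝔤 where
  toSubmodule := levi b S ⊔ nilradical b S
  lie_mem' := by
    intro x y hx hy
    have e := levi_sup_nilradical b S
    change x ∈ levi b S ⊔ nilradical b S at hx
    change y ∈ levi b S ⊔ nilradical b S at hy
    change ⁅x, y⁆ ∈ levi b S ⊔ nilradical b S
    rw [e] at hx hy ⊢
    refine mem_biSup_genWeightSpace_of ?_ hx hy
    rintro _ ⟨l, rfl, n, hn, hl⟩ _ ⟨l', rfl, n', hn', hl'⟩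
    exact ⟨l + l', rfl, n + n', show (0 : ℤ) ≤ n + n' from add_nonneg hn hn', by rw [map_add, hl, hl']; push_cast; rfl⟩

theorem oppNilradical_le (b : (rootSystem H).Base) (S : Set b.support) :
    oppNilradical b S
      ≤ (⨆ χ, ⨆ (_ : χ ∈ heightSet b S {n | n < 0}), rootSpace H χ).toSubmodule := by
  simp only [LieSubmodule.iSup_toSubmodule]
  refine iSup₂_le fun α hα => ?_
  obtain ⟨n, hn, h1, h2⟩ := sigmaHeight_root b S α
  exact le_iSup₂_of_le (-(α.1 : H → ℂ))
    (neg_mem_heightSet_root b S α n hn _ (neg_lt_zero.mpr (h2.mp hα))) le_rfl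

/-- The decomposition `𝔤 = ū ⊕ 𝔭`. -/
theorem isCompl_oppNilradical_parabolic (b : (rootSystem H).Base) (S : Set b.support) :
    IsCompl (oppNilradical b S) (parabolic b S).toSubmodule := by
  constructor
  · have hind := iSupIndep_genWeightSpace ℂ H 𝔤
    have hd := hind.disjoint_biSup_biSup (s := heightSet b S {n | n < 0})
      (t := heightSet b S {n | 0 ≤ n}) (by
        rw [Set.disjoint_left]
        rintro _ ⟨l, rfl, n, hn, hl⟩ ⟨l', hll, n', hn', hl'⟩
        have : l = l' := DFunLike.coe_injective hll
        subst this
        rw [hl] at hl'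
        have : n = n' := by exact_mod_cast hl'
        subst this
        exact absurd (show n < 0 from hn) (not_lt.mpr (show (0 : ℤ) ≤ n from hn')))
    rw [← LieSubmodule.disjoint_toSubmodule] at hd
    refine hd.mono (oppNilradical_le b S) ?_
    exact (levi_sup_nilradical b S).le
  · rw [codisjoint_iff, eq_top_iff]
    have htop := iSup_genWeightSpace_eq_top' ℂ H 𝔤
    rw [← LieSubmodule.toSubmodule_inj, LieSubmodule.iSup_toSubmodule,
      LieSubmodule.top_toSubmodule] at htop
    rw [← htop]
    refine iSup_le fun χ => ?_
    by_cases h0 : (χ : H → ℂ) = 0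
    · rw [h0]
      refine le_sup_of_le_right ?_
      change (rootSpace H (0 : H → ℂ)).toSubmodule ≤ levi b S ⊔ nilradical b S
      rw [rootSpace_zero_eq]
      exact le_sup_of_le_left le_sup_left
    obtain ⟨α, hα⟩ := exists_root_of_ne_bot χ.genWeightSpace_ne_bot h0
    obtain ⟨n, hn, h1, h2⟩ := sigmaHeight_root b S α
    rcases lt_trichotomy n 0 with h | h | h
    · refine le_sup_of_le_left ?_
      have hneg : (-α.1 : Weight ℂ H 𝔤) ∈ H.root := by
        have := α.2
        simp only [LieSubalgebra.root, Finset.mem_filter, Finset.mem_univ, true_and] at this ⊢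
        exact Weight.IsNonZero.neg this
      have hβ : (((-α.1 : Weight ℂ H 𝔤)) : H → ℂ) = -(α.1 : H → ℂ) := Weight.coe_neg
      obtain ⟨m, hm, hm1, hm2⟩ := sigmaHeight_root b S ⟨-α.1, hneg⟩
      have e : (rootSystem H).root ⟨-α.1, hneg⟩ = -(rootSystem H).root α := by
        ext x; exact congrFun hβ x
      rw [e, map_neg, hn] at hm
      have hmn : -n = m := by exact_mod_cast hm
      refine le_iSup₂_of_le ⟨-α.1, hneg⟩ (hm2.mpr (by omega)) ?_
      rw [← hα]
      simp only [hβ, neg_neg]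
      exact le_rfl
    · refine le_sup_of_le_right (le_sup_of_le_left (le_sup_of_le_right ?_))
      exact le_iSup₂_of_le α (h1.mpr h) (by rw [hα])
    · refine le_sup_of_le_right (le_sup_of_le_right ?_)
      exact le_iSup₂_of_le α (h2.mpr h) (by rw [hα])

end Parabolic

section Topology

/-- The finest linear topology (translation invariant, with a base of neighbourhoods of zero that
consists of subspaces) on `E` for which all the given maps `F i : Y i → E` are continuous. -/
abbrev finestLinear {E : Type*} [AddCommGroup E] [Module ℂ E] {ι : Type*} {Y : ι → Type*}
    [∀ i, TopologicalSpace (Y i)] (F : ∀ i, Y i → E) : TopologicalSpace E :=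
  sInf {τ | @IsTopologicalAddGroup E τ _ ∧ @IsLinearTopology ℂ E _ _ _ τ ∧
    ∀ i, @Continuous _ _ _ τ (F i)}

section

variable {E : Type*} [AddCommGroup E] [Module ℂ E] {ι : Type*} {Y : ι → Type*}
    [∀ i, TopologicalSpace (Y i)] (F : ∀ i, Y i → E)

theorem isTopologicalAddGroup_finestLinear : @IsTopologicalAddGroup E (finestLinear F) _ :=
  topologicalAddGroup_sInf fun _ h => h.1

theorem continuous_finestLinear (i : ι) : @Continuous _ _ _ (finestLinear F) (F i) :=
  continuous_sInf_rng.mpr fun _ h => h.2.2 i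

theorem continuousConstSMul_finestLinear : @ContinuousConstSMul ℂ E (finestLinear F) _ := by
  let := finestLinear F
  refine ⟨fun c => continuous_sInf_rng.mpr fun τ h => continuous_sInf_dom h ?_⟩
  let := τ
  have := h.1
  have := h.2.1
  refine continuous_of_continuousAt_zero (DistribSMul.toAddMonoidHom E c) ?_
  change Filter.Tendsto (fun x : E => c • x) (nhds 0) (nhds (c • (0 : E)))
  rw [smul_zero, (IsLinearTopology.hasBasis_submodule ℂ).tendsto_iff
    (IsLinearTopology.hasBasis_submodule ℂ)]
  exact fun W hW => ⟨W, hW, fun x hx => W.smul_mem c hx⟩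

theorem isLinearTopology_finestLinear : @IsLinearTopology ℂ E _ _ _ (finestLinear F) := by
  let := finestLinear F
  have := isTopologicalAddGroup_finestLinear F
  refine ⟨Filter.hasBasis_iff.mpr fun U => ⟨fun hU => ?_, fun ⟨W, hW, hU⟩ =>
    Filter.mem_of_superset hW hU⟩⟩
  rw [nhds_sInf, iInf_subtype'] at hU
  refine Filter.iInf_sets_induct hU (p := fun U => ∃ W : Submodule ℂ E,
    (W : Set E) ∈ nhds (0 : E) ∧ (W : Set E) ⊆ U) ?_ ?_
  · exact ⟨⊤, Filter.univ_mem, fun _ _ => trivial⟩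
  · intro τ s₁ s₂ h₁ h₂
    obtain ⟨W₂, hW₂, hs₂⟩ := h₂
    obtain ⟨W₁, hW₁, hs₁⟩ :=
      (@IsLinearTopology.hasBasis_submodule ℂ E _ _ _ τ.1 τ.2.2.1).mem_iff.mp h₁
    have hW₁' : (W₁ : Set E) ∈ nhds (0 : E) :=
      nhds_mono (sInf_le τ.2 : finestLinear F ≤ τ.1) hW₁
    exact ⟨W₁ ⊓ W₂, Filter.inter_mem hW₁' hW₂, Set.inter_subset_inter hs₁ hs₂⟩

end

/-- The `t`-adic topology on `N((t))` for `N` finite dimensional: the subspaces `N ⊗ t ^ n ℂ[[t]]`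
are a base of neighbourhoods of zero. -/
abbrev tAdic (N : Type*) [AddCommGroup N] [Module ℂ N] : TopologicalSpace (Laurent ⊗[ℂ] N) :=
  ⨅ n : ℤ, TopologicalSpace.induced (Submodule.span ℂ {x | ∃ (f : Laurent) (a : N),
    (∀ m < n, Laurent.coeff m f = 0) ∧ x = f ⊗ₜ[ℂ] a}).mkQ ⊥

end Topology

section Series

/-- `F(T) = ∑ F_j T ^ j` for a nilpotent operator `T` and a formal power series `F`. -/
def evalSeries {E : Type*} [AddCommGroup E] [Module ℂ E] (F : PowerSeries ℂ) (T : Module.End ℂ E) :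
    Module.End ℂ E :=
  ∑ j ∈ Finset.range (nilpotencyClass T), PowerSeries.coeff j F • T ^ j

end Series

section Pol

variable (W : Type*) [AddCommGroup W] [Module ℂ W]

/-- The algebra map `S(W) → S(W) ⊕ ε S(W) ⊗ W`, `w ↦ w + ε (1 ⊗ w)`. -/
def symDual : SymmetricAlgebra ℂ W →ₐ[ℂ]
    TrivSqZeroExt (SymmetricAlgebra ℂ W) (SymmetricAlgebra ℂ W ⊗[ℂ] W) :=
  SymmetricAlgebra.lift
    { toFun := fun w => TrivSqZeroExt.inl (SymmetricAlgebra.ι ℂ W w) + TrivSqZeroExt.inr (1 ⊗ₜ w)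
      map_add' := fun w w' => by
        ext <;> simp [TensorProduct.tmul_add]
      map_smul' := fun r w => by
        ext <;> simp }

/-- The universal derivation `S(W) → S(W) ⊗ W`, `w ↦ 1 ⊗ w`; in terms of a basis `w_i` of `W` it is
`p ↦ ∑ ∂p/∂w_i ⊗ w_i`. -/
def symDiff : SymmetricAlgebra ℂ W →ₗ[ℂ] SymmetricAlgebra ℂ W ⊗[ℂ] W where
  toFun p := (symDual W p).snd
  map_add' p q := by simp
  map_smul' r p := by simp

theorem symDiff_ι (w : W) : symDiff W (SymmetricAlgebra.ι ℂ W w) = 1 ⊗ₜ w := by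
  simp [symDiff, symDual]

theorem symDual_fst (p : SymmetricAlgebra ℂ W) : (symDual W p).fst = p := by
  have : (TrivSqZeroExt.fstHom ℂ (SymmetricAlgebra ℂ W) (SymmetricAlgebra ℂ W ⊗[ℂ] W)).comp
      (symDual W) = AlgHom.id ℂ _ := by
    apply SymmetricAlgebra.algHom_ext
    ext w
    simp [symDual]
  exact DFunLike.congr_fun this p

theorem symDiff_mul (p q : SymmetricAlgebra ℂ W) :
    symDiff W (p * q) = p • symDiff W q + q • symDiff W p := by
  have : symDiff W (p * q) = (symDual W p * symDual W q).snd := by simp [symDiff]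
  rw [this, TrivSqZeroExt.snd_mul, symDual_fst, symDual_fst, op_smul_eq_smul]
  rfl

end Pol

section Action

open LieAlgebra LieAlgebra.IsKilling LieModule Module

variable {𝔤 : Type*} [LieRing 𝔤] [LieAlgebra ℂ 𝔤] [FiniteDimensional ℂ 𝔤] [LieAlgebra.IsSimple ℂ 𝔤]
  {H : LieSubalgebra ℂ 𝔤} [H.IsCartanSubalgebra]

/-- For a root `θ` this is the scalar `r` for which the form `(a, b) = r κ(a, b)` satisfies
`(θ, θ) = 2`, equivalently `(h_θ, h_θ) = 2` for the coroot `h_θ`. -/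
def normalization (θ : H.root) : ℂ :=
  2 / killingForm ℂ 𝔤 ((rootSystem H).coroot θ : H) ((rootSystem H).coroot θ : H)

variable (b : (rootSystem H).Base) (S : Set b.support) (r : ℂ)

/-- `ū_nat = ū((t)) = 𝒦(ū)`, as a vector space. -/
abbrev UBar : Type _ := Laurent ⊗[ℂ] (oppNilradical b S)

/-- The inclusion `ū_nat → ĝ`. -/
def uIncl : UBar b S →ₗ[ℂ] Affine 𝔤 r :=
  Affine.incl 𝔤 r ∘ₗ (oppNilradical b S).subtype.lTensor Laurent

/-- The projection `ĝ → ū_nat` along `𝔭_nat`. -/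
def uProj : Affine 𝔤 r →ₗ[ℂ] UBar b S :=
  ((oppNilradical b S).projectionOnto (parabolic b S).toSubmodule
    (isCompl_oppNilradical_parabolic b S)).lTensor Laurent ∘ₗ Affine.loop 𝔤 r

/-- The natural parabolic subalgebra `𝔭_nat = 𝔭((t)) ⊕ ℂ c`. -/
def pNat : LieSubalgebra ℂ (Affine 𝔤 r) where
  toSubmodule := (LinearMap.range ((parabolic b S).toSubmodule.subtype.lTensor Laurent)).comap
    (Affine.loop 𝔤 r)
  lie_mem' := by
    rintro x y ⟨x', hx⟩ ⟨y', hy⟩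
    change Affine.loop 𝔤 r ⁅x, y⁆ ∈ LinearMap.range _
    rw [Affine.loop_lie, ← hx, ← hy]
    clear hx hy
    induction x' with
    | zero => simp
    | add u v hu hv => rw [map_add, add_lie]; exact add_mem hu hv
    | tmul f a =>
      induction y' with
      | zero => simp
      | add u v hu hv => rw [map_add, lie_add]; exact add_mem hu hv
      | tmul g b' =>
        refine ⟨(f * g) ⊗ₜ ⟨⁅(a : 𝔤), (b' : 𝔤)⁆, (parabolic b S).lie_mem a.2 b'.2⟩, ?_⟩
        exact (LieAlgebra.ExtendScalars.bracket_tmul ℂ Laurent 𝔤 𝔤 f g (a : 𝔤) (b' : 𝔤)).symm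

/-- The projection `ĝ → 𝔭_nat` along `ū_nat`. -/
def pProj : Affine 𝔤 r →ₗ[ℂ] pNat b S r :=
  LinearMap.codRestrict (pNat b S r).toSubmodule (LinearMap.id - uIncl b S r ∘ₗ uProj b S r) (by
    intro x
    change Affine.loop 𝔤 r x - (oppNilradical b S).subtype.lTensor Laurent
      (((oppNilradical b S).projectionOnto (parabolic b S).toSubmodule
        (isCompl_oppNilradical_parabolic b S)).lTensor Laurent (Affine.loop 𝔤 r x)) ∈
      LinearMap.range ((parabolic b S).toSubmodule.subtype.lTensor Laurent)
    induction Affine.loop 𝔤 r x with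
    | zero => simp
    | add u v hu hv =>
      rw [map_add, map_add, add_sub_add_comm]
      exact add_mem hu hv
    | tmul f a =>
      refine ⟨f ⊗ₜ ⟨a - ((oppNilradical b S).projectionOnto (parabolic b S).toSubmodule
        (isCompl_oppNilradical_parabolic b S) a : 𝔤), ?_⟩, ?_⟩
      · have hk := Submodule.ker_projectionOnto (isCompl_oppNilradical_parabolic b S)
        refine hk.le ?_
        rw [LinearMap.mem_ker, map_sub, Submodule.projectionOnto_apply_left, sub_self]
      · simp [TensorProduct.tmul_sub])

/-- The central element `c` of `𝔭_nat`. -/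
def pCentral : pNat b S r := ⟨Affine.c 𝔤 r, by
  change Affine.loop 𝔤 r (Affine.c 𝔤 r) ∈ LinearMap.range _
  exact Submodule.zero_mem _⟩

/-- `Pol Ω_𝒦(ū^*) = S(𝒦(ū))`, the polynomials in the symbols `∂_{x_{α, n}} = f_α ⊗ t ^ n`. -/
abbrev Pol : Type _ := SymmetricAlgebra ℂ (UBar b S)

/-- The operator `ad u(x)`, `u(x) = ∑ x_{α, n} f_{α, n}`, on `Pol ⊗ ĝ`. The element `x_{α, n}` of
the Weyl algebra acts on `Pol` as minus the partial derivative with respect to `∂_{x_{α, n}}`, so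
`ad u(x) (p ⊗ a) = - ∑ (∂p/∂w_i) ⊗ [w_i, a]` for a basis `w_i` of `ū_nat`. -/
def adU : Module.End ℂ (Pol b S ⊗[ℂ] Affine 𝔤 r) :=
  -((TensorProduct.lift ((LieModule.toEnd ℂ (Affine 𝔤 r) (Affine 𝔤 r)).toLinearMap ∘ₗ
      uIncl b S r)).lTensor (Pol b S) ∘ₗ
    (TensorProduct.assoc ℂ (Pol b S) (UBar b S) (Affine 𝔤 r)).toLinearMap ∘ₗ
    (symDiff (UBar b S)).rTensor (Affine 𝔤 r))

/-- The operator `e ^ (- ad u(x))` on `Pol ⊗ ĝ`. -/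
def expAdU : Module.End ℂ (Pol b S ⊗[ℂ] Affine 𝔤 r) :=
  evalSeries (PowerSeries.exp ℂ) (-adU b S r)

/-- The operator `ad u(x) e ^ (ad u(x)) / (e ^ (ad u(x)) - 1)` on `Pol ⊗ ĝ`; recall that
`bernoulli'PowerSeries ℂ` is the power series of `X e ^ X / (e ^ X - 1)`. -/
def toddAdU : Module.End ℂ (Pol b S ⊗[ℂ] Affine 𝔤 r) :=
  evalSeries (bernoulli'PowerSeries ℂ) (adU b S r)

variable {V : Type*} [AddCommGroup V] [Module ℂ V] (σ : pNat b S r →ₗ⁅ℂ⁆ Module.End ℂ V)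

/-- `p ↦ - ∑_{α, n} ∂_{x_{α, n}} [ad u(x) e ^ (ad u(x)) / (e ^ (ad u(x)) - 1)
(e ^ (- ad u(x)) a)_{ū_nat}]_{α, n} p` on `Pol`, where `∂_{x_{α, n}}` acts by multiplication. -/
def vectorFieldOp (a : Affine 𝔤 r) : Module.End ℂ (Pol b S) :=
  -(LinearMap.mul' ℂ (Pol b S) ∘ₗ
    (SymmetricAlgebra.ι ℂ (UBar b S) ∘ₗ uProj b S r).lTensor (Pol b S) ∘ₗ
    toddAdU b S r ∘ₗ
    (uIncl b S r ∘ₗ uProj b S r).lTensor (Pol b S) ∘ₗ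
    expAdU b S r ∘ₗ
    (TensorProduct.mk ℂ (Pol b S) (Affine 𝔤 r)).flip a)

/-- `p ⊗ v ↦ (e ^ (- ad u(x)) a)_{𝔭_nat} (p ⊗ v)` on `Pol ⊗ V`, where `𝔭_nat` acts on `V`. -/
def parabolicOp (a : Affine 𝔤 r) : Module.End ℂ (Pol b S ⊗[ℂ] V) :=
  (TensorProduct.lift (σ.toLinearMap ∘ₗ pProj b S r)).lTensor (Pol b S) ∘ₗ
    (TensorProduct.assoc ℂ (Pol b S) (Affine 𝔤 r) V).toLinearMap ∘ₗ
    (expAdU b S r ∘ₗ (TensorProduct.mk ℂ (Pol b S) (Affine 𝔤 r)).flip a).rTensor V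

/-- The operator by which `a ∈ ĝ` acts on the free field module `Pol Ω_𝒦(ū^*) ⊗ V`. -/
def freeFieldOp (a : Affine 𝔤 r) : Module.End ℂ (Pol b S ⊗[ℂ] V) :=
  (vectorFieldOp b S r a).rTensor V + parabolicOp b S r σ a

/-- The free field module `Pol Ω_𝒦(ū^*) ⊗ V`, as a vector space. -/
def FreeFieldModule (_σ : pNat b S r →ₗ⁅ℂ⁆ Module.End ℂ V) : Type _ := Pol b S ⊗[ℂ] V

namespace FreeFieldModule

instance : AddCommGroup (FreeFieldModule b S r σ) := inferInstanceAs (AddCommGroup (Pol b S ⊗[ℂ] V))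

instance : Module ℂ (FreeFieldModule b S r σ) := inferInstanceAs (Module ℂ (Pol b S ⊗[ℂ] V))

/-- The operator by which `a ∈ ĝ` acts on the free field module. -/
def op (a : Affine 𝔤 r) : Module.End ℂ (FreeFieldModule b S r σ) := freeFieldOp b S r σ a

/-- The map `((w_1, …, w_n), v) ↦ w_1 ⋯ w_n ⊗ v`. -/
def monomial (n : ℕ) (x : (Fin n → UBar b S) × V) : FreeFieldModule b S r σ :=
  (∏ i, SymmetricAlgebra.ι ℂ (UBar b S) (x.1 i)) ⊗ₜ[ℂ] x.2

/-- The finest linear topology for which all the maps `ū_nat ^ n × V → Pol ⊗ V`,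
`((w_1, …, w_n), v) ↦ w_1 ⋯ w_n ⊗ v`, are continuous. -/
instance [TopologicalSpace V] : TopologicalSpace (FreeFieldModule b S r σ) :=
  letI : TopologicalSpace (UBar b S) := tAdic (oppNilradical b S)
  finestLinear (monomial b S r σ)

instance [TopologicalSpace V] : IsTopologicalAddGroup (FreeFieldModule b S r σ) :=
  let _ : TopologicalSpace (UBar b S) := tAdic (oppNilradical b S)
  isTopologicalAddGroup_finestLinear _

instance [TopologicalSpace V] : IsLinearTopology ℂ (FreeFieldModule b S r σ) :=
  let _ : TopologicalSpace (UBar b S) := tAdic (oppNilradical b S)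
  isLinearTopology_finestLinear _

instance [TopologicalSpace V] : ContinuousConstSMul ℂ (FreeFieldModule b S r σ) :=
  let _ : TopologicalSpace (UBar b S) := tAdic (oppNilradical b S)
  continuousConstSMul_finestLinear _

end FreeFieldModule

/-- The relations `u x ⊗ v = u ⊗ x v`, `x ∈ U(𝔭_nat)`, that define the tensor product
`U(ĝ) ⊗_{U(𝔭_nat)} V` as a quotient of `U(ĝ) ⊗_ℂ V`. -/
def indRel : Submodule ℂ (UniversalEnvelopingAlgebra ℂ (Affine 𝔤 r) ⊗[ℂ] V) :=
  Submodule.span ℂ {z | ∃ (u : UniversalEnvelopingAlgebra ℂ (Affine 𝔤 r))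
    (x : UniversalEnvelopingAlgebra ℂ (pNat b S r)) (v : V),
    z = (u * UniversalEnvelopingAlgebra.lift ℂ
        ((UniversalEnvelopingAlgebra.ι ℂ).comp (pNat b S r).incl) x) ⊗ₜ v -
      u ⊗ₜ UniversalEnvelopingAlgebra.lift ℂ σ x v}

/-- The generalized imaginary Verma module `M(V) = U(ĝ) ⊗_{U(𝔭_nat)} V`. -/
def ImaginaryVerma : Type _ :=
  (UniversalEnvelopingAlgebra ℂ (Affine 𝔤 r) ⊗[ℂ] V) ⧸ indRel b S r σ

namespace ImaginaryVerma

instance : AddCommGroup (ImaginaryVerma b S r σ) :=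
  inferInstanceAs (AddCommGroup (_ ⧸ indRel b S r σ))

instance : Module ℂ (ImaginaryVerma b S r σ) :=
  inferInstanceAs (Module ℂ (_ ⧸ indRel b S r σ))

/-- The class of `u ⊗ v`. -/
def mk : UniversalEnvelopingAlgebra ℂ (Affine 𝔤 r) ⊗[ℂ] V →ₗ[ℂ] ImaginaryVerma b S r σ :=
  (indRel b S r σ).mkQ

/-- Left multiplication by `u' ∈ U(ĝ)`, `u ⊗ v ↦ u' u ⊗ v`. -/
def mulLeft (u' : UniversalEnvelopingAlgebra ℂ (Affine 𝔤 r)) :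
    Module.End ℂ (ImaginaryVerma b S r σ) :=
  (indRel b S r σ).mapQ (indRel b S r σ) ((LinearMap.mulLeft ℂ u').rTensor V) (by
    rw [indRel, Submodule.span_le]
    rintro _ ⟨u, x, v, rfl⟩
    refine Submodule.subset_span ⟨u' * u, x, v, ?_⟩
    simp [mul_assoc])

theorem mulLeft_mk (u' u : UniversalEnvelopingAlgebra ℂ (Affine 𝔤 r)) (v : V) :
    mulLeft b S r σ u' (mk b S r σ (u ⊗ₜ v)) = mk b S r σ ((u' * u) ⊗ₜ v) := rfl

theorem hom_ext {E : Type*} [AddCommGroup E] [Module ℂ E]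
    {f g : ImaginaryVerma b S r σ →ₗ[ℂ] E}
    (h : ∀ u v, f (mk b S r σ (u ⊗ₜ v)) = g (mk b S r σ (u ⊗ₜ v))) : f = g :=
  Submodule.linearMap_qext _ (TensorProduct.ext' h)

/-- The action of `ĝ` on `M(V)` by left multiplication. -/
def act : Affine 𝔤 r →ₗ⁅ℂ⁆ Module.End ℂ (ImaginaryVerma b S r σ) where
  toFun a := mulLeft b S r σ (UniversalEnvelopingAlgebra.ι ℂ a)
  map_add' a a' := hom_ext b S r σ fun u v => by
    rw [LinearMap.add_apply, mulLeft_mk, mulLeft_mk, mulLeft_mk, map_add, add_mul,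
      TensorProduct.add_tmul, map_add]
  map_smul' t a := hom_ext b S r σ fun u v => by
    rw [RingHom.id_apply, LinearMap.smul_apply, mulLeft_mk, mulLeft_mk, map_smul, smul_mul_assoc,
      ← TensorProduct.smul_tmul', map_smul]
  map_lie' {a a'} := hom_ext b S r σ fun u v => by
    rw [LieRing.of_associative_ring_bracket, LinearMap.sub_apply, Module.End.mul_apply,
      Module.End.mul_apply, mulLeft_mk, mulLeft_mk, mulLeft_mk, mulLeft_mk, mulLeft_mk,
      LieHom.map_lie, LieRing.of_associative_ring_bracket, sub_mul, TensorProduct.sub_tmul,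
      map_sub, mul_assoc, mul_assoc]

/-- The map `((a_1, …, a_n), v) ↦ a_1 ⋯ a_n ⊗ v`. -/
def monomial (n : ℕ) (x : (Fin n → Affine 𝔤 r) × V) : ImaginaryVerma b S r σ :=
  mk b S r σ ((List.ofFn fun i => UniversalEnvelopingAlgebra.ι ℂ (x.1 i)).prod ⊗ₜ[ℂ] x.2)

/-- The finest linear topology for which all the maps `ĝ ^ n × V → M(V)`,
`((a_1, …, a_n), v) ↦ a_1 ⋯ a_n ⊗ v`, are continuous. -/
instance [TopologicalSpace V] : TopologicalSpace (ImaginaryVerma b S r σ) :=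
  finestLinear (monomial b S r σ)

instance [TopologicalSpace V] : IsTopologicalAddGroup (ImaginaryVerma b S r σ) :=
  isTopologicalAddGroup_finestLinear _

instance [TopologicalSpace V] : IsLinearTopology ℂ (ImaginaryVerma b S r σ) :=
  isLinearTopology_finestLinear _

instance [TopologicalSpace V] : ContinuousConstSMul ℂ (ImaginaryVerma b S r σ) :=
  continuousConstSMul_finestLinear _

end ImaginaryVerma

end Action
end FreeField

end

/-!
The geometric idea is that of a flag manifold. Let `L = i(W) ⊕ P` be a Lie algebra that splits into
a subalgebra `i(W)` with nilpotent adjoint action on `L` and a subalgebra `P`. In the coordinates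
`w ↦ e ^ (-i(w)) P` on the big cell, `L` acts by vector fields on `W` and, with values in a
`P`-module `V`, by these fields together with `P`-valued functions. The operators of the theorem
are the formal Fourier transform of this action: a linear map `SA W → X` is regarded as the Taylor
series of a function on `W` with values in `X`, the comultiplication of `SA W` provides the
pointwise products (`conv`), and composition with `fieldOp ξ` is the derivative along the vector
field `ξ`.

*The representation.* Put `T(w) = -i(w)`. Then `e ^ (-ad T) a` is a function with values in `L`
(`expFun`), and its projection to `P` is the function `parFun a`. The vector field of `a` is the
one whose image under the Maurer--Cartan form `(1 - e ^ (-ad T)) / ad T` is the projection of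
`e ^ (-ad T) a` to `i(W)` (`thetaAd_vectorFun`); the Todd series of the definition inverts that
form. The commutation relations (`vectorFun_lie`, `parFun_lie`, `freeOp_lie`) then follow from the
formula for the logarithmic derivative of the exponential (`derivation_expAd`) and the
Maurer--Cartan equation (`derivation_thetaAd`).

*The isomorphism.* One has `i(w) (w ^ n ⊗ v) = -w ^ (n + 1) ⊗ v`, and `P` acts on `1 ⊗ V` as on
`V`. Hence `u ⊗ v ↦ u (1 ⊗ v)` is a map of the induced module to `SA W ⊗ V` (`toFree`) that has as a
right inverse the map `w ^ n ⊗ v ↦ (-w) ^ n ⊗ v`, which is symmetrization up to signs (`ofFree`).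
The latter is surjective by a reordering argument (`range_ofFree`), so that the two maps are
inverse to each other; the Poincaré--Birkhoff--Witt theorem is not used.

*The topology.* For both modules the action is continuous on the spanning monomials, and this
implies joint continuity, since `𝔤[[t]]` is a linearly compact open subspace of `ĝ`
(`continuous_bilin_of_finestLinear`). The map `toFree` is continuous because monomials are iterated
actions on `1 ⊗ v`, and `ofFree` because `n` times the symmetrization of a product `w_1 ⋯ w_n` is
the sum of the `w_i` times the symmetrizations of the products of the other factors
(`smul_symMap_prod`). An element of the free field module involves only finite-dimensional
subspaces of `W` and `V`, which embed in discrete quotients; this gives the Hausdorff property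
(`t2Space_free`).
-/

noncomputable section

namespace FreeField

open Finset.HasAntidiagonal (antidiagonal mem_antidiagonal)

/-! ### Power series in a nilpotent operator -/

section EvalSeries

variable {E : Type*} [AddCommGroup E] [Module ℂ E] {T : Module.End ℂ E}

theorem evalSeries_eq_sum (F : PowerSeries ℂ) {n : ℕ} (h : T ^ n = 0) :
    evalSeries F T = ∑ j ∈ Finset.range n, PowerSeries.coeff j F • T ^ j := by
  have h0 : T ^ nilpotencyClass T = 0 := pow_nilpotencyClass ⟨n, h⟩
  refine Finset.sum_subset (Finset.range_mono (Nat.sInf_le h)) fun j _ hj => ?_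
  rw [pow_eq_zero_of_le (not_lt.mp (Finset.mem_range.not.mp hj)) h0, smul_zero]

theorem evalSeries_eq_aeval (F : PowerSeries ℂ) {n : ℕ} (h : T ^ n = 0) :
    evalSeries F T = Polynomial.aeval T (PowerSeries.trunc (n + 1) F) := by
  rw [evalSeries_eq_sum F h, Polynomial.aeval_eq_sum_range' (n := n + 1)
    (PowerSeries.natDegree_trunc_lt _ _), Finset.sum_range_succ, h, smul_zero, add_zero]
  refine Finset.sum_congr rfl fun j hj => ?_
  rw [PowerSeries.coeff_trunc, if_pos ((Finset.mem_range.mp hj).trans n.lt_succ_self)]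

theorem aeval_eq_of_coeff_eq {p q : Polynomial ℂ} {n : ℕ} (h : T ^ n = 0)
    (hpq : ∀ j < n, p.coeff j = q.coeff j) : Polynomial.aeval T p = Polynomial.aeval T q := by
  obtain ⟨s, hs⟩ : Polynomial.X ^ n ∣ p - q := by
    rw [Polynomial.X_pow_dvd_iff]
    intro d hd
    rw [Polynomial.coeff_sub, hpq d hd, sub_self]
  rw [← sub_eq_zero, ← map_sub, hs, map_mul, map_pow, Polynomial.aeval_X, h, zero_mul]

theorem evalSeries_mul (F G : PowerSeries ℂ) (h : IsNilpotent T) :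
    evalSeries (F * G) T = evalSeries F T * evalSeries G T := by
  obtain ⟨n, hn⟩ := h
  rw [evalSeries_eq_aeval _ hn, evalSeries_eq_aeval _ hn, evalSeries_eq_aeval _ hn, ← map_mul]
  refine aeval_eq_of_coeff_eq hn fun j hj => ?_
  rw [PowerSeries.coeff_trunc, if_pos (by omega), PowerSeries.coeff_mul, Polynomial.coeff_mul]
  refine Finset.sum_congr rfl fun p hp => ?_
  have := mem_antidiagonal.mp hp
  rw [PowerSeries.coeff_trunc, PowerSeries.coeff_trunc, if_pos (by omega), if_pos (by omega)]

theorem evalSeries_one (h : IsNilpotent T) : evalSeries 1 T = 1 := by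
  obtain ⟨n, hn⟩ := h
  have hn' : T ^ (n + 1) = 0 := by rw [pow_succ, hn, zero_mul]
  rw [evalSeries_eq_sum _ hn', Finset.sum_range_succ']
  simp [PowerSeries.coeff_one]

/-- A power series in nilpotent operators is compatible with linear maps that intertwine the
operators. -/
theorem evalSeries_intertwine {E' : Type*} [AddCommGroup E'] [Module ℂ E'] {T' : Module.End ℂ E'}
    (F : PowerSeries ℂ) (hT : IsNilpotent T) (hT' : IsNilpotent T') (f : E →ₗ[ℂ] E')
    (hf : ∀ x, f (T x) = T' (f x)) (x : E) : f (evalSeries F T x) = evalSeries F T' (f x) := by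
  obtain ⟨n, hn⟩ := hT
  obtain ⟨m, hm⟩ := hT'
  have hpow : ∀ (j : ℕ) (x : E), f ((T ^ j) x) = (T' ^ j) (f x) := by
    intro j
    induction j with
    | zero => intro x; rfl
    | succ j ih => intro x; rw [pow_succ, pow_succ, Module.End.mul_apply, Module.End.mul_apply,
        ih, hf]
  rw [evalSeries_eq_sum F (pow_eq_zero_of_le (le_max_left n m) hn),
    evalSeries_eq_sum F (pow_eq_zero_of_le (le_max_right n m) hm)]
  simp only [LinearMap.sum_apply, LinearMap.smul_apply, map_sum, map_smul, hpow]

theorem evalSeries_apply_of_eq_zero (F : PowerSeries ℂ)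
    (hT : IsNilpotent T) {x : E} (hx : T x = 0) :
    evalSeries F T x = PowerSeries.coeff 0 F • x := by
  obtain ⟨n, hn⟩ := hT
  have hn' : T ^ (n + 1) = 0 := by rw [pow_succ, hn, zero_mul]
  rw [evalSeries_eq_sum _ hn', Finset.sum_range_succ', LinearMap.add_apply, LinearMap.sum_apply,
    Finset.sum_eq_zero, zero_add]
  · simp
  · intro j _
    rw [LinearMap.smul_apply, pow_succ, Module.End.mul_apply, hx, map_zero, smul_zero]

theorem evalSeries_mem (F : PowerSeries ℂ)
    {M : Submodule ℂ E} (h : ∀ x ∈ M, T x ∈ M) {x : E} (hx : x ∈ M) :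
    evalSeries F T x ∈ M := by
  have key : ∀ j, (T ^ j) x ∈ M := by
    intro j
    induction j with
    | zero => exact hx
    | succ j ih => rw [pow_succ', Module.End.mul_apply]; exact h _ ih
  rw [evalSeries, LinearMap.sum_apply]
  exact Submodule.sum_mem _ fun j _ => Submodule.smul_mem _ _ (key j)

end EvalSeries

/-! ### The derivative of the exponential map -/

section MaurerCartan

/-- The power series of `(1 - e ^ (-X)) / X`. -/
def thetaSeries : PowerSeries ℂ := PowerSeries.mk fun n => (-1) ^ n * ((n + 1).factorial : ℂ)⁻¹

theorem bernoulli'_mul_thetaSeries : bernoulli'PowerSeries ℂ * thetaSeries = 1 := by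
  have h1 : (PowerSeries.exp ℂ - 1) = PowerSeries.X * thetaSeries * PowerSeries.exp ℂ := by
    have hx : PowerSeries.X * thetaSeries = 1 - PowerSeries.evalNegHom (PowerSeries.exp ℂ) := by
      ext n
      rcases n with - | n
      · rw [PowerSeries.coeff_zero_X_mul, map_sub, PowerSeries.evalNegHom,
          PowerSeries.coeff_rescale, PowerSeries.coeff_exp]
        simp
      · rw [PowerSeries.coeff_succ_X_mul, thetaSeries, PowerSeries.coeff_mk, map_sub,
          PowerSeries.evalNegHom, PowerSeries.coeff_rescale, PowerSeries.coeff_exp]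
        simp [PowerSeries.coeff_one, pow_succ]
    rw [hx, sub_mul, one_mul, mul_comm, PowerSeries.exp_mul_exp_neg_eq_one]
  have h2 := bernoulli'PowerSeries_mul_exp_sub_one ℂ
  rw [h1] at h2
  have hu : PowerSeries.exp ℂ ≠ 0 := by
    intro h
    have := congrArg (PowerSeries.coeff 0) h
    simp at this
  apply mul_left_cancel₀ (PowerSeries.X_ne_zero (R := ℂ))
  apply mul_right_cancel₀ hu
  calc _ = _ := by ring
    _ = _ := h2
    _ = _ := by ring

/-- Multiplication of the degree `n + 1` part of a product by `n + 1`, distributed over the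
factors. Identities between homogeneous parts are proved by induction on the degree in this way. -/
theorem succ_smul_sum_antidiagonal_succ {E : Type*} [AddCommGroup E] [Module ℂ E]
    (f : ℕ → ℕ → E) (n : ℕ) :
    ((n : ℂ) + 1) • ∑ p ∈ antidiagonal (n + 1), f p.1 p.2
      = ∑ p ∈ antidiagonal n, (((p.1 : ℂ) + 1) • f (p.1 + 1) p.2
          + ((p.2 : ℂ) + 1) • f p.1 (p.2 + 1)) := by
  have h1 := Finset.Nat.sum_antidiagonal_succ (n := n) (f := fun p => (p.1 : ℂ) • f p.1 p.2)
  have h2 := Finset.Nat.sum_antidiagonal_succ' (n := n) (f := fun p => (p.2 : ℂ) • f p.1 p.2)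
  simp only [Nat.cast_zero, zero_smul, zero_add, Nat.cast_add, Nat.cast_one] at h1 h2
  rw [Finset.sum_add_distrib, ← h1, ← h2, ← Finset.sum_add_distrib, Finset.smul_sum]
  refine Finset.sum_congr rfl fun p hp => ?_
  rw [← add_smul]
  congr 1
  have := mem_antidiagonal.mp hp
  exact_mod_cast this.symm

/-- A product of two sums with `K` terms, arranged by degree. -/
theorem sum_range_sum_antidiagonal {E : Type*} [AddCommGroup E] (f : ℕ → ℕ → E) (K : ℕ)
    (h1 : ∀ i j, K ≤ i → f i j = 0) (h2 : ∀ i j, K ≤ j → f i j = 0) :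
    ∑ n ∈ Finset.range (2 * K), ∑ p ∈ antidiagonal n, f p.1 p.2
      = ∑ i ∈ Finset.range K, ∑ j ∈ Finset.range K, f i j := by
  rw [← Finset.sum_product', Finset.sum_sigma']
  symm
  refine Finset.sum_of_injOn (fun p : ℕ × ℕ => (⟨p.1 + p.2, p⟩ : (_ : ℕ) × (ℕ × ℕ))) ?_ ?_ ?_ ?_
  · rintro ⟨i, j⟩ _ ⟨i', j'⟩ _ h
    simp only [Sigma.mk.injEq] at h
    exact eq_of_heq h.2
  · rintro ⟨i, j⟩ h
    simp only [Finset.coe_product, Finset.coe_range, Set.mem_prod, Set.mem_Iio] at h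
    simp
    omega
  · rintro ⟨n, i, j⟩ hn h
    simp only [Finset.mem_sigma, Finset.mem_range, mem_antidiagonal] at hn
    by_cases hi : K ≤ i
    · exact h1 _ _ hi
    by_cases hj : K ≤ j
    · exact h2 _ _ hj
    refine absurd ⟨(i, j), ?_, ?_⟩ h
    · simp; omega
    · simp only [Sigma.mk.injEq]
      exact ⟨hn.2, by simp⟩
  · intro p _; rfl

variable {𝓛 : Type*} [LieRing 𝓛]

theorem lie_sum_sum {ι κ : Type*} (s : Finset ι) (t : Finset κ) (f : ι → 𝓛) (g : κ → 𝓛) :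
    ⁅∑ i ∈ s, f i, ∑ j ∈ t, g j⁆ = ∑ i ∈ s, ∑ j ∈ t, ⁅f i, g j⁆ := by
  rw [sum_lie]
  exact Finset.sum_congr rfl fun i _ => lie_sum _ _ _

variable [LieAlgebra ℂ 𝓛] (T : 𝓛)

/-- The homogeneous parts of `e ^ (-ad T)`. -/
def expTerm (n : ℕ) : Module.End ℂ 𝓛 :=
  ((-1) ^ n * (n.factorial : ℂ)⁻¹) • (LieAlgebra.ad ℂ 𝓛 T) ^ n

/-- The homogeneous parts of `(1 - e ^ (-ad T)) / ad T`. The index is shifted: the term `n` has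
degree `n - 1` in `ad T`, and degree `n` in `T` once it is applied to a derivative of `T`. -/
def thetaTerm : ℕ → Module.End ℂ 𝓛
  | 0 => 0
  | n + 1 => ((-1) ^ n * ((n + 1).factorial : ℂ)⁻¹) • (LieAlgebra.ad ℂ 𝓛 T) ^ n

theorem succ_smul_expTerm (n : ℕ) (x : 𝓛) :
    ((n : ℂ) + 1) • expTerm T (n + 1) x = -⁅T, expTerm T n x⁆ := by
  have h : ((n : ℂ) + 1) ≠ 0 := by exact_mod_cast n.succ_ne_zero
  rw [expTerm, expTerm, pow_succ' (LieAlgebra.ad ℂ 𝓛 T), LinearMap.smul_apply,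
    LinearMap.smul_apply, Module.End.mul_apply, LieAlgebra.ad_apply, lie_smul, smul_smul,
    ← neg_smul]
  congr 1
  rw [Nat.factorial_succ, pow_succ]
  push_cast
  field_simp

theorem succ_smul_thetaTerm (n : ℕ) (x : 𝓛) :
    ((n : ℂ) + 1) • thetaTerm T (n + 1) x = expTerm T n x := by
  have h : ((n : ℂ) + 1) ≠ 0 := by exact_mod_cast n.succ_ne_zero
  rw [expTerm, thetaTerm, LinearMap.smul_apply, LinearMap.smul_apply, smul_smul]
  congr 1
  rw [Nat.factorial_succ]
  push_cast
  field_simp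

theorem lie_thetaTerm_succ (n : ℕ) (x : 𝓛) :
    ⁅T, thetaTerm T (n + 1) x⁆ = -expTerm T (n + 1) x := by
  rw [expTerm, thetaTerm, LinearMap.smul_apply, LinearMap.smul_apply,
    pow_succ' (LieAlgebra.ad ℂ 𝓛 T), Module.End.mul_apply, LieAlgebra.ad_apply, lie_smul,
    ← neg_smul, pow_succ]
  congr 1
  ring

theorem lie_thetaTerm (n : ℕ) (x : 𝓛) :
    ⁅T, thetaTerm T n x⁆ = -expTerm T n x + if n = 0 then x else 0 := by
  cases n with
  | zero => simp [thetaTerm, expTerm]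
  | succ n => rw [lie_thetaTerm_succ]; simp

theorem expTerm_lie (n : ℕ) (x y : 𝓛) : expTerm T n ⁅x, y⁆
    = ∑ p ∈ antidiagonal n, ⁅expTerm T p.1 x, expTerm T p.2 y⁆ := by
  induction n with
  | zero => simp [expTerm]
  | succ n ih =>
    have h : ((n : ℂ) + 1) ≠ 0 := by exact_mod_cast n.succ_ne_zero
    refine (smul_right_injective 𝓛 h) ?_
    simp only
    rw [succ_smul_sum_antidiagonal_succ (fun i j => ⁅expTerm T i x, expTerm T j y⁆),
      succ_smul_expTerm, ih, lie_sum, ← Finset.sum_neg_distrib]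
    refine Finset.sum_congr rfl fun p _ => ?_
    rw [← smul_lie, ← lie_smul, succ_smul_expTerm, succ_smul_expTerm, leibniz_lie, neg_lie, lie_neg,
      neg_add]

variable {T} {D D' : 𝓛 →ₗ[ℂ] 𝓛} (hD : ∀ x y, D ⁅x, y⁆ = ⁅D x, y⁆ + ⁅x, D y⁆)
  (hD' : ∀ x y, D' ⁅x, y⁆ = ⁅D' x, y⁆ + ⁅x, D' y⁆)

include hD in
/-- The homogeneous parts of `derivation_expAd`. -/
theorem derivation_expTerm (n : ℕ) (x : 𝓛) : D (expTerm T n x) = expTerm T n (D x)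
    - ∑ p ∈ antidiagonal n, ⁅thetaTerm T p.1 (D T), expTerm T p.2 x⁆ := by
  induction n with
  | zero => simp [expTerm, thetaTerm]
  | succ n ih =>
    have h : ((n : ℂ) + 1) ≠ 0 := by exact_mod_cast n.succ_ne_zero
    refine (smul_right_injective 𝓛 h) ?_
    simp only
    rw [smul_sub,
      succ_smul_sum_antidiagonal_succ (fun i j => ⁅thetaTerm T i (D T), expTerm T j x⁆),
      succ_smul_expTerm, ← map_smul, succ_smul_expTerm, map_neg, hD, ih, lie_sub, lie_sum]
    have h0 : ∑ p ∈ antidiagonal n,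
        ⁅(if p.1 = 0 then D T else 0), expTerm T p.2 x⁆ = ⁅D T, expTerm T n x⁆ := by
      rw [Finset.sum_eq_single (0, n)]
      · simp
      · rintro ⟨i, j⟩ hij hne
        have hi : i ≠ 0 := by
          rintro rfl
          exact hne (by simpa using hij)
        simp [hi]
      · simp
    have h1 : ∀ p ∈ antidiagonal n, ⁅T, ⁅thetaTerm T p.1 (D T), expTerm T p.2 x⁆⁆
        = ⁅(if p.1 = 0 then D T else 0), expTerm T p.2 x⁆
          - (((p.1 : ℂ) + 1) • ⁅thetaTerm T (p.1 + 1) (D T), expTerm T p.2 x⁆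
            + ((p.2 : ℂ) + 1) • ⁅thetaTerm T p.1 (D T), expTerm T (p.2 + 1) x⁆) := by
      intro p _
      rw [← smul_lie, ← lie_smul, succ_smul_expTerm, succ_smul_thetaTerm, leibniz_lie,
        lie_thetaTerm, add_lie, neg_lie, lie_neg]
      abel
    rw [Finset.sum_congr rfl h1, Finset.sum_sub_distrib, h0]
    abel

include hD hD' in
/-- The homogeneous parts of `derivation_thetaAd`. -/
theorem derivation_thetaTerm (n : ℕ) :
    D (thetaTerm T n (D' T)) - thetaTerm T n (D (D' T))
      - (D' (thetaTerm T n (D T)) - thetaTerm T n (D' (D T)))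
      + ∑ p ∈ antidiagonal n, ⁅thetaTerm T p.1 (D T), thetaTerm T p.2 (D' T)⁆ = 0 := by
  cases n with
  | zero => simp [thetaTerm]
  | succ n =>
    have h : ((n : ℂ) + 1) ≠ 0 := by exact_mod_cast n.succ_ne_zero
    refine (smul_right_injective 𝓛 h) ?_
    simp only [smul_zero]
    rw [smul_add,
      succ_smul_sum_antidiagonal_succ (fun i j => ⁅thetaTerm T i (D T), thetaTerm T j (D' T)⁆)]
    have e : ∀ (F : 𝓛 →ₗ[ℂ] 𝓛) (x : 𝓛),
        ((n : ℂ) + 1) • F (thetaTerm T (n + 1) x) = F (expTerm T n x) := by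
      intro F x
      rw [← map_smul, succ_smul_thetaTerm]
    have e' : ∀ p ∈ antidiagonal n,
        (((p.1 : ℂ) + 1) • ⁅thetaTerm T (p.1 + 1) (D T), thetaTerm T p.2 (D' T)⁆
          + ((p.2 : ℂ) + 1) • ⁅thetaTerm T p.1 (D T), thetaTerm T (p.2 + 1) (D' T)⁆)
        = ⁅thetaTerm T p.1 (D T), expTerm T p.2 (D' T)⁆
          - ⁅thetaTerm T p.2 (D' T), expTerm T p.1 (D T)⁆ := by
      intro p _
      rw [← smul_lie, ← lie_smul, succ_smul_thetaTerm, succ_smul_thetaTerm,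
        ← lie_skew (expTerm T p.1 (D T))]
      abel
    have e'' : ∑ p ∈ antidiagonal n, ⁅thetaTerm T p.2 (D' T), expTerm T p.1 (D T)⁆
        = ∑ p ∈ antidiagonal n, ⁅thetaTerm T p.1 (D' T), expTerm T p.2 (D T)⁆ :=
      Finset.sum_nbij' Prod.swap Prod.swap (by simp [add_comm]) (by simp [add_comm]) (by simp)
        (by simp) (by simp)
    rw [Finset.sum_congr rfl e', Finset.sum_sub_distrib, e'']
    simp only [smul_sub, e, succ_smul_thetaTerm]
    rw [derivation_expTerm hD, derivation_expTerm hD']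
    abel

variable (T) in
/-- The automorphism `e ^ (-ad T)`. -/
def expAd : Module.End ℂ 𝓛 := evalSeries (PowerSeries.exp ℂ) (-LieAlgebra.ad ℂ 𝓛 T)

variable (T) in
/-- The operator `(1 - e ^ (-ad T)) / ad T`, which expresses the derivative of the exponential map
at `T` through left translation. -/
def thetaAd : Module.End ℂ 𝓛 := evalSeries thetaSeries (LieAlgebra.ad ℂ 𝓛 T)

theorem expTerm_eq_zero {n K : ℕ} (h : LieAlgebra.ad ℂ 𝓛 T ^ K = 0) (hn : K ≤ n) :
    expTerm T n = 0 := by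
  rw [expTerm, pow_eq_zero_of_le hn h, smul_zero]

theorem thetaTerm_eq_zero {n K : ℕ} (h : LieAlgebra.ad ℂ 𝓛 T ^ K = 0) (hn : K + 1 ≤ n) :
    thetaTerm T n = 0 := by
  obtain ⟨m, rfl⟩ := Nat.exists_eq_succ_of_ne_zero (show n ≠ 0 by omega)
  rw [thetaTerm, pow_eq_zero_of_le (by omega) h, smul_zero]

theorem expAd_apply {K : ℕ} (h : LieAlgebra.ad ℂ 𝓛 T ^ K = 0) (x : 𝓛) :
    expAd T x = ∑ n ∈ Finset.range K, expTerm T n x := by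
  rw [expAd, evalSeries_eq_sum _ (n := K) (by rw [neg_pow, h, mul_zero]), LinearMap.sum_apply]
  refine Finset.sum_congr rfl fun n _ => ?_
  rw [expTerm, neg_pow, PowerSeries.coeff_exp, ← neg_one_smul ℂ (1 : Module.End ℂ 𝓛), smul_pow,
    one_pow, smul_one_mul, smul_smul, mul_comm]
  simp

theorem thetaAd_apply {K : ℕ} (h : LieAlgebra.ad ℂ 𝓛 T ^ K = 0) (x : 𝓛) :
    thetaAd T x = ∑ n ∈ Finset.range (K + 1), thetaTerm T n x := by
  rw [thetaAd, evalSeries_eq_sum _ h, LinearMap.sum_apply, Finset.sum_range_succ']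
  simp [thetaTerm, thetaSeries]

section

variable (hT : IsNilpotent (LieAlgebra.ad ℂ 𝓛 T))

include hT

/-- A common bound: `K` terms suffice for `expAd` and, because of the shifted index, also for
`thetaAd`; products of the two have `2 * K` terms. -/
theorem exists_pow_ad_eq_zero :
    ∃ K, 1 ≤ K ∧ LieAlgebra.ad ℂ 𝓛 T ^ (K - 1) = 0 ∧ LieAlgebra.ad ℂ 𝓛 T ^ K = 0 ∧
      LieAlgebra.ad ℂ 𝓛 T ^ (2 * K) = 0 ∧ LieAlgebra.ad ℂ 𝓛 T ^ (2 * K - 1) = 0 := by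
  obtain ⟨K, hK⟩ := hT
  exact ⟨K + 1, by omega, hK, pow_eq_zero_of_le (by omega) hK, pow_eq_zero_of_le (by omega) hK,
    pow_eq_zero_of_le (by omega) hK⟩

theorem expAd_lie (x y : 𝓛) : expAd T ⁅x, y⁆ = ⁅expAd T x, expAd T y⁆ := by
  obtain ⟨K, h1, h2, h3, h4, h5⟩ := exists_pow_ad_eq_zero hT
  rw [expAd_apply h4, expAd_apply h3, expAd_apply h3, lie_sum_sum]
  simp only [expTerm_lie]
  exact sum_range_sum_antidiagonal (fun i j => ⁅expTerm T i x, expTerm T j y⁆) K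
    (fun i j hi => by rw [expTerm_eq_zero h3 hi]; simp)
    (fun i j hj => by rw [expTerm_eq_zero h3 hj]; simp)

include hD in
/-- The logarithmic derivative of `e ^ (-ad T)`. -/
theorem derivation_expAd (x : 𝓛) :
    D (expAd T x) = expAd T (D x) - ⁅thetaAd T (D T), expAd T x⁆ := by
  obtain ⟨K, h1, h2, h3, h4, h5⟩ := exists_pow_ad_eq_zero hT
  have hθ := thetaAd_apply h2
  rw [Nat.sub_add_cancel h1] at hθ
  have hs := sum_range_sum_antidiagonal (fun i j => ⁅thetaTerm T i (D T), expTerm T j x⁆) K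
    (fun i j hi => by rw [thetaTerm_eq_zero h2 (by omega)]; simp)
    (fun i j hj => by rw [expTerm_eq_zero h3 hj]; simp)
  rw [← lie_sum_sum, ← hθ, ← expAd_apply h3] at hs
  rw [← hs, expAd_apply h4, expAd_apply h4, map_sum, ← Finset.sum_sub_distrib]
  exact Finset.sum_congr rfl fun n _ => derivation_expTerm hD n x

include hD hD' in
/-- The Maurer--Cartan equation for the form `thetaAd`. -/
theorem derivation_thetaAd :
    D (thetaAd T (D' T)) - D' (thetaAd T (D T)) + ⁅thetaAd T (D T), thetaAd T (D' T)⁆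
      = thetaAd T (D (D' T) - D' (D T)) := by
  obtain ⟨K, h1, h2, h3, h4, h5⟩ := exists_pow_ad_eq_zero hT
  have hθ := thetaAd_apply h2
  have hθ' := thetaAd_apply h5
  rw [Nat.sub_add_cancel h1] at hθ
  rw [Nat.sub_add_cancel (by omega)] at hθ'
  have hs := sum_range_sum_antidiagonal
    (fun i j => ⁅thetaTerm T i (D T), thetaTerm T j (D' T)⁆) K
    (fun i j hi => by rw [thetaTerm_eq_zero h2 (by omega)]; simp)
    (fun i j hj => by rw [thetaTerm_eq_zero (n := j) h2 (by omega)]; simp)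
  rw [← lie_sum_sum, ← hθ, ← hθ] at hs
  rw [← hs, hθ', hθ', hθ', map_sum, map_sum, ← Finset.sum_sub_distrib, ← Finset.sum_add_distrib]
  refine Finset.sum_congr rfl fun n _ => ?_
  have := derivation_thetaTerm hD hD' n (T := T)
  rw [map_sub, ← sub_eq_zero, ← this]
  abel

/-- The Todd series inverts `thetaAd`. -/
theorem thetaAd_todd (x : 𝓛) :
    thetaAd T (evalSeries (bernoulli'PowerSeries ℂ) (LieAlgebra.ad ℂ 𝓛 T) x) = x := by
  rw [thetaAd, ← Module.End.mul_apply, ← evalSeries_mul _ _ hT, mul_comm,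
    bernoulli'_mul_thetaSeries, evalSeries_one hT, Module.End.one_apply]

theorem todd_thetaAd (x : 𝓛) :
    evalSeries (bernoulli'PowerSeries ℂ) (LieAlgebra.ad ℂ 𝓛 T) (thetaAd T x) = x := by
  rw [thetaAd, ← Module.End.mul_apply, ← evalSeries_mul _ _ hT,
    bernoulli'_mul_thetaSeries, evalSeries_one hT, Module.End.one_apply]

end

end MaurerCartan

/-! ### Formal functions on a vector space -/

section FormalFunctions

open SymmetricAlgebra (ι)
open Coalgebra (comul counit)

variable {W : Type*} [AddCommGroup W] [Module ℂ W]

variable (W) in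
/-- The symmetric algebra of `W`. A linear map `F : SA W →ₗ[ℂ] X` is regarded as a formal function
on `W` with values in `X`, namely as the Taylor series `w ↦ ∑ F (w ^ n) / n!` at the origin.
Pointwise products of functions correspond to the convolution `conv`. -/
abbrev SA : Type _ := SymmetricAlgebra ℂ W

/-- Induction over products of elements of `W`. For functions this is the comparison of Taylor
series: the step `ι_mul` passes to a partial derivative. -/
theorem sa_induction {motive : SA W → Prop} (one : motive 1)
    (smul : ∀ (r : ℂ) p, motive p → motive (r • p))
    (add : ∀ p q, motive p → motive q → motive (p + q))
    (ι_mul : ∀ w p, motive p → motive (ι ℂ W w * p)) (p : SA W) : motive p := by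
  have key : ∀ p q : SA W, motive q → motive (p * q) := by
    intro p
    induction p using SymmetricAlgebra.induction with
    | algebraMap r => intro q hq; rw [← Algebra.smul_def]; exact smul r q hq
    | ι w => exact ι_mul w
    | mul a b ha hb => intro q hq; rw [mul_assoc]; exact ha _ (hb _ hq)
    | add a b ha hb => intro q hq; rw [add_mul]; exact add _ _ (ha _ hq) (hb _ hq)
  have := key p 1 one
  rwa [mul_one] at this

section

variable {X Y Z : Type*} [AddCommGroup X] [Module ℂ X] [AddCommGroup Y] [Module ℂ Y]
  [AddCommGroup Z] [Module ℂ Z]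

/-- The partial derivative of a formal function in the direction `w`. -/
def shift (w : W) (F : SA W →ₗ[ℂ] X) : SA W →ₗ[ℂ] X := F ∘ₗ LinearMap.mulLeft ℂ (ι ℂ W w)

theorem shift_apply (w : W) (F : SA W →ₗ[ℂ] X) (p : SA W) : shift w F p = F (ι ℂ W w * p) := rfl

/-- The map `p ↦ ∑ p_(1) ⊗ F p_(2)`, the comodule map that corresponds to `F`. -/
def tilde (F : SA W →ₗ[ℂ] X) : SA W →ₗ[ℂ] SA W ⊗[ℂ] X := F.lTensor (SA W) ∘ₗ comul

theorem tilde_one (F : SA W →ₗ[ℂ] X) : tilde F 1 = 1 ⊗ₜ F 1 := by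
  simp [tilde, Algebra.TensorProduct.one_def]

theorem comul_ι_mul (w : W) (p : SA W) : comul (R := ℂ) (ι ℂ W w * p)
    = (ι ℂ W w ⊗ₜ[ℂ] 1) * comul (R := ℂ) p + (1 ⊗ₜ[ℂ] ι ℂ W w) * comul (R := ℂ) p := by
  rw [Bialgebra.comul_mul, SymmetricAlgebra.comul_ι, add_mul]

theorem tilde_ι_mul (F : SA W →ₗ[ℂ] X) (w : W) (p : SA W) :
    tilde F (ι ℂ W w * p) = ι ℂ W w • tilde F p + tilde (shift w F) p := by
  simp only [tilde, LinearMap.comp_apply, comul_ι_mul, map_add]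
  generalize comul (R := ℂ) p = z
  congr 1
  · induction z with
    | zero => simp
    | add x y hx hy => simp only [mul_add, map_add, hx, hy, smul_add]
    | tmul x y => simp [TensorProduct.smul_tmul']
  · induction z with
    | zero => simp
    | add x y hx hy => simp only [mul_add, map_add, hx, hy]
    | tmul x y => simp [shift]

theorem tilde_add (F G : SA W →ₗ[ℂ] X) : tilde (F + G) = tilde F + tilde G := by
  simp [tilde, LinearMap.lTensor_add, LinearMap.add_comp]

theorem tilde_smul (r : ℂ) (F : SA W →ₗ[ℂ] X) : tilde (r • F) = r • tilde F := by
  simp [tilde, LinearMap.lTensor_smul, LinearMap.smul_comp]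

theorem tilde_comp (f : X →ₗ[ℂ] Y) (F : SA W →ₗ[ℂ] X) (p : SA W) :
    tilde (f ∘ₗ F) p = f.lTensor (SA W) (tilde F p) := by
  simp [tilde, LinearMap.lTensor_comp]

/-- The pointwise product of two formal functions with respect to a bilinear map. -/
def conv (B : X →ₗ[ℂ] Y →ₗ[ℂ] Z) (F : SA W →ₗ[ℂ] X) (G : SA W →ₗ[ℂ] Y) : SA W →ₗ[ℂ] Z :=
  TensorProduct.lift B ∘ₗ TensorProduct.map F G ∘ₗ comul

variable (B : X →ₗ[ℂ] Y →ₗ[ℂ] Z)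

theorem conv_one (F : SA W →ₗ[ℂ] X) (G : SA W →ₗ[ℂ] Y) : conv B F G 1 = B (F 1) (G 1) := by
  simp [conv, Algebra.TensorProduct.one_def]

/-- The Leibniz rule for the derivative in a constant direction. -/
theorem conv_ι_mul (F : SA W →ₗ[ℂ] X) (G : SA W →ₗ[ℂ] Y) (w : W) (p : SA W) :
    conv B F G (ι ℂ W w * p) = conv B (shift w F) G p + conv B F (shift w G) p := by
  simp only [conv, LinearMap.comp_apply, comul_ι_mul, map_add]
  generalize comul (R := ℂ) p = z
  congr 1
  · induction z with
    | zero => simp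
    | add x y hx hy => simp only [mul_add, map_add, hx, hy]
    | tmul x y => simp [shift]
  · induction z with
    | zero => simp
    | add x y hx hy => simp only [mul_add, map_add, hx, hy]
    | tmul x y => simp [shift]

theorem shift_conv (F : SA W →ₗ[ℂ] X) (G : SA W →ₗ[ℂ] Y) (w : W) :
    shift w (conv B F G) = conv B (shift w F) G + conv B F (shift w G) :=
  LinearMap.ext fun p => conv_ι_mul B F G w p

theorem conv_add_left (F F' : SA W →ₗ[ℂ] X) (G : SA W →ₗ[ℂ] Y) :
    conv B (F + F') G = conv B F G + conv B F' G := by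
  simp [conv, TensorProduct.map_add_left, LinearMap.add_comp, LinearMap.comp_add]

theorem conv_add_right (F : SA W →ₗ[ℂ] X) (G G' : SA W →ₗ[ℂ] Y) :
    conv B F (G + G') = conv B F G + conv B F G' := by
  simp [conv, TensorProduct.map_add_right, LinearMap.add_comp, LinearMap.comp_add]

theorem conv_smul_right (r : ℂ) (F : SA W →ₗ[ℂ] X) (G : SA W →ₗ[ℂ] Y) :
    conv B F (r • G) = r • conv B F G := by
  simp [conv, TensorProduct.map_smul_right, LinearMap.smul_comp, LinearMap.comp_smul]

theorem conv_mem {F : SA W →ₗ[ℂ] X} {G : SA W →ₗ[ℂ] Y} {M : Submodule ℂ Z}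
    (h : ∀ p q, B (F p) (G q) ∈ M) (p : SA W) : conv B F G p ∈ M := by
  rw [conv, LinearMap.comp_apply, LinearMap.comp_apply]
  induction comul (R := ℂ) p with
  | zero => simp
  | add x y hx hy => rw [map_add, map_add]; exact add_mem hx hy
  | tmul x y => simpa using h x y

/-- The constant function with value `x`. -/
def constFun (x : X) : SA W →ₗ[ℂ] X := (counit (R := ℂ) (A := SA W)).smulRight x

theorem constFun_one (x : X) : (constFun x : SA W →ₗ[ℂ] X) 1 = x := by simp [constFun]

theorem constFun_ι_mul (x : X) (w : W) (p : SA W) : constFun x (ι ℂ W w * p) = 0 := by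
  simp [constFun]

theorem shift_constFun (x : X) (w : W) : shift w (constFun x) = 0 :=
  LinearMap.ext fun p => constFun_ι_mul x w p

theorem tilde_zero : tilde (0 : SA W →ₗ[ℂ] X) = 0 := by simp [tilde]

theorem tilde_constFun (x : X) (p : SA W) : tilde (constFun x) p = p ⊗ₜ x := by
  induction p using sa_induction with
  | one => rw [tilde_one, constFun_one]
  | smul r p hp => rw [map_smul, hp, TensorProduct.smul_tmul']
  | add p q hp hq => rw [map_add, hp, hq, TensorProduct.add_tmul]
  | ι_mul w p hp =>
    rw [tilde_ι_mul, hp, shift_constFun, tilde_zero, LinearMap.zero_apply, add_zero,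
      TensorProduct.smul_tmul', smul_eq_mul]

theorem conv_constFun_left (x : X) (G : SA W →ₗ[ℂ] Y) : conv B (constFun x) G = B x ∘ₗ G := by
  ext p
  rw [LinearMap.comp_apply]
  induction p using sa_induction generalizing G with
  | one => rw [conv_one, constFun_one]
  | smul r p hp => simp only [map_smul, hp]
  | add p q hp hq => simp only [map_add, hp, hq]
  | ι_mul w p hp =>
    have h0 : conv B (0 : SA W →ₗ[ℂ] X) G = 0 := by simp [conv]
    rw [conv_ι_mul, shift_constFun, h0, LinearMap.zero_apply, zero_add, hp, shift_apply]

end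

/-! ### Vector fields -/

section VectorFields

variable {X Y Z : Type*} [AddCommGroup X] [Module ℂ X] [AddCommGroup Y] [Module ℂ Y]
  [AddCommGroup Z] [Module ℂ Z]

/-- The operator `p ↦ ∑ p_(1) ξ(p_(2))` on the symmetric algebra; the transposed map
`F ↦ F ∘ fieldOp ξ` is the derivative of formal functions along the vector field `ξ`. -/
def fieldOp (ξ : SA W →ₗ[ℂ] W) : Module.End ℂ (SA W) :=
  LinearMap.mul' ℂ (SA W) ∘ₗ (ι ℂ W).lTensor (SA W) ∘ₗ tilde ξ

theorem fieldOp_one (ξ : SA W →ₗ[ℂ] W) : fieldOp ξ 1 = ι ℂ W (ξ 1) := by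
  simp [fieldOp, tilde_one]

theorem mul'_smul (p : SA W) (z : SA W ⊗[ℂ] W) :
    LinearMap.mul' ℂ (SA W) ((ι ℂ W).lTensor (SA W) (p • z))
      = p * LinearMap.mul' ℂ (SA W) ((ι ℂ W).lTensor (SA W) z) := by
  induction z with
  | zero => simp
  | add x y hx hy => simp only [smul_add, map_add, hx, hy, mul_add]
  | tmul x y => simp [TensorProduct.smul_tmul', mul_assoc]

theorem fieldOp_ι_mul (ξ : SA W →ₗ[ℂ] W) (w : W) (p : SA W) :
    fieldOp ξ (ι ℂ W w * p) = ι ℂ W w * fieldOp ξ p + fieldOp (shift w ξ) p := by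
  simp only [fieldOp, LinearMap.comp_apply, tilde_ι_mul, map_add, mul'_smul]

theorem fieldOp_add (ξ η : SA W →ₗ[ℂ] W) : fieldOp (ξ + η) = fieldOp ξ + fieldOp η := by
  simp [fieldOp, tilde_add, LinearMap.comp_add]

theorem fieldOp_smul (r : ℂ) (ξ : SA W →ₗ[ℂ] W) : fieldOp (r • ξ) = r • fieldOp ξ := by
  simp [fieldOp, tilde_smul, LinearMap.comp_smul]

theorem counit_fieldOp (ξ : SA W →ₗ[ℂ] W) (p : SA W) : counit (R := ℂ) (fieldOp ξ p) = 0 := by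
  rw [fieldOp, LinearMap.comp_apply, LinearMap.comp_apply]
  induction tilde ξ p with
  | zero => simp
  | add x y hx hy => simp only [map_add, hx, hy, add_zero]
  | tmul x y => simp

theorem shift_comp_fieldOp (F : SA W →ₗ[ℂ] X) (ξ : SA W →ₗ[ℂ] W) (w : W) :
    shift w (F ∘ₗ fieldOp ξ) = shift w F ∘ₗ fieldOp ξ + F ∘ₗ fieldOp (shift w ξ) := by
  ext p
  simp only [shift_apply, LinearMap.comp_apply, LinearMap.add_apply, fieldOp_ι_mul, map_add]

theorem constFun_comp_fieldOp (x : X) (ξ : SA W →ₗ[ℂ] W) : constFun x ∘ₗ fieldOp ξ = 0 := by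
  ext p
  simp [constFun, counit_fieldOp]

/-- The derivative along a vector field is a derivation of the pointwise products. -/
theorem conv_comp_fieldOp (B : X →ₗ[ℂ] Y →ₗ[ℂ] Z) (F : SA W →ₗ[ℂ] X) (G : SA W →ₗ[ℂ] Y)
    (ξ : SA W →ₗ[ℂ] W) :
    conv B F G ∘ₗ fieldOp ξ = conv B (F ∘ₗ fieldOp ξ) G + conv B F (G ∘ₗ fieldOp ξ) := by
  ext p
  rw [LinearMap.comp_apply, LinearMap.add_apply]
  induction p using sa_induction generalizing F G ξ with
  | one =>
    rw [fieldOp_one, ← mul_one (ι ℂ W (ξ 1)), conv_ι_mul, conv_one, conv_one, conv_one, conv_one]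
    simp [shift_apply, fieldOp_one]
  | smul r p hp => simp only [map_smul, hp, smul_add]
  | add p q hp hq => simp only [map_add, hp, hq]; abel
  | ι_mul w p hp =>
    simp only [fieldOp_ι_mul, map_add, conv_ι_mul, hp, shift_comp_fieldOp, conv_add_left,
      conv_add_right, LinearMap.add_apply]
    abel

/-- The commutator of vector fields, arranged without subtractions. -/
theorem fieldOp_fieldOp (ξ η : SA W →ₗ[ℂ] W) (p : SA W) :
    fieldOp ξ (fieldOp η p) + fieldOp (η ∘ₗ fieldOp ξ) p
      = fieldOp η (fieldOp ξ p) + fieldOp (ξ ∘ₗ fieldOp η) p := by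
  induction p using sa_induction generalizing ξ η with
  | one =>
    simp only [fieldOp_one, LinearMap.comp_apply]
    rw [← mul_one (ι ℂ W (ξ 1)), fieldOp_ι_mul, ← mul_one (ι ℂ W (η 1)), fieldOp_ι_mul]
    simp only [fieldOp_one, shift_apply, mul_one]
    rw [mul_comm]
    abel
  | smul r p hp => simp only [map_smul, ← smul_add, hp]
  | add p q hp hq =>
    simp only [map_add]
    rw [add_add_add_comm, hp, hq, add_add_add_comm]
  | ι_mul w p hp =>
    have h1 := congrArg (ι ℂ W w * ·) (hp ξ η)
    have h2 := hp ξ (shift w η)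
    have h3 := hp (shift w ξ) η
    simp only [fieldOp_ι_mul, map_add, shift_comp_fieldOp, fieldOp_add, LinearMap.add_apply,
      mul_add] at h1 h2 h3 ⊢
    linear_combination (exp := 1) h1 + h2 + h3

variable (W) in
/-- The tautological function `w ↦ w`. -/
def tautFun : SA W →ₗ[ℂ] W :=
  (TensorProduct.lid ℂ W).toLinearMap ∘ₗ (counit (R := ℂ) (A := SA W)).rTensor W ∘ₗ symDiff W

theorem symDiff_one : symDiff W 1 = 0 := by simp [symDiff]

theorem symDiff_ι_mul (w : W) (p : SA W) :
    symDiff W (ι ℂ W w * p) = ι ℂ W w • symDiff W p + p ⊗ₜ w := by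
  rw [symDiff_mul, symDiff_ι, TensorProduct.smul_tmul', smul_eq_mul, mul_one]

theorem tautFun_one : tautFun W 1 = 0 := by simp [tautFun, symDiff_one]

theorem tautFun_ι_mul (w : W) (p : SA W) :
    tautFun W (ι ℂ W w * p) = counit (R := ℂ) p • w := by
  rw [tautFun, LinearMap.comp_apply, LinearMap.comp_apply, symDiff_ι_mul, map_add, map_add]
  have : (counit (R := ℂ) (A := SA W)).rTensor W (ι ℂ W w • symDiff W p) = 0 := by
    induction symDiff W p with
    | zero => simp
    | add x y hx hy => rw [smul_add, map_add, hx, hy, add_zero]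
    | tmul x y => simp [TensorProduct.smul_tmul']
  rw [this]
  simp

/-- The derivative of the tautological function along `ξ` is `ξ`. -/
theorem tautFun_comp_fieldOp (ξ : SA W →ₗ[ℂ] W) : tautFun W ∘ₗ fieldOp ξ = ξ := by
  ext p
  rw [LinearMap.comp_apply]
  induction p using sa_induction generalizing ξ with
  | one => rw [fieldOp_one, ← mul_one (ι ℂ W _), tautFun_ι_mul]; simp
  | smul r p hp => simp only [map_smul, hp]
  | add p q hp hq => simp only [map_add, hp, hq]
  | ι_mul w p hp =>
    rw [fieldOp_ι_mul, map_add, tautFun_ι_mul, counit_fieldOp, hp, zero_smul, zero_add,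
      shift_apply]

end VectorFields

/-! ### Functions with values in operators -/

section Operators

/-- The bracket of a Lie algebra as a bilinear map. -/
def lieMap (L : Type*) [LieRing L] [LieAlgebra ℂ L] : L →ₗ[ℂ] L →ₗ[ℂ] L :=
  (LieAlgebra.ad ℂ L).toLinearMap

theorem lieMap_apply {L : Type*} [LieRing L] [LieAlgebra ℂ L] (x y : L) : lieMap L x y = ⁅x, y⁆ :=
  rfl

variable {X V : Type*} [AddCommGroup X] [Module ℂ X] [AddCommGroup V] [Module ℂ V]

/-- The operator `p ⊗ v ↦ ∑ p_(1) ⊗ B(A(p_(2))) v`. -/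
def actOp (B : X →ₗ[ℂ] Module.End ℂ V) (A : SA W →ₗ[ℂ] X) : Module.End ℂ (SA W ⊗[ℂ] V) :=
  (TensorProduct.lift B).lTensor (SA W) ∘ₗ (TensorProduct.assoc ℂ (SA W) X V).toLinearMap ∘ₗ
    (tilde A).rTensor V

variable (B : X →ₗ[ℂ] Module.End ℂ V) (A : SA W →ₗ[ℂ] X)

theorem actOp_one (v : V) : actOp B A (1 ⊗ₜ v) = 1 ⊗ₜ B (A 1) v := by
  simp [actOp, tilde_one]

theorem actOp_ι_mul (w : W) (p : SA W) (v : V) : actOp B A ((ι ℂ W w * p) ⊗ₜ v)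
    = ι ℂ W w • actOp B A (p ⊗ₜ v) + actOp B (shift w A) (p ⊗ₜ v) := by
  simp only [actOp, LinearMap.comp_apply, LinearMap.rTensor_tmul, tilde_ι_mul,
    TensorProduct.add_tmul, map_add]
  congr 1
  induction tilde A p with
  | zero => simp
  | add x y hx hy => simp only [smul_add, TensorProduct.add_tmul, map_add, hx, hy]
  | tmul x y => simp [TensorProduct.smul_tmul']

theorem actOp_ι_smul (w : W) (z : SA W ⊗[ℂ] V) : actOp B A (ι ℂ W w • z)
    = ι ℂ W w • actOp B A z + actOp B (shift w A) z := by
  induction z with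
  | zero => simp
  | add x y hx hy => simp only [smul_add, map_add, hx, hy]; abel
  | tmul x y => rw [TensorProduct.smul_tmul', smul_eq_mul, actOp_ι_mul]

theorem actOp_add (A' : SA W →ₗ[ℂ] X) : actOp B (A + A') = actOp B A + actOp B A' := by
  simp [actOp, tilde_add, LinearMap.rTensor_add, LinearMap.comp_add]

theorem actOp_smul (r : ℂ) : actOp B (r • A) = r • actOp B A := by
  simp [actOp, tilde_smul, LinearMap.rTensor_smul, LinearMap.comp_smul]

theorem rTensor_fieldOp_ι_smul (ξ : SA W →ₗ[ℂ] W) (w : W) (z : SA W ⊗[ℂ] V) :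
    (fieldOp ξ).rTensor V (ι ℂ W w • z)
      = ι ℂ W w • (fieldOp ξ).rTensor V z + (fieldOp (shift w ξ)).rTensor V z := by
  induction z with
  | zero => simp
  | add x y hx hy => simp only [smul_add, map_add, hx, hy]; abel
  | tmul x y => simp [TensorProduct.smul_tmul', fieldOp_ι_mul, TensorProduct.add_tmul]

theorem sa_tensor_induction {motive : SA W ⊗[ℂ] V → Prop} (one : ∀ v, motive (1 ⊗ₜ v))
    (smul : ∀ (r : ℂ) p, motive p → motive (r • p))
    (add : ∀ p q, motive p → motive q → motive (p + q))
    (ι_smul : ∀ w p, motive p → motive (ι ℂ W w • p)) (z : SA W ⊗[ℂ] V) : motive z := by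
  induction z with
  | zero => simpa using one 0
  | add x y hx hy => exact add _ _ hx hy
  | tmul p v =>
    induction p using sa_induction with
    | one => exact one v
    | smul r p hp => rw [← TensorProduct.smul_tmul']; exact smul r _ hp
    | add p q hp hq => rw [TensorProduct.add_tmul]; exact add _ _ hp hq
    | ι_mul w p hp => rw [← smul_eq_mul, ← TensorProduct.smul_tmul']; exact ι_smul w _ hp

/-- The commutator of a multiplication operator with a vector field is the multiplication by the
derivative. -/
theorem actOp_fieldOp (ξ : SA W →ₗ[ℂ] W) (z : SA W ⊗[ℂ] V) :
    actOp B A ((fieldOp ξ).rTensor V z)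
      = (fieldOp ξ).rTensor V (actOp B A z) + actOp B (A ∘ₗ fieldOp ξ) z := by
  induction z using sa_tensor_induction generalizing A ξ with
  | one v =>
    rw [LinearMap.rTensor_tmul, fieldOp_one, ← mul_one (ι ℂ W (ξ 1)), actOp_ι_mul, actOp_one,
      actOp_one, actOp_one, LinearMap.rTensor_tmul, fieldOp_one, TensorProduct.smul_tmul',
      LinearMap.comp_apply, fieldOp_one, shift_apply, smul_eq_mul, mul_one]
  | smul r p hp => simp only [map_smul, hp, smul_add]
  | add p q hp hq => simp only [map_add, hp, hq]; abel
  | ι_smul w p hp =>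
    simp only [rTensor_fieldOp_ι_smul, map_add, actOp_ι_smul, hp, shift_comp_fieldOp, actOp_add,
      LinearMap.add_apply, smul_add]
    abel

theorem actOp_actOp {P : Type*} [LieRing P] [LieAlgebra ℂ P] (σ : P →ₗ⁅ℂ⁆ Module.End ℂ V)
    (A A' : SA W →ₗ[ℂ] P) (z : SA W ⊗[ℂ] V) :
    actOp σ.toLinearMap A (actOp σ.toLinearMap A' z)
        - actOp σ.toLinearMap A' (actOp σ.toLinearMap A z)
      = actOp σ.toLinearMap (conv (lieMap P) A A') z := by
  induction z using sa_tensor_induction generalizing A A' with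
  | one v =>
    simp only [actOp_one, conv_one, lieMap_apply]
    rw [← TensorProduct.tmul_sub]
    simp [LieRing.of_associative_ring_bracket]
  | smul r p hp => simp only [map_smul, ← smul_sub, hp]
  | add p q hp hq => simp only [map_add, ← hp, ← hq]; abel
  | ι_smul w p hp =>
    simp only [map_add, actOp_ι_smul, ← hp, shift_conv, actOp_add, LinearMap.add_apply, smul_sub]
    abel

end Operators

/-! ### The Lie algebra of formal functions with values in a Lie algebra -/

section FunLie

variable (W) (L : Type*) [LieRing L] [LieAlgebra ℂ L]

/-- The Lie algebra of formal functions on `W` with values in `L`, with the pointwise bracket. -/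
def FunLie : Type _ := SA W →ₗ[ℂ] L

namespace FunLie

instance : AddCommGroup (FunLie W L) := inferInstanceAs (AddCommGroup (SA W →ₗ[ℂ] L))

instance : Module ℂ (FunLie W L) := inferInstanceAs (Module ℂ (SA W →ₗ[ℂ] L))

variable {W L}

/-- The underlying linear map. -/
def toLin (F : FunLie W L) : SA W →ₗ[ℂ] L := F

/-- A linear map as an element of `FunLie`. -/
def ofLin (F : SA W →ₗ[ℂ] L) : FunLie W L := F

/-- The constant functions. -/
def const : L →ₗ[ℂ] FunLie W L where
  toFun a := ofLin (constFun a)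
  map_add' a b := LinearMap.ext fun p => by
    change constFun (a + b) p = constFun a p + constFun b p
    simp [constFun]
  map_smul' r a := LinearMap.ext fun p => by
    exact smul_comm _ _ _

instance : Bracket (FunLie W L) (FunLie W L) where
  bracket F G := conv (lieMap L) F.toLin G.toLin

theorem lie_def (F G : FunLie W L) :
    ⁅F, G⁆.toLin = conv (lieMap L) F.toLin G.toLin := rfl

theorem conv_ad_self (F : SA W →ₗ[ℂ] L) (p : SA W) :
    conv (lieMap L) F F p = 0 := by
  have key : ∀ (F G : SA W →ₗ[ℂ] L), conv (lieMap L) F G p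
      + conv (lieMap L) G F p = 0 := by
    induction p using sa_induction with
    | one => intro F G; rw [conv_one, conv_one, lieMap_apply, lieMap_apply, ← lie_skew, neg_add_cancel]
    | smul r p hp => intro F G; rw [map_smul, map_smul, ← smul_add, hp, smul_zero]
    | add p q hp hq => intro F G; rw [map_add, map_add, add_add_add_comm, hp, hq, add_zero]
    | ι_mul w p hp =>
      intro F G
      rw [conv_ι_mul, conv_ι_mul, add_comm (conv _ (shift w G) F p), add_add_add_comm, hp, hp,
        add_zero]
  have h := key F F
  rw [← two_smul ℂ] at h
  exact (smul_eq_zero.mp h).resolve_left two_ne_zero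

theorem conv_ad_leibniz (F G K : SA W →ₗ[ℂ] L) (p : SA W) :
    conv (lieMap L) F (conv (lieMap L) G K) p
      = conv (lieMap L) (conv (lieMap L) F G) K p
        + conv (lieMap L) G (conv (lieMap L) F K) p := by
  induction p using sa_induction generalizing F G K with
  | one => simp only [conv_one, lieMap_apply]; exact leibniz_lie _ _ _
  | smul r p hp => rw [map_smul, map_smul, map_smul, hp, smul_add]
  | add p q hp hq => rw [map_add, map_add, map_add, hp, hq]; abel
  | ι_mul w p hp =>
    simp only [conv_ι_mul, shift_conv, conv_add_left, conv_add_right, LinearMap.add_apply]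
    rw [hp, hp F (shift w G), hp F G]
    abel

instance : LieRing (FunLie W L) where
  add_lie _ _ _ := conv_add_left _ _ _ _
  lie_add _ _ _ := conv_add_right _ _ _ _
  lie_self F := LinearMap.ext fun p => conv_ad_self F p
  leibniz_lie F G K := LinearMap.ext fun p => conv_ad_leibniz F G K p

instance : LieAlgebra ℂ (FunLie W L) where
  lie_smul _ _ _ := conv_smul_right _ _ _ _

/-- The derivative of `L`-valued functions along a vector field. -/
def deriv (ξ : SA W →ₗ[ℂ] W) : FunLie W L →ₗ[ℂ] FunLie W L where
  toFun F := F.toLin ∘ₗ fieldOp ξ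
  map_add' _ _ := rfl
  map_smul' _ _ := rfl

theorem deriv_lie (ξ : SA W →ₗ[ℂ] W) (F G : FunLie W L) :
    deriv ξ ⁅F, G⁆ = ⁅deriv ξ F, G⁆ + ⁅F, deriv ξ G⁆ :=
  conv_comp_fieldOp _ F.toLin G.toLin ξ

end FunLie

end FunLie

end FormalFunctions

/-! ### The free field representation of a split Lie algebra -/

section FreeFieldRep

open SymmetricAlgebra (ι)

/-- A decomposition `L = i(W) ⊕ P` of a Lie algebra into a subalgebra `i(W)` whose adjoint action
on `L` is nilpotent, and a subalgebra `P`. The image of `i` is a subalgebra by `i_q_lie`, and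
the submodules `I k` witness the nilpotency. -/
structure Splitting (W L : Type*) [AddCommGroup W] [Module ℂ W] [LieRing L] [LieAlgebra ℂ L]
    (P : LieSubalgebra ℂ L) where
  /-- The inclusion of the first summand. -/
  i : W →ₗ[ℂ] L
  /-- The projection to the first summand. -/
  q : L →ₗ[ℂ] W
  /-- The projection to the second summand. -/
  pr : L →ₗ[ℂ] P
  q_i : ∀ w, q (i w) = w
  i_q_add_pr : ∀ x, i (q x) + (pr x : L) = x
  q_coe : ∀ x : P, q x = 0
  i_q_lie : ∀ w w', i (q ⁅i w, i w'⁆) = ⁅i w, i w'⁆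
  nilpotent : ∃ I : ℕ → Submodule ℂ L, I 0 = ⊤ ∧ (∀ k w, ∀ x ∈ I k, ⁅i w, x⁆ ∈ I (k + 1)) ∧
    ∃ n, I n = ⊥

variable {W L : Type*} [AddCommGroup W] [Module ℂ W] [LieRing L] [LieAlgebra ℂ L]
  {P : LieSubalgebra ℂ L} (s : Splitting W L P)

namespace Splitting

theorem coe_pr (x : L) : (s.pr x : L) = x - s.i (s.q x) := by
  rw [eq_sub_iff_add_eq, add_comm, s.i_q_add_pr]

theorem pr_i (w : W) : s.pr (s.i w) = 0 := by
  apply Subtype.ext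
  rw [coe_pr, s.q_i, sub_self]
  rfl

theorem pr_coe (x : P) : s.pr (x : L) = x := by
  apply Subtype.ext
  rw [coe_pr, s.q_coe, map_zero, sub_zero]

/-- The operator `ad u`, `p ⊗ a ↦ -∑ (∂p/∂w_i) ⊗ [w_i, a]`. -/
def adOp : Module.End ℂ (SA W ⊗[ℂ] L) :=
  -((TensorProduct.lift ((LieModule.toEnd ℂ L L).toLinearMap ∘ₗ s.i)).lTensor (SA W) ∘ₗ
    (TensorProduct.assoc ℂ (SA W) W L).toLinearMap ∘ₗ (symDiff W).rTensor L)

theorem adOp_one (a : L) : s.adOp (1 ⊗ₜ a) = 0 := by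
  simp [adOp, symDiff_one]

theorem adOp_ι_mul (w : W) (p : SA W) (a : L) :
    s.adOp ((ι ℂ W w * p) ⊗ₜ a) = ι ℂ W w • s.adOp (p ⊗ₜ a) - p ⊗ₜ ⁅s.i w, a⁆ := by
  simp only [adOp, LinearMap.neg_apply, LinearMap.comp_apply, LinearMap.rTensor_tmul,
    symDiff_ι_mul, TensorProduct.add_tmul, map_add, neg_add, smul_neg, sub_eq_add_neg]
  congr 2
  induction symDiff W p with
  | zero => simp
  | add x y hx hy => simp only [smul_add, TensorProduct.add_tmul, map_add, hx, hy]
  | tmul x y => simp [TensorProduct.smul_tmul']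

theorem adOp_ι_smul (w : W) (z : SA W ⊗[ℂ] L) : s.adOp (ι ℂ W w • z)
    = ι ℂ W w • s.adOp z - (lieMap L (s.i w)).lTensor (SA W) z := by
  induction z with
  | zero => simp
  | add x y hx hy => simp only [smul_add, map_add, hx, hy]; abel
  | tmul x y => rw [TensorProduct.smul_tmul', smul_eq_mul, adOp_ι_mul]; rfl

theorem isNilpotent_adOp : IsNilpotent s.adOp := by
  obtain ⟨I, hI, hs, n, hn⟩ := s.nilpotent
  refine ⟨n, ?_⟩
  have key : ∀ k z, (s.adOp ^ k) z ∈ LinearMap.range ((I k).subtype.lTensor (SA W)) := by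
    intro k
    induction k with
    | zero =>
      intro z
      induction z with
      | zero => exact Submodule.zero_mem _
      | add x y hx hy => exact add_mem hx hy
      | tmul p a => exact ⟨p ⊗ₜ ⟨a, by rw [hI]; trivial⟩, rfl⟩
    | succ k ih =>
      intro z
      rw [pow_succ', Module.End.mul_apply]
      obtain ⟨y, hy⟩ := ih z
      rw [← hy]
      clear hy
      induction y with
      | zero => simp
      | add x y hx hy => rw [map_add, map_add]; exact add_mem hx hy
      | tmul p a =>
        rw [LinearMap.lTensor_tmul, adOp, LinearMap.neg_apply]
        refine neg_mem ?_
        rw [LinearMap.comp_apply, LinearMap.comp_apply, LinearMap.rTensor_tmul]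
        induction symDiff W p with
        | zero => simp
        | add x y hx hy => rw [TensorProduct.add_tmul, map_add, map_add]; exact add_mem hx hy
        | tmul x y => exact ⟨x ⊗ₜ ⟨_, hs k y a a.2⟩, by simp⟩
  ext1
  ext p a
  obtain ⟨y, hy⟩ := key n (p ⊗ₜ a)
  simp only [TensorProduct.AlgebraTensorModule.curry_apply, TensorProduct.curry_apply,
    LinearMap.coe_restrictScalars, LinearMap.zero_apply]
  have h0 : (I n).subtype = 0 := by
    ext x
    exact (Submodule.mem_bot ℂ).mp (hn.le x.2)
  rw [← hy, h0]
  simp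

/-- The function `w ↦ -i(w)`. -/
def tautField : FunLie W L := FunLie.ofLin (-(s.i ∘ₗ tautFun W))

/-- The map `tilde` carries the bracket with the function `w ↦ -i(w)` to the operator `ad u`. -/
theorem adOp_tilde (F : SA W →ₗ[ℂ] L) (p : SA W) :
    s.adOp (tilde F p) = tilde (⁅s.tautField, FunLie.ofLin F⁆.toLin) p := by
  have h : ∀ w, shift w (s.tautField.toLin) = constFun (-s.i w) := by
    intro w
    ext p
    simp only [tautField, FunLie.toLin]
    change -(s.i (tautFun W (ι ℂ W w * p))) = _
    rw [tautFun_ι_mul, map_smul]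
    simp [constFun]
  have h1 : s.tautField.toLin 1 = 0 := by
    change -(s.i (tautFun W 1)) = _
    rw [tautFun_one, map_zero, neg_zero]
  induction p using sa_induction generalizing F with
  | one =>
    rw [tilde_one, tilde_one, adOp_one]
    change _ = 1 ⊗ₜ conv (lieMap L) s.tautField.toLin F 1
    rw [conv_one, h1, map_zero, LinearMap.zero_apply, TensorProduct.tmul_zero]
  | smul r p hp => simp only [map_smul, hp]
  | add p q hp hq => simp only [map_add, hp, hq]
  | ι_mul w p hp =>
    rw [tilde_ι_mul, map_add, adOp_ι_smul, hp, hp, tilde_ι_mul]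
    change _ = _ + tilde (shift w (conv (lieMap L) s.tautField.toLin F)) p
    rw [shift_conv, tilde_add, h, conv_constFun_left, LinearMap.add_apply, tilde_comp, map_neg,
      LinearMap.lTensor_neg, LinearMap.neg_apply, sub_add_eq_add_sub, sub_eq_add_neg, add_assoc,
      add_comm (tilde _ p)]
    rfl

theorem isNilpotent_ad_tautField : IsNilpotent (LieAlgebra.ad ℂ (FunLie W L) s.tautField) := by
  obtain ⟨I, hI, hs, n, hn⟩ := s.nilpotent
  refine ⟨n, ?_⟩
  have key : ∀ k (F : FunLie W L) p,
      ((LieAlgebra.ad ℂ (FunLie W L) s.tautField ^ k) F).toLin p ∈ I k := by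
    intro k
    induction k with
    | zero => intro F p; rw [hI]; trivial
    | succ k ih =>
      intro F p
      rw [pow_succ', Module.End.mul_apply, LieAlgebra.ad_apply, FunLie.lie_def]
      refine conv_mem _ (fun x y => ?_) p
      rw [lieMap_apply]
      change ⁅-s.i (tautFun W x), _⁆ ∈ _
      rw [neg_lie]
      exact neg_mem (hs _ _ _ (ih F y))
  refine LinearMap.ext fun F => LinearMap.ext fun p => ?_
  have := key n F p
  rw [hn] at this
  exact (Submodule.mem_bot ℂ).mp this

/-- The operator `e ^ (-ad u)`. -/
def expOp : Module.End ℂ (SA W ⊗[ℂ] L) := evalSeries (PowerSeries.exp ℂ) (-s.adOp)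

/-- The operator `ad u e ^ (ad u) / (e ^ (ad u) - 1)`. -/
def toddOp : Module.End ℂ (SA W ⊗[ℂ] L) := evalSeries (bernoulli'PowerSeries ℂ) s.adOp

theorem expOp_tilde (F : FunLie W L) (p : SA W) :
    s.expOp (tilde F.toLin p) = tilde (expAd s.tautField F).toLin p := by
  refine (evalSeries_intertwine _ s.isNilpotent_ad_tautField.neg s.isNilpotent_adOp.neg
    { toFun := fun F : FunLie W L => tilde F.toLin p
      map_add' := fun F G => by
        rw [← LinearMap.add_apply, ← tilde_add]; rfl
      map_smul' := fun r F => by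
        rw [RingHom.id_apply, ← LinearMap.smul_apply, ← tilde_smul]; rfl } ?_ F).symm
  intro F
  rw [LinearMap.coe_mk, AddHom.coe_mk, LinearMap.neg_apply, LinearMap.neg_apply, adOp_tilde]
  rw [← neg_one_smul ℂ (tilde _ p), ← LinearMap.smul_apply, ← tilde_smul, neg_one_smul]
  rfl

theorem toddOp_tilde (F : FunLie W L) (p : SA W) : s.toddOp (tilde F.toLin p)
    = tilde (evalSeries (bernoulli'PowerSeries ℂ)
        (LieAlgebra.ad ℂ (FunLie W L) s.tautField) F).toLin p := by
  refine (evalSeries_intertwine _ s.isNilpotent_ad_tautField s.isNilpotent_adOp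
    { toFun := fun F : FunLie W L => tilde F.toLin p
      map_add' := fun F G => by
        rw [← LinearMap.add_apply, ← tilde_add]; rfl
      map_smul' := fun r F => by
        rw [RingHom.id_apply, ← LinearMap.smul_apply, ← tilde_smul]; rfl } ?_ F).symm
  intro F
  rw [LinearMap.coe_mk, AddHom.coe_mk, adOp_tilde]
  rfl

/-- The function `w ↦ e ^ (-ad T(w)) a`, where `T(w) = -i(w)`. -/
def expFun : L →ₗ[ℂ] FunLie W L := expAd s.tautField ∘ₗ FunLie.const

/-- Projection of a function to its component in the first summand. -/
def projFun : Module.End ℂ (FunLie W L) where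
  toFun F := (s.i ∘ₗ s.q) ∘ₗ F.toLin
  map_add' _ _ := LinearMap.comp_add _ _ _
  map_smul' _ _ := LinearMap.comp_smul _ _ _

theorem projFun_projFun (F : FunLie W L) : s.projFun (s.projFun F) = s.projFun F :=
  LinearMap.ext fun p => congrArg s.i (s.q_i (s.q (F.toLin p)))

theorem projFun_lie (F G : FunLie W L) :
    s.projFun ⁅s.projFun F, s.projFun G⁆ = ⁅s.projFun F, s.projFun G⁆ := by
  refine LinearMap.ext fun p => sub_eq_zero.mp ?_
  have : conv (lieMap L) (s.projFun F).toLin (s.projFun G).toLin p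
      ∈ LinearMap.ker (s.i ∘ₗ s.q - LinearMap.id) := by
    refine conv_mem _ (fun x y => ?_) p
    rw [LinearMap.mem_ker, LinearMap.sub_apply, sub_eq_zero]
    exact s.i_q_lie _ _
  exact this

theorem projFun_lie_sub (F G : FunLie W L) :
    s.projFun ⁅F - s.projFun F, G - s.projFun G⁆ = 0 := by
  refine LinearMap.ext fun p => ?_
  have : conv (lieMap L) (F - s.projFun F).toLin (G - s.projFun G).toLin p
      ∈ LinearMap.ker (s.i ∘ₗ s.q) := by
    refine conv_mem _ (fun x y => ?_) p
    rw [LinearMap.mem_ker, LinearMap.comp_apply]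
    change s.i (s.q ⁅F.toLin x - s.i (s.q (F.toLin x)), G.toLin y - s.i (s.q (G.toLin y))⁆) = 0
    rw [← s.coe_pr, ← s.coe_pr, ← LieSubalgebra.coe_bracket, s.q_coe, map_zero]
  exact this

/-- The coefficients of minus the vector field by which `a` acts. -/
def vectorFun (a : L) : SA W →ₗ[ℂ] W :=
  s.q ∘ₗ (evalSeries (bernoulli'PowerSeries ℂ) (LieAlgebra.ad ℂ (FunLie W L) s.tautField)
    (s.projFun (s.expFun a))).toLin

/-- The function with values in `P` by which `a` acts. -/
def parFun (a : L) : SA W →ₗ[ℂ] P := s.pr ∘ₗ (s.expFun a).toLin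

/-- The Maurer--Cartan form at `T = tautField`, evaluated on the vector field of `a`, is the
component of `e ^ (-ad T) a` in the first summand. -/
theorem thetaAd_vectorFun (a : L) :
    thetaAd s.tautField (FunLie.ofLin (s.i ∘ₗ s.vectorFun a)) = s.projFun (s.expFun a) := by
  have h : ∀ F ∈ LinearMap.ker (s.projFun - LinearMap.id),
      LieAlgebra.ad ℂ (FunLie W L) s.tautField F ∈ LinearMap.ker (s.projFun - LinearMap.id) := by
    intro F hF
    rw [LinearMap.mem_ker, LinearMap.sub_apply, sub_eq_zero, LinearMap.id_apply] at hF ⊢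
    have hT : s.projFun s.tautField = s.tautField := by
      refine LinearMap.ext fun p => ?_
      change s.i (s.q (-s.i (tautFun W p))) = -s.i (tautFun W p)
      rw [← map_neg, s.q_i]
    rw [LieAlgebra.ad_apply, ← hF, ← hT, s.projFun_lie]
  have h2 := evalSeries_mem (bernoulli'PowerSeries ℂ) h (x := s.projFun (s.expFun a)) (by
    rw [LinearMap.mem_ker, LinearMap.sub_apply, sub_eq_zero, LinearMap.id_apply,
      s.projFun_projFun])
  rw [LinearMap.mem_ker, LinearMap.sub_apply, sub_eq_zero, LinearMap.id_apply] at h2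
  have h3 : (FunLie.ofLin (s.i ∘ₗ s.vectorFun a)) = s.projFun _ := rfl
  rw [h3, h2, thetaAd_todd s.isNilpotent_ad_tautField]

theorem deriv_tautField (ξ : SA W →ₗ[ℂ] W) :
    FunLie.deriv ξ s.tautField = FunLie.ofLin (-(s.i ∘ₗ ξ)) := by
  change -(s.i ∘ₗ (tautFun W ∘ₗ fieldOp ξ)) = _
  rw [tautFun_comp_fieldOp]
  rfl

/-- The derivation of functions along the vector field of `a`. -/
def derivOf (a : L) : FunLie W L →ₗ[ℂ] FunLie W L := FunLie.deriv (-s.vectorFun a)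

theorem derivOf_tautField (a : L) :
    s.derivOf a s.tautField = (FunLie.ofLin (s.i ∘ₗ s.vectorFun a)) := by
  rw [derivOf, deriv_tautField, LinearMap.comp_neg, neg_neg]

/-- The derivative of `e ^ (-ad T) b` along the vector field of `a` is its bracket with the
component of `e ^ (-ad T) a` in the first summand, by the formula for the logarithmic derivative. -/
theorem derivOf_expFun (a b : L) :
    s.derivOf a (s.expFun b) = -⁅s.projFun (s.expFun a), s.expFun b⁆ := by
  have h := derivation_expAd (FunLie.deriv_lie (-s.vectorFun a)) s.isNilpotent_ad_tautField
    (FunLie.const b)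
  have h0 : FunLie.deriv (-s.vectorFun a) (FunLie.const b) = 0 :=
    constFun_comp_fieldOp b _
  rw [h0, map_zero, zero_sub] at h
  have h1 := s.derivOf_tautField a
  rw [derivOf] at h1
  rw [h1, thetaAd_vectorFun] at h
  exact h

theorem expFun_lie (a b : L) : s.expFun ⁅a, b⁆ = ⁅s.expFun a, s.expFun b⁆ := by
  have h := expAd_lie s.isNilpotent_ad_tautField (FunLie.const a)
    (FunLie.const b)
  have h0 : ⁅(FunLie.const a : FunLie W L), (FunLie.const b : FunLie W L)⁆
      = (FunLie.const ⁅a, b⁆) := by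
    change conv (lieMap L) (constFun a : SA W →ₗ[ℂ] L) (constFun b) = constFun ⁅a, b⁆
    rw [conv_constFun_left]
    ext p
    simp [constFun, lieMap_apply]
  rw [h0] at h
  exact h

/-- The vector fields represent `L`, by the Maurer--Cartan equation. -/
theorem vectorFun_lie (a b : L) :
    s.vectorFun a ∘ₗ fieldOp (-s.vectorFun b) - s.vectorFun b ∘ₗ fieldOp (-s.vectorFun a)
      = s.vectorFun ⁅a, b⁆ := by
  have hN := s.isNilpotent_ad_tautField
  have h := derivation_thetaAd (FunLie.deriv_lie (-s.vectorFun a))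
    (FunLie.deriv_lie (-s.vectorFun b)) hN
  change s.derivOf a (thetaAd _ (s.derivOf b _)) - s.derivOf b (thetaAd _ (s.derivOf a _))
    + ⁅thetaAd _ (s.derivOf a _), thetaAd _ (s.derivOf b _)⁆ = thetaAd _
      (s.derivOf a (s.derivOf b _) - s.derivOf b (s.derivOf a _)) at h
  simp only [derivOf_tautField, thetaAd_vectorFun] at h
  have e : ∀ a b, s.derivOf a (s.projFun (s.expFun b))
      = -s.projFun ⁅s.projFun (s.expFun a), s.expFun b⁆ := by
    intro a b
    rw [← map_neg, ← derivOf_expFun]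
    rfl
  have h1 : s.derivOf a (s.projFun (s.expFun b)) - s.derivOf b (s.projFun (s.expFun a))
      + ⁅s.projFun (s.expFun a), s.projFun (s.expFun b)⁆ = -s.projFun (s.expFun ⁅a, b⁆) := by
    have h2 := s.projFun_lie_sub (s.expFun a) (s.expFun b)
    rw [sub_lie, lie_sub, lie_sub, map_sub, map_sub, map_sub, ← expFun_lie] at h2
    rw [e, e, ← s.projFun_lie (s.expFun a), ← lie_skew _ (s.expFun a), map_neg]
    rw [sub_eq_zero] at h2
    rw [eq_add_of_sub_eq h2]
    abel
  rw [h1, ← thetaAd_vectorFun, ← map_neg] at h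
  have h3 := congrArg (evalSeries (bernoulli'PowerSeries ℂ)
    (LieAlgebra.ad ℂ (FunLie W L) s.tautField)) h
  rw [todd_thetaAd hN, todd_thetaAd hN] at h3
  refine LinearMap.ext fun p => ?_
  have h4 := congrArg (fun F : FunLie W L => s.q (F.toLin p)) h3
  change s.q (-s.i (s.vectorFun ⁅a, b⁆ p)) = s.q (s.i (s.vectorFun b (fieldOp _ p))
    - s.i (s.vectorFun a (fieldOp _ p))) at h4
  rw [map_neg, map_sub, s.q_i, s.q_i, s.q_i] at h4
  rw [LinearMap.sub_apply, LinearMap.comp_apply, LinearMap.comp_apply, ← neg_neg (s.vectorFun _ p),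
    h4, neg_sub]

/-- The `P`-valued functions form a cocycle over the vector fields. -/
theorem parFun_lie (a b : L) :
    s.parFun a ∘ₗ fieldOp (-s.vectorFun b) - s.parFun b ∘ₗ fieldOp (-s.vectorFun a)
      + conv (lieMap P) (s.parFun a) (s.parFun b) = s.parFun ⁅a, b⁆ := by
  have hc : P.toSubmodule.subtype ∘ₗ conv (lieMap P) (s.parFun a) (s.parFun b)
      = ⁅s.expFun a - s.projFun (s.expFun a), s.expFun b - s.projFun (s.expFun b)⁆.toLin := by
    have e : ∀ a, (s.expFun a - s.projFun (s.expFun a)).toLin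
        = P.toSubmodule.subtype ∘ₗ s.parFun a := fun a =>
      LinearMap.ext fun p => (s.coe_pr _).symm
    rw [FunLie.lie_def, e, e]
    simp only [conv, TensorProduct.map_comp, ← LinearMap.comp_assoc]
    congr 2
    ext1
    rfl
  have hd : ∀ a b, s.parFun a ∘ₗ fieldOp (-s.vectorFun b)
      = s.pr ∘ₗ (-⁅s.projFun (s.expFun b), s.expFun a⁆).toLin := by
    intro a b
    rw [← derivOf_expFun]
    rfl
  refine LinearMap.ext fun p => Subtype.ext ?_
  have h0 := congrArg (fun F : SA W →ₗ[ℂ] L => F p) hc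
  have h1 : ∀ F : FunLie W L, ((s.pr (F.toLin p) : P) : L) = (F - s.projFun F).toLin p :=
    fun F => s.coe_pr _
  have h2 := s.projFun_lie_sub (s.expFun a) (s.expFun b)
  have h3 := s.projFun_lie (s.expFun a) (s.expFun b)
  have h4 : (-⁅s.projFun (s.expFun b), s.expFun a⁆
        - s.projFun (-⁅s.projFun (s.expFun b), s.expFun a⁆))
      - (-⁅s.projFun (s.expFun a), s.expFun b⁆
        - s.projFun (-⁅s.projFun (s.expFun a), s.expFun b⁆))
      + ⁅s.expFun a - s.projFun (s.expFun a), s.expFun b - s.projFun (s.expFun b)⁆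
      = ⁅s.expFun a, s.expFun b⁆ - s.projFun ⁅s.expFun a, s.expFun b⁆ := by
    rw [sub_lie, lie_sub, lie_sub] at h2 ⊢
    rw [lie_skew]
    simp only [map_sub, map_neg, h3] at h2 ⊢
    rw [sub_eq_zero] at h2
    rw [eq_add_of_sub_eq h2]
    abel
  rw [LinearMap.add_apply, LinearMap.sub_apply, hd, hd]
  change ((s.pr _ : P) : L) - ((s.pr _ : P) : L)
    + (P.toSubmodule.subtype ∘ₗ conv (lieMap P) (s.parFun a) (s.parFun b)) p = ((s.pr _ : P) : L)
  rw [h1, h1, h1, expFun_lie, hc]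
  exact congrArg (fun F : FunLie W L => F.toLin p) h4

section Rep

variable {V : Type*} [AddCommGroup V] [Module ℂ V] (σ : P →ₗ⁅ℂ⁆ Module.End ℂ V)

/-- The action of `a` on polynomials by a vector field. -/
def vectorOp (a : L) : Module.End ℂ (SA W) :=
  -(LinearMap.mul' ℂ (SA W) ∘ₗ (ι ℂ W ∘ₗ s.q).lTensor (SA W) ∘ₗ s.toddOp ∘ₗ
    (s.i ∘ₗ s.q).lTensor (SA W) ∘ₗ s.expOp ∘ₗ (TensorProduct.mk ℂ (SA W) L).flip a)

/-- The action of `a` through the representation of `P`. -/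
def parOp (a : L) : Module.End ℂ (SA W ⊗[ℂ] V) :=
  (TensorProduct.lift (σ.toLinearMap ∘ₗ s.pr)).lTensor (SA W) ∘ₗ
    (TensorProduct.assoc ℂ (SA W) L V).toLinearMap ∘ₗ
    (s.expOp ∘ₗ (TensorProduct.mk ℂ (SA W) L).flip a).rTensor V

/-- The action of `a` on the free field module. -/
def freeOp (a : L) : Module.End ℂ (SA W ⊗[ℂ] V) := (s.vectorOp a).rTensor V + s.parOp σ a

theorem vectorOp_eq (a : L) : s.vectorOp a = fieldOp (-s.vectorFun a) := by
  refine LinearMap.ext fun p => ?_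
  have h : (TensorProduct.mk ℂ (SA W) L).flip a p = tilde (FunLie.const a : FunLie W L).toLin p :=
    (tilde_constFun a p).symm
  rw [← neg_one_smul ℂ (s.vectorFun a), fieldOp_smul, vectorOp, LinearMap.neg_apply]
  simp only [LinearMap.comp_apply, LinearMap.smul_apply]
  rw [h, expOp_tilde, ← tilde_comp, neg_one_smul]
  change -(LinearMap.mul' ℂ (SA W) ((ι ℂ W ∘ₗ s.q).lTensor (SA W)
    (s.toddOp (tilde (s.projFun (s.expFun a)).toLin p)))) = _
  rw [toddOp_tilde, LinearMap.lTensor_comp_apply, ← tilde_comp]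
  rfl

theorem parOp_eq (a : L) : s.parOp σ a = actOp σ.toLinearMap (s.parFun a) := by
  refine TensorProduct.ext' fun p v => ?_
  have h : (TensorProduct.mk ℂ (SA W) L).flip a p = tilde (FunLie.const a : FunLie W L).toLin p :=
    (tilde_constFun a p).symm
  simp only [parOp, actOp, LinearMap.comp_apply, LinearMap.rTensor_tmul]
  rw [h, expOp_tilde, parFun, tilde_comp]
  change _ = (TensorProduct.lift σ.toLinearMap).lTensor (SA W) (TensorProduct.assoc ℂ (SA W) P V
    ((s.pr.lTensor (SA W) (tilde (expAd s.tautField (FunLie.const a)).toLin p)) ⊗ₜ v))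
  induction tilde (expAd s.tautField (FunLie.const a)).toLin p with
  | zero => simp
  | add x y hx hy => simp only [TensorProduct.add_tmul, map_add, hx, hy]
  | tmul x y => simp

theorem freeOp_lie (a b : L) : s.freeOp σ ⁅a, b⁆ = ⁅s.freeOp σ a, s.freeOp σ b⁆ := by
  refine LinearMap.ext fun z => ?_
  have hv : (fieldOp (-s.vectorFun ⁅a, b⁆)).rTensor V z
      = (fieldOp (-s.vectorFun a)).rTensor V ((fieldOp (-s.vectorFun b)).rTensor V z)
        - (fieldOp (-s.vectorFun b)).rTensor V ((fieldOp (-s.vectorFun a)).rTensor V z) := by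
    rw [← LinearMap.rTensor_comp_apply, ← LinearMap.rTensor_comp_apply, ← LinearMap.sub_apply,
      ← LinearMap.rTensor_sub]
    congr 2
    refine LinearMap.ext fun p => ?_
    have h := fieldOp_fieldOp (-s.vectorFun a) (-s.vectorFun b) p
    have e : -s.vectorFun ⁅a, b⁆ = (-s.vectorFun a) ∘ₗ fieldOp (-s.vectorFun b)
        + (-1 : ℂ) • ((-s.vectorFun b) ∘ₗ fieldOp (-s.vectorFun a)) := by
      rw [← vectorFun_lie, neg_one_smul, LinearMap.neg_comp, LinearMap.neg_comp]
      abel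
    rw [e, fieldOp_add, fieldOp_smul, neg_one_smul, LinearMap.add_apply, LinearMap.neg_apply,
      LinearMap.sub_apply, LinearMap.comp_apply, LinearMap.comp_apply, ← sub_eq_add_neg,
      sub_eq_sub_iff_add_eq_add, add_comm, ← h, add_comm]
  have h1 := actOp_fieldOp σ.toLinearMap (s.parFun a) (-s.vectorFun b) z
  have h2 := actOp_fieldOp σ.toLinearMap (s.parFun b) (-s.vectorFun a) z
  have h3 := actOp_actOp σ (s.parFun a) (s.parFun b) z
  have h4 : actOp σ.toLinearMap (s.parFun ⁅a, b⁆) z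
      = actOp σ.toLinearMap (s.parFun a ∘ₗ fieldOp (-s.vectorFun b)) z
        - actOp σ.toLinearMap (s.parFun b ∘ₗ fieldOp (-s.vectorFun a)) z
        + actOp σ.toLinearMap (conv (lieMap P) (s.parFun a) (s.parFun b)) z := by
    rw [← parFun_lie, sub_eq_add_neg, ← neg_one_smul ℂ (s.parFun b ∘ₗ _), actOp_add, actOp_add,
      actOp_smul, LinearMap.add_apply, LinearMap.add_apply, LinearMap.smul_apply,
      neg_one_smul ℂ (actOp σ.toLinearMap _ z), ← sub_eq_add_neg]
  rw [LieRing.of_associative_ring_bracket, LinearMap.sub_apply, Module.End.mul_apply,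
    Module.End.mul_apply]
  simp only [freeOp, vectorOp_eq, parOp_eq, LinearMap.add_apply, map_add, hv, h4, h1, h2, ← h3]
  abel

theorem vectorFun_add (a b : L) : s.vectorFun (a + b) = s.vectorFun a + s.vectorFun b := by
  rw [vectorFun, map_add, map_add, map_add]
  exact LinearMap.comp_add _ _ _

theorem vectorFun_smul (c : ℂ) (a : L) : s.vectorFun (c • a) = c • s.vectorFun a := by
  rw [vectorFun, map_smul, map_smul, map_smul]
  exact LinearMap.comp_smul _ _ _

theorem parFun_add (a b : L) : s.parFun (a + b) = s.parFun a + s.parFun b := by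
  rw [parFun, map_add]
  exact LinearMap.comp_add _ _ _

theorem parFun_smul (c : ℂ) (a : L) : s.parFun (c • a) = c • s.parFun a := by
  rw [parFun, map_smul]
  exact LinearMap.comp_smul _ _ _

/-- The free field representation. -/
def rep : L →ₗ⁅ℂ⁆ Module.End ℂ (SA W ⊗[ℂ] V) where
  toFun := s.freeOp σ
  map_add' a b := by
    rw [freeOp, freeOp, freeOp, vectorOp_eq, vectorOp_eq, vectorOp_eq, parOp_eq, parOp_eq, parOp_eq,
      vectorFun_add, parFun_add, neg_add, fieldOp_add, LinearMap.rTensor_add, actOp_add]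
    abel
  map_smul' c a := by
    rw [freeOp, freeOp, vectorOp_eq, vectorOp_eq, parOp_eq, parOp_eq, vectorFun_smul,
      parFun_smul, ← smul_neg, fieldOp_smul, LinearMap.rTensor_smul, actOp_smul, ← smul_add]
    rfl
  map_lie' {a b} := s.freeOp_lie σ a b

theorem rep_apply (a : L) : s.rep σ a = s.freeOp σ a := rfl

/-- On the vectors annihilated by `ad u` the action has no higher terms. -/
theorem freeOp_tmul {p : SA W} {a : L} (h : s.adOp (p ⊗ₜ a) = 0)
    (h' : s.adOp (p ⊗ₜ s.i (s.q a)) = 0) (v : V) :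
    s.freeOp σ a (p ⊗ₜ v) = -((ι ℂ W (s.q a) * p) ⊗ₜ v) + p ⊗ₜ σ (s.pr a) v := by
  have h1 : s.expOp (p ⊗ₜ a) = p ⊗ₜ a := by
    rw [expOp, evalSeries_apply_of_eq_zero _ s.isNilpotent_adOp.neg (by simpa using h)]
    simp [PowerSeries.coeff_exp]
  have h2 : s.toddOp (p ⊗ₜ s.i (s.q a)) = p ⊗ₜ s.i (s.q a) := by
    rw [toddOp, evalSeries_apply_of_eq_zero _ s.isNilpotent_adOp h']
    simp [bernoulli'PowerSeries]
  rw [freeOp, LinearMap.add_apply, LinearMap.rTensor_tmul, vectorOp, parOp]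
  congr 1
  · rw [LinearMap.neg_apply, TensorProduct.neg_tmul]
    simp only [LinearMap.comp_apply, LinearMap.flip_apply, TensorProduct.mk_apply, h1,
      LinearMap.lTensor_tmul, h2, s.q_i, LinearMap.mul'_apply]
    rw [mul_comm]
  · simp [h1]

theorem rep_one (x : P) (v : V) : s.rep σ (x : L) (1 ⊗ₜ v) = 1 ⊗ₜ σ x v := by
  rw [rep_apply, freeOp_tmul _ _ (s.adOp_one _) (s.adOp_one _), s.q_coe, map_zero, zero_mul,
    TensorProduct.zero_tmul, neg_zero, zero_add, s.pr_coe]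

theorem adOp_ι_pow (w : W) (n : ℕ) : s.adOp ((ι ℂ W w ^ n) ⊗ₜ s.i w) = 0 := by
  induction n with
  | zero => rw [pow_zero, adOp_one]
  | succ n ih => rw [pow_succ', adOp_ι_mul, ih, lie_self, smul_zero, TensorProduct.tmul_zero,
      sub_zero]

theorem rep_ι_pow (w : W) (n : ℕ) (v : V) :
    s.rep σ (s.i w) ((ι ℂ W w ^ n) ⊗ₜ v) = -((ι ℂ W w ^ (n + 1)) ⊗ₜ v) := by
  rw [rep_apply, freeOp_tmul _ _ (s.adOp_ι_pow _ _) (by rw [s.q_i, adOp_ι_pow]), s.q_i, s.pr_i,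
    map_zero, LinearMap.zero_apply, TensorProduct.tmul_zero, add_zero, pow_succ']

theorem adOp_central {a : L} (ha : ∀ x : L, ⁅x, a⁆ = 0) (p : SA W) : s.adOp (p ⊗ₜ a) = 0 := by
  induction p using sa_induction with
  | one => exact s.adOp_one a
  | smul r p hp => rw [← TensorProduct.smul_tmul', map_smul, hp, smul_zero]
  | add p q hp hq => rw [TensorProduct.add_tmul, map_add, hp, hq, add_zero]
  | ι_mul w p hp => rw [adOp_ι_mul, hp, ha, smul_zero, TensorProduct.tmul_zero, sub_zero]

theorem rep_central {x : P} (hx : ∀ y : L, ⁅y, (x : L)⁆ = 0) (z : SA W ⊗[ℂ] V) :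
    s.rep σ (x : L) z = (σ x).lTensor (SA W) z := by
  induction z with
  | zero => simp
  | add y z hy hz => rw [map_add, map_add, hy, hz]
  | tmul p v =>
    rw [rep_apply, freeOp_tmul _ _ (s.adOp_central hx p)
      (by rw [s.q_coe, map_zero, TensorProduct.tmul_zero, map_zero]), s.q_coe, map_zero, zero_mul,
      TensorProduct.zero_tmul, neg_zero, zero_add, s.pr_coe, LinearMap.lTensor_tmul]

end Rep

end Splitting
end FreeFieldRep

/-! ### Symmetrization -/

section Symmetrization

open SymmetricAlgebra (ι)
open Coalgebra (counit)

/-- The coefficients of a polynomial with values in a submodule lie in the submodule. -/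
theorem mem_of_forall_sum_pow_smul_mem {E : Type*} [AddCommGroup E] [Module ℂ E]
    {M : Submodule ℂ E} {n : ℕ} {x : ℕ → E}
    (h : ∀ t : ℂ, ∑ k ∈ Finset.range n, t ^ k • x k ∈ M) {k : ℕ} (hk : k < n) : x k ∈ M := by
  rw [← Submodule.Quotient.mk_eq_zero, ← Module.forall_dual_apply_eq_zero_iff ℂ]
  intro f
  set P : Polynomial ℂ := ∑ k ∈ Finset.range n,
    Polynomial.monomial k (f (Submodule.Quotient.mk (x k))) with hP
  have hP0 : P = 0 := by
    refine Polynomial.funext fun t => ?_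
    have := congrArg f ((Submodule.Quotient.mk_eq_zero M).mpr (h t))
    rw [← Submodule.mkQ_apply, map_sum, map_sum, map_zero] at this
    rw [hP, Polynomial.eval_finsetSum, Polynomial.eval_zero, ← this]
    refine Finset.sum_congr rfl fun j _ => ?_
    rw [Polynomial.eval_monomial, map_smul, map_smul, smul_eq_mul, mul_comm]
    rfl
  have := congrArg (fun p => p.coeff k) hP0
  simpa [hP, Polynomial.finsetSum_coeff, Polynomial.coeff_monomial, hk] using this

variable {W : Type*} [AddCommGroup W] [Module ℂ W]

variable (W) in
/-- The homogeneous part of degree `n` of the symmetric algebra. -/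
def homog (n : ℕ) : Submodule ℂ (SA W) := Submodule.span ℂ (Set.range fun w => ι ℂ W w ^ n)

theorem pow_mem_homog (w : W) (n : ℕ) : ι ℂ W w ^ n ∈ homog W n :=
  Submodule.subset_span ⟨w, rfl⟩

theorem pow_mul_mem_homog (w u : W) (n : ℕ) : ι ℂ W w ^ n * ι ℂ W u ∈ homog W (n + 1) := by
  -- the coefficient of `t` in `(w + t u) ^ (n + 1)`
  have h := mem_of_forall_sum_pow_smul_mem (M := homog W (n + 1)) (n := n + 1 + 1)
    (x := fun k => ι ℂ W u ^ k * ι ℂ W w ^ (n + 1 - k) * ((n + 1).choose k : SA W)) (fun t => by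
      have h := pow_mem_homog (t • u + w) (n + 1)
      rw [map_add, map_smul, add_pow] at h
      refine (congrArg (· ∈ homog W (n + 1)) (Finset.sum_congr rfl fun k _ => ?_)).mp h
      rw [smul_pow, smul_mul_assoc, smul_mul_assoc]) (k := 1) (by omega)
  simp only [pow_one, Nat.add_sub_cancel, Nat.choose_one_right] at h
  have h2 := (homog W (n + 1)).smul_mem (((n : ℂ) + 1)⁻¹) h
  have h3 : ((n : ℂ) + 1) ≠ 0 := by exact_mod_cast n.succ_ne_zero
  have h4 : ((n + 1 : ℕ) : SA W) = algebraMap ℂ (SA W) ((n : ℂ) + 1) := by simp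
  rwa [h4, mul_comm _ (algebraMap _ _ _), ← Algebra.smul_def, smul_smul, inv_mul_cancel₀ h3,
    one_smul, mul_comm] at h2

theorem mul_mem_homog {p : SA W} {n : ℕ} (hp : p ∈ homog W n) (u : W) :
    p * ι ℂ W u ∈ homog W (n + 1) := by
  induction hp using Submodule.span_induction with
  | mem p hp => obtain ⟨w, rfl⟩ := hp; exact pow_mul_mem_homog w u n
  | zero => rw [zero_mul]; exact Submodule.zero_mem _
  | add x y _ _ hx hy => rw [add_mul]; exact add_mem hx hy
  | smul r x _ hx => rw [smul_mul_assoc]; exact Submodule.smul_mem _ _ hx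

theorem prod_mem_homog (n : ℕ) (w : Fin n → W) : ∏ i, ι ℂ W (w i) ∈ homog W n := by
  induction n with
  | zero => simpa using pow_mem_homog (0 : W) 0
  | succ n ih => rw [Fin.prod_univ_succ, mul_comm]; exact mul_mem_homog (ih _) _

theorem iSup_homog : ⨆ n, homog W n = ⊤ := by
  rw [eq_top_iff]
  rintro p -
  induction p using sa_induction with
  | one => exact Submodule.mem_iSup_of_mem 0 (by simpa using pow_mem_homog (0 : W) 0)
  | smul r p hp => exact Submodule.smul_mem _ _ hp
  | add p q hp hq => exact add_mem hp hq
  | ι_mul w p hp =>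
    induction hp using Submodule.iSup_induction' with
    | mem n p hp => rw [mul_comm]; exact Submodule.mem_iSup_of_mem (n + 1) (mul_mem_homog hp w)
    | zero => rw [mul_zero]; exact Submodule.zero_mem _
    | add x y _ _ hx hy => rw [mul_add]; exact add_mem hx hy

/-- The powers of elements of `W` span the symmetric algebra. -/
theorem sa_pow_induction {motive : SA W → Prop} (pow : ∀ w n, motive (ι ℂ W w ^ n))
    (smul : ∀ (r : ℂ) p, motive p → motive (r • p))
    (add : ∀ p q, motive p → motive q → motive (p + q)) (p : SA W) : motive p := by
  have hz : motive 0 := by simpa using smul 0 _ (pow 0 0)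
  have hp : p ∈ ⨆ n, homog W n := by rw [iSup_homog]; trivial
  induction hp using Submodule.iSup_induction' with
  | mem n p hp =>
    induction hp using Submodule.span_induction with
    | mem p hp => obtain ⟨w, rfl⟩ := hp; exact pow w n
    | zero => exact hz
    | add x y _ _ hx hy => exact add _ _ hx hy
    | smul r x _ hx => exact smul r _ hx
  | zero => exact hz
  | add x y _ _ hx hy => exact add _ _ hx hy

theorem symDiff_pow (w : W) (n : ℕ) :
    symDiff W (ι ℂ W w ^ (n + 1)) = ((n : ℂ) + 1) • (ι ℂ W w ^ n) ⊗ₜ w := by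
  induction n with
  | zero => simp [symDiff_ι]
  | succ n ih =>
    rw [pow_succ', symDiff_ι_mul, ih, smul_comm, TensorProduct.smul_tmul', smul_eq_mul, ← pow_succ']
    push_cast
    rw [add_smul ((n : ℂ) + 1), one_smul]

theorem symDiff_prod (n : ℕ) (w : Fin (n + 1) → W) : symDiff W (∏ i, ι ℂ W (w i))
    = ∑ i, (∏ k, ι ℂ W (w (i.succAbove k))) ⊗ₜ w i := by
  induction n with
  | zero => simp [symDiff_ι]
  | succ n ih =>
    rw [Fin.prod_univ_succ, symDiff_ι_mul, ih, add_comm, Finset.smul_sum]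
    refine Eq.trans ?_ (Fin.sum_univ_succ _).symm
    congr 1
    refine Finset.sum_congr rfl fun i _ => ?_
    rw [Fin.prod_univ_succ, TensorProduct.smul_tmul']
    simp

section

variable {A : Type*} [Ring A] [Algebra ℂ A] (j : W →ₗ[ℂ] A)

/-- The map `p ↦ ∑ j(w_i) f(∂p/∂w_i)`. -/
def eulerOp (f : SA W →ₗ[ℂ] A) : SA W →ₗ[ℂ] A :=
  LinearMap.mul' ℂ A ∘ₗ TensorProduct.map j f ∘ₗ (TensorProduct.comm ℂ (SA W) W).toLinearMap ∘ₗ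
    symDiff W

theorem eulerOp_pow (f : SA W →ₗ[ℂ] A) (w : W) (n : ℕ) :
    eulerOp j f (ι ℂ W w ^ (n + 1)) = ((n : ℂ) + 1) • (j w * f (ι ℂ W w ^ n)) := by
  simp [eulerOp, symDiff_pow]

theorem eulerOp_prod (f : SA W →ₗ[ℂ] A) (n : ℕ) (w : Fin (n + 1) → W) :
    eulerOp j f (∏ i, ι ℂ W (w i)) = ∑ i, j (w i) * f (∏ k, ι ℂ W (w (i.succAbove k))) := by
  simp [eulerOp, symDiff_prod]

/-- The homogeneous parts of symmetrization, defined recursively by Euler's formula: in degree `n`,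
`n` times symmetrization is `eulerOp` of symmetrization in degree `n - 1`. -/
def symPart : ℕ → SA W →ₗ[ℂ] A
  | 0 => Algebra.linearMap ℂ A ∘ₗ counit (R := ℂ) (A := SA W)
  | n + 1 => ((n : ℂ) + 1)⁻¹ • eulerOp j (symPart n)

theorem symPart_pow (w : W) (n m : ℕ) :
    symPart j n (ι ℂ W w ^ m) = if n = m then j w ^ m else 0 := by
  induction n generalizing m with
  | zero =>
    cases m with
    | zero => simp [symPart]
    | succ m => simp [symPart, pow_succ]
  | succ n ih =>
    rw [symPart, LinearMap.smul_apply]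
    cases m with
    | zero => simp [eulerOp, symDiff_one]
    | succ m =>
      rw [eulerOp_pow, ih]
      by_cases h : n = m
      · subst h
        have h3 : ((n : ℂ) + 1) ≠ 0 := by exact_mod_cast n.succ_ne_zero
        rw [if_pos rfl, if_pos rfl, smul_smul, inv_mul_cancel₀ h3, one_smul, pow_succ']
      · rw [if_neg h, if_neg (by omega), mul_zero, smul_zero, smul_zero]

theorem finite_support_symPart (p : SA W) : (Function.support fun n => symPart j n p).Finite := by
  induction p using sa_pow_induction with
  | pow w m =>
    refine (Set.finite_singleton m).subset fun n hn => ?_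
    by_contra h
    exact hn ((symPart_pow j w n m).trans (if_neg h))
  | smul r p hp =>
    refine hp.subset fun n hn h => hn ?_
    exact (map_smul _ r p).trans (by rw [show symPart j n p = 0 from h, smul_zero])
  | add p q hp hq =>
    refine (hp.union hq).subset fun n hn => ?_
    by_contra h
    rw [Set.mem_union, not_or, Function.notMem_support, Function.notMem_support] at h
    exact hn ((map_add _ p q).trans
      (by rw [show symPart j n p = 0 from h.1, show symPart j n q = 0 from h.2, add_zero]))

/-- Symmetrization: the linear map with `w ^ n ↦ j(w) ^ n`. -/
def symMap : SA W →ₗ[ℂ] A where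
  toFun p := ∑ᶠ n, symPart j n p
  map_add' p q := by
    simp only [map_add]
    exact finsum_add_distrib (finite_support_symPart j p) (finite_support_symPart j q)
  map_smul' r p := by
    simp only [map_smul, RingHom.id_apply]
    exact (smul_finsum r _).symm

theorem symMap_pow (w : W) (n : ℕ) : symMap j (ι ℂ W w ^ n) = j w ^ n := by
  change ∑ᶠ m, symPart j m (ι ℂ W w ^ n) = _
  simp only [symPart_pow]
  exact (finsum_eq_single _ n fun m hm => if_neg hm).trans (if_pos rfl)

/-- Euler's formula for symmetrization. -/
theorem smul_symMap {n : ℕ} {p : SA W} (hp : p ∈ homog W (n + 1)) :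
    ((n : ℂ) + 1) • symMap j p = eulerOp j (symMap j) p := by
  induction hp using Submodule.span_induction with
  | mem p hp =>
    obtain ⟨w, rfl⟩ := hp
    simp only
    rw [eulerOp_pow, symMap_pow, symMap_pow, pow_succ']
  | zero => simp
  | add x y _ _ hx hy => rw [map_add, map_add, smul_add, hx, hy]
  | smul r x _ hx => rw [map_smul, map_smul, smul_comm, hx]

theorem smul_symMap_prod (n : ℕ) (w : Fin (n + 1) → W) :
    ((n : ℂ) + 1) • symMap j (∏ i, ι ℂ W (w i))
      = ∑ i, j (w i) * symMap j (∏ k, ι ℂ W (w (i.succAbove k))) := by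
  rw [smul_symMap j (prod_mem_homog _ w), eulerOp_prod]

theorem smul_symMap_pow_mul (w u : W) (m : ℕ) :
    ((m : ℂ) + 1 + 1) • symMap j (ι ℂ W w ^ (m + 1) * ι ℂ W u)
      = ((m : ℂ) + 1) • (j w * symMap j (ι ℂ W w ^ m * ι ℂ W u)) + j u * j w ^ (m + 1) := by
  have h := smul_symMap j (pow_mul_mem_homog w u (m + 1))
  push_cast at h
  rw [h, mul_comm, eulerOp]
  simp only [LinearMap.comp_apply, symDiff_ι_mul, symDiff_pow]
  simp only [map_add, map_smul, TensorProduct.comm_tmul,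
    TensorProduct.map_tmul, LinearMap.mul'_apply, LinearEquiv.coe_coe, smul_eq_mul, symMap_pow,
    mul_comm (ι ℂ W u), smul_comm (_ : SA W) (_ : ℂ), TensorProduct.smul_tmul' (_ : SA W)]

section Reorder

variable {X : Type*} [AddCommGroup X] [Module ℂ X] (J : X →ₗ[ℂ] A)

/-- The span of the products `j(w) ^ k J(x)` with `k < m`. -/
def powSpan (w : W) (m : ℕ) : Submodule ℂ A :=
  Submodule.span ℂ {a | ∃ k < m, ∃ x, a = j w ^ k * J x}

theorem mul_mem_powSpan {w : W} {m : ℕ} {a : A} (ha : a ∈ powSpan j J w m) :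
    j w * a ∈ powSpan j J w (m + 1) := by
  induction ha using Submodule.span_induction with
  | mem a ha =>
    obtain ⟨k, hk, x, rfl⟩ := ha
    exact Submodule.subset_span ⟨k + 1, by omega, x, by rw [pow_succ', mul_assoc]⟩
  | zero => rw [mul_zero]; exact Submodule.zero_mem _
  | add x y _ _ hx hy => rw [mul_add]; exact add_mem hx hy
  | smul r x _ hx => rw [mul_smul_comm]; exact Submodule.smul_mem _ _ hx

variable {j J} (hJ : ∀ x w, ∃ x', J x * j w - j w * J x = J x')

include hJ

theorem mem_powSpan_mul {w : W} {m : ℕ} {a : A} (ha : a ∈ powSpan j J w m) :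
    a * j w ∈ powSpan j J w (m + 1) := by
  induction ha using Submodule.span_induction with
  | mem a ha =>
    obtain ⟨k, hk, x, rfl⟩ := ha
    obtain ⟨x', hx'⟩ := hJ x w
    rw [mul_assoc, eq_add_of_sub_eq hx', mul_add, ← mul_assoc, ← pow_succ]
    exact add_mem (Submodule.subset_span ⟨k, by omega, x', rfl⟩)
      (Submodule.subset_span ⟨k + 1, by omega, x, rfl⟩)
  | zero => rw [zero_mul]; exact Submodule.zero_mem _
  | add x y _ _ hx hy => rw [add_mul]; exact add_mem hx hy
  | smul r x _ hx => rw [smul_mul_assoc]; exact Submodule.smul_mem _ _ hx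

/-- Moving a factor of `J(X)` past a power of `j(w)` costs only products with fewer factors. -/
theorem mul_pow_sub_mem (w : W) (x : X) (m : ℕ) :
    J x * j w ^ m - j w ^ m * J x ∈ powSpan j J w m := by
  induction m with
  | zero => simp
  | succ m ih =>
    obtain ⟨x', hx'⟩ := hJ x w
    have e : J x * j w ^ (m + 1) - j w ^ (m + 1) * J x
        = (J x * j w ^ m - j w ^ m * J x) * j w + j w ^ m * J x' := by
      rw [← hx', pow_succ]
      noncomm_ring
    rw [e]
    exact add_mem (mem_powSpan_mul hJ ih) (Submodule.subset_span ⟨m, by omega, x', rfl⟩)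

end Reorder

variable {j} (hj : ∀ u w, ∃ x, j u * j w - j w * j u = j x)

include hj

/-- The symmetrization of `w ^ m u` is `j(w) ^ m j(u)` up to products with fewer factors. -/
theorem symMap_pow_mul_sub_mem (w u : W) (m : ℕ) :
    ((m : ℂ) + 1) • symMap j (ι ℂ W w ^ m * ι ℂ W u) - ((m : ℂ) + 1) • (j w ^ m * j u)
      ∈ powSpan j j w m := by
  induction m with
  | zero =>
    have h := symMap_pow j u 1
    rw [pow_one, pow_one] at h
    simp [h]
  | succ m ih =>
    push_cast
    rw [smul_symMap_pow_mul]
    have e : ((m : ℂ) + 1) • (j w * symMap j (ι ℂ W w ^ m * ι ℂ W u)) + j u * j w ^ (m + 1)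
        - ((m : ℂ) + 1 + 1) • (j w ^ (m + 1) * j u)
        = j w * (((m : ℂ) + 1) • symMap j (ι ℂ W w ^ m * ι ℂ W u)
          - ((m : ℂ) + 1) • (j w ^ m * j u)) + (j u * j w ^ (m + 1) - j w ^ (m + 1) * j u) := by
      rw [mul_sub, mul_smul_comm, mul_smul_comm, ← mul_assoc, ← pow_succ',
        add_smul ((m : ℂ) + 1) (1 : ℂ) (j w ^ (m + 1) * j u), one_smul]
      abel
    rw [e]
    exact add_mem (mul_mem_powSpan j j ih) (mul_pow_sub_mem hj w u (m + 1))

/-- If `j(W)` is closed under commutators, then the products `j(w) ^ k j(u)` are symmetrizations. -/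
theorem powSpan_le_range (w : W) (m : ℕ) : powSpan j j w m ≤ LinearMap.range (symMap j) := by
  induction m with
  | zero =>
    refine Submodule.span_le.mpr ?_
    rintro _ ⟨k, hk, -⟩
    exact absurd hk (Nat.not_lt_zero k)
  | succ m ih =>
    refine Submodule.span_le.mpr ?_
    rintro _ ⟨k, hk, u, rfl⟩
    rcases (Nat.lt_succ_iff_lt_or_eq.mp hk) with hk | rfl
    · exact ih (Submodule.subset_span ⟨k, hk, u, rfl⟩)
    · have h3 : ((k : ℂ) + 1) ≠ 0 := by exact_mod_cast k.succ_ne_zero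
      have h := ih (symMap_pow_mul_sub_mem hj w u k)
      have h2 := Submodule.sub_mem _ (LinearMap.mem_range_self (symMap j)
        (((k : ℂ) + 1) • (ι ℂ W w ^ k * ι ℂ W u))) h
      rw [map_smul, sub_sub_cancel] at h2
      exact ((LinearMap.range (symMap j)).smul_mem_iff h3).mp h2

end

end Symmetrization

/-! ### The induced module -/

section Induced

open SymmetricAlgebra (ι)

variable {W L : Type*} [AddCommGroup W] [Module ℂ W] [LieRing L] [LieAlgebra ℂ L]
  {P : LieSubalgebra ℂ L} (s : Splitting W L P)

theorem uea_induction {motive : UniversalEnvelopingAlgebra ℂ L → Prop}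
    (algebraMap : ∀ r, motive (algebraMap ℂ _ r))
    (ι : ∀ x, motive (UniversalEnvelopingAlgebra.ι ℂ x))
    (mul : ∀ a b, motive a → motive b → motive (a * b))
    (add : ∀ a b, motive a → motive b → motive (a + b))
    (u : UniversalEnvelopingAlgebra ℂ L) : motive u := by
  obtain ⟨a, rfl⟩ : ∃ a, UniversalEnvelopingAlgebra.mkAlgHom ℂ L a = u :=
    Quotient.mk_surjective u
  induction a using TensorAlgebra.induction with
  | algebraMap r => rw [AlgHom.commutes]; exact algebraMap r
  | ι x => exact ι x
  | mul x y hx hy => rw [map_mul]; exact mul _ _ hx hy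
  | add x y hx hy => rw [map_add]; exact add _ _ hx hy

variable {V : Type*} [AddCommGroup V] [Module ℂ V] (σ : P →ₗ⁅ℂ⁆ Module.End ℂ V)

/-- The relations of the tensor product `U(L) ⊗_{U(P)} V`. -/
def indRelOf : Submodule ℂ (UniversalEnvelopingAlgebra ℂ L ⊗[ℂ] V) :=
  Submodule.span ℂ {z | ∃ (u : UniversalEnvelopingAlgebra ℂ L)
    (x : UniversalEnvelopingAlgebra ℂ P) (v : V),
    z = (u * UniversalEnvelopingAlgebra.lift ℂ
        ((UniversalEnvelopingAlgebra.ι ℂ).comp P.incl) x) ⊗ₜ v -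
      u ⊗ₜ UniversalEnvelopingAlgebra.lift ℂ σ x v}

/-- The induced module `U(L) ⊗_{U(P)} V`. -/
abbrev IndMod : Type _ := (UniversalEnvelopingAlgebra ℂ L ⊗[ℂ] V) ⧸ indRelOf σ

theorem indRelOf_mkQ_mul (u : UniversalEnvelopingAlgebra ℂ L) (x : P) (v : V) :
    (indRelOf σ).mkQ ((u * UniversalEnvelopingAlgebra.ι ℂ (x : L)) ⊗ₜ v)
      = (indRelOf σ).mkQ (u ⊗ₜ σ x v) := by
  rw [← sub_eq_zero, ← map_sub, Submodule.mkQ_apply, Submodule.Quotient.mk_eq_zero]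
  refine Submodule.subset_span ⟨u, UniversalEnvelopingAlgebra.ι ℂ x, v, ?_⟩
  rw [UniversalEnvelopingAlgebra.lift_ι_apply, UniversalEnvelopingAlgebra.lift_ι_apply]
  rfl

/-- Left multiplication on the induced module. -/
def indMul (u' : UniversalEnvelopingAlgebra ℂ L) : Module.End ℂ (IndMod σ) :=
  (indRelOf σ).mapQ (indRelOf σ) ((LinearMap.mulLeft ℂ u').rTensor V) (by
    rw [indRelOf, Submodule.span_le]
    rintro _ ⟨u, x, v, rfl⟩
    refine Submodule.subset_span ⟨u' * u, x, v, ?_⟩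
    simp [mul_assoc])

theorem indMul_mkQ (u' u : UniversalEnvelopingAlgebra ℂ L) (v : V) :
    indMul σ u' ((indRelOf σ).mkQ (u ⊗ₜ v)) = (indRelOf σ).mkQ ((u' * u) ⊗ₜ v) := rfl

theorem indMul_mul (u u' : UniversalEnvelopingAlgebra ℂ L) (m : IndMod σ) :
    indMul σ (u * u') m = indMul σ u (indMul σ u' m) := by
  obtain ⟨z, rfl⟩ := Submodule.mkQ_surjective _ m
  induction z with
  | zero => simp
  | add x y hx hy => simp only [map_add, hx, hy]
  | tmul x v => rw [indMul_mkQ, indMul_mkQ, indMul_mkQ, mul_assoc]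

namespace Splitting

/-- The map `U(L) ⊗ V → S(W) ⊗ V`, `u ⊗ v ↦ u (1 ⊗ v)`. -/
def toFreeAux : UniversalEnvelopingAlgebra ℂ L ⊗[ℂ] V →ₗ[ℂ] SA W ⊗[ℂ] V :=
  TensorProduct.lift (LinearMap.lcomp ℂ (SA W ⊗[ℂ] V) (TensorProduct.mk ℂ (SA W) V 1) ∘ₗ
    (UniversalEnvelopingAlgebra.lift ℂ (s.rep σ)).toLinearMap)

theorem toFreeAux_tmul (u : UniversalEnvelopingAlgebra ℂ L) (v : V) :
    s.toFreeAux σ (u ⊗ₜ v) = UniversalEnvelopingAlgebra.lift ℂ (s.rep σ) u (1 ⊗ₜ v) := by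
  simp [toFreeAux]

theorem lift_rep_one (x : UniversalEnvelopingAlgebra ℂ P) (v : V) :
    UniversalEnvelopingAlgebra.lift ℂ (s.rep σ) (UniversalEnvelopingAlgebra.lift ℂ
      ((UniversalEnvelopingAlgebra.ι ℂ).comp P.incl) x) (1 ⊗ₜ v)
      = 1 ⊗ₜ UniversalEnvelopingAlgebra.lift ℂ σ x v := by
  induction x using uea_induction generalizing v with
  | algebraMap r => simp [Algebra.algebraMap_eq_smul_one]
  | ι x =>
    rw [UniversalEnvelopingAlgebra.lift_ι_apply, UniversalEnvelopingAlgebra.lift_ι_apply,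
      LieHom.comp_apply, UniversalEnvelopingAlgebra.lift_ι_apply]
    exact s.rep_one σ x v
  | mul a b ha hb =>
    rw [map_mul, map_mul, map_mul, Module.End.mul_apply, Module.End.mul_apply, hb, ha]
  | add a b ha hb =>
    rw [map_add, map_add, map_add, LinearMap.add_apply, LinearMap.add_apply, ha, hb,
      TensorProduct.tmul_add]

/-- The map from the induced module to the free field module. -/
def toFree : IndMod σ →ₗ[ℂ] SA W ⊗[ℂ] V :=
  (indRelOf σ).liftQ (s.toFreeAux σ) (by
    rw [indRelOf, Submodule.span_le]
    rintro _ ⟨u, x, v, rfl⟩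
    rw [SetLike.mem_coe, LinearMap.mem_ker, map_sub, toFreeAux_tmul, toFreeAux_tmul, map_mul,
      Module.End.mul_apply, lift_rep_one, sub_self])

theorem toFree_mkQ (u : UniversalEnvelopingAlgebra ℂ L) (v : V) :
    s.toFree σ ((indRelOf σ).mkQ (u ⊗ₜ v))
      = UniversalEnvelopingAlgebra.lift ℂ (s.rep σ) u (1 ⊗ₜ v) := by
  rw [toFree, Submodule.mkQ_apply, Submodule.liftQ_apply, toFreeAux_tmul]

theorem toFree_indMul (a : L) (m : IndMod σ) :
    s.toFree σ (indMul σ (UniversalEnvelopingAlgebra.ι ℂ a) m) = s.rep σ a (s.toFree σ m) := by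
  obtain ⟨z, rfl⟩ := Submodule.mkQ_surjective _ m
  induction z with
  | zero => simp
  | add x y hx hy => simp only [map_add, hx, hy]
  | tmul u v =>
    rw [indMul_mkQ, toFree_mkQ, toFree_mkQ, map_mul, Module.End.mul_apply,
      UniversalEnvelopingAlgebra.lift_ι_apply]

/-- The map `w ↦ -w` from `W` to `U(L)`. -/
def negι : W →ₗ[ℂ] UniversalEnvelopingAlgebra ℂ L :=
  -((UniversalEnvelopingAlgebra.ι ℂ : L →ₗ⁅ℂ⁆ _).toLinearMap ∘ₗ s.i)

theorem negι_apply (w : W) : s.negι w = -UniversalEnvelopingAlgebra.ι ℂ (s.i w) := rfl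

/-- The inverse map: symmetrization, with the sign `(-1) ^ n` in degree `n`. -/
def ofFree : SA W ⊗[ℂ] V →ₗ[ℂ] IndMod σ :=
  (indRelOf σ).mkQ ∘ₗ (symMap s.negι).rTensor V

theorem ofFree_tmul (p : SA W) (v : V) :
    s.ofFree σ (p ⊗ₜ v) = (indRelOf σ).mkQ (symMap s.negι p ⊗ₜ v) := rfl

/-- On `w ^ n ⊗ v` the composition is computed by `i(w) (w ^ k ⊗ v) = -w ^ (k + 1) ⊗ v`. -/
theorem toFree_ofFree (z : SA W ⊗[ℂ] V) : s.toFree σ (s.ofFree σ z) = z := by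
  induction z with
  | zero => simp
  | add x y hx hy => rw [map_add, map_add, hx, hy]
  | tmul p v =>
    induction p using sa_pow_induction with
    | smul r p hp => rw [← TensorProduct.smul_tmul', map_smul, map_smul, hp]
    | add p q hp hq => rw [TensorProduct.add_tmul, map_add, map_add, hp, hq]
    | pow w n =>
      rw [ofFree_tmul, toFree_mkQ, symMap_pow]
      induction n with
      | zero => simp
      | succ n ih =>
        rw [pow_succ', map_mul, Module.End.mul_apply, ih, negι_apply, map_neg,
          UniversalEnvelopingAlgebra.lift_ι_apply, LinearMap.neg_apply, rep_ι_pow, neg_neg]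

/-- The map `ofFree` is surjective: its range contains `1 ⊗ V` and is stable under `L`, as
reordering expresses `a w ^ n ⊗ v` through the vectors `w ^ k b ⊗ v` with `b ∈ L`, and the component
of `b` in `P` can be absorbed in `v`. -/
theorem range_ofFree : LinearMap.range (s.ofFree σ) = ⊤ := by
  have hι : ∀ x y : L, UniversalEnvelopingAlgebra.ι ℂ x * UniversalEnvelopingAlgebra.ι ℂ y
      - UniversalEnvelopingAlgebra.ι ℂ y * UniversalEnvelopingAlgebra.ι ℂ x
      = UniversalEnvelopingAlgebra.ι ℂ ⁅x, y⁆ := by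
    intro x y
    rw [LieHom.map_lie, LieRing.of_associative_ring_bracket]
  have hj : ∀ u w, ∃ x, s.negι u * s.negι w - s.negι w * s.negι u = s.negι x := by
    intro u w
    refine ⟨-s.q ⁅s.i u, s.i w⁆, ?_⟩
    simp only [negι_apply, neg_mul_neg, map_neg, neg_neg, s.i_q_lie]
    exact hι _ _
  have hJ : ∀ (x : L) (w : W), ∃ x', (UniversalEnvelopingAlgebra.ι ℂ : L →ₗ⁅ℂ⁆ _).toLinearMap x
      * s.negι w - s.negι w * (UniversalEnvelopingAlgebra.ι ℂ : L →ₗ⁅ℂ⁆ _).toLinearMap x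
      = (UniversalEnvelopingAlgebra.ι ℂ : L →ₗ⁅ℂ⁆ _).toLinearMap x' := by
    intro x w
    refine ⟨-⁅x, s.i w⁆, ?_⟩
    rw [negι_apply, mul_neg, neg_mul, neg_sub_neg, map_neg]
    change _ = -(UniversalEnvelopingAlgebra.ι ℂ ⁅x, s.i w⁆)
    rw [← hι, neg_sub]
    rfl
  -- the range contains `j(w) ^ k a ⊗ v` for `a ∈ L`
  have h1 : ∀ (w : W) (k : ℕ) (a : L) (v : V),
      (indRelOf σ).mkQ ((s.negι w ^ k * UniversalEnvelopingAlgebra.ι ℂ a) ⊗ₜ v)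
        ∈ LinearMap.range (s.ofFree σ) := by
    intro w k a v
    rw [← s.i_q_add_pr a, map_add, mul_add, TensorProduct.add_tmul, map_add]
    refine add_mem ?_ ?_
    · obtain ⟨p, hp⟩ := powSpan_le_range hj w (k + 1)
        (Submodule.subset_span ⟨k, k.lt_succ_self, s.q a, rfl⟩)
      refine ⟨-(p ⊗ₜ v), ?_⟩
      rw [map_neg, ofFree_tmul, hp, s.negι_apply (s.q a), mul_neg, TensorProduct.neg_tmul, map_neg, neg_neg]
    · rw [indRelOf_mkQ_mul, ← symMap_pow]
      exact ⟨_, s.ofFree_tmul σ _ _⟩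
  -- the range is stable under `L`
  have h2 : ∀ (a : L) (z : SA W ⊗[ℂ] V),
      indMul σ (UniversalEnvelopingAlgebra.ι ℂ a) (s.ofFree σ z)
        ∈ LinearMap.range (s.ofFree σ) := by
    intro a z
    induction z with
    | zero => simp
    | add x y hx hy => rw [map_add, map_add]; exact add_mem hx hy
    | tmul p v =>
      induction p using sa_pow_induction with
      | smul r p hp =>
        rw [← TensorProduct.smul_tmul', map_smul, map_smul]; exact Submodule.smul_mem _ _ hp
      | add p q hp hq => rw [TensorProduct.add_tmul, map_add, map_add]; exact add_mem hp hq
      | pow w n =>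
        rw [ofFree_tmul, symMap_pow, indMul_mkQ]
        have h := mul_pow_sub_mem hJ w a n
        rw [← sub_add_cancel (UniversalEnvelopingAlgebra.ι ℂ a * s.negι w ^ n)
          (s.negι w ^ n * UniversalEnvelopingAlgebra.ι ℂ a), TensorProduct.add_tmul, map_add]
        refine add_mem ?_ (h1 w n a v)
        have h3 : powSpan s.negι (UniversalEnvelopingAlgebra.ι ℂ : L →ₗ⁅ℂ⁆ _).toLinearMap w n
            ≤ (LinearMap.range (s.ofFree σ)).comap ((indRelOf σ).mkQ ∘ₗ
              (TensorProduct.mk ℂ (UniversalEnvelopingAlgebra ℂ L) V).flip v) := by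
          refine Submodule.span_le.mpr ?_
          rintro _ ⟨k, -, x, rfl⟩
          exact h1 w k x v
        exact h3 h
  have h4 : ∀ (u : UniversalEnvelopingAlgebra ℂ L) (m), m ∈ LinearMap.range (s.ofFree σ) →
      indMul σ u m ∈ LinearMap.range (s.ofFree σ) := by
    intro u
    have hadd : ∀ u u' : UniversalEnvelopingAlgebra ℂ L, ∀ m,
        indMul σ (u + u') m = indMul σ u m + indMul σ u' m := by
      intro u u' m
      obtain ⟨z, rfl⟩ := Submodule.mkQ_surjective _ m
      induction z with
      | zero => simp
      | add x y hx hy => simp only [map_add, hx, hy]; abel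
      | tmul x v => rw [indMul_mkQ, indMul_mkQ, indMul_mkQ, add_mul, TensorProduct.add_tmul, map_add]
    have hr : ∀ (r : ℂ) m, indMul σ (algebraMap ℂ _ r) m = r • m := by
      intro r m
      obtain ⟨z, rfl⟩ := Submodule.mkQ_surjective _ m
      induction z with
      | zero => simp
      | add x y hx hy => simp only [map_add, smul_add, hx, hy]
      | tmul x v => rw [indMul_mkQ, ← Algebra.smul_def, ← TensorProduct.smul_tmul', map_smul]
    induction u using uea_induction with
    | algebraMap r => intro m hm; rw [hr]; exact Submodule.smul_mem _ _ hm
    | ι x => rintro _ ⟨z, rfl⟩; exact h2 x z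
    | mul a b ha hb => intro m hm; rw [indMul_mul]; exact ha _ (hb _ hm)
    | add a b ha hb => intro m hm; rw [hadd]; exact add_mem (ha _ hm) (hb _ hm)
  rw [eq_top_iff]
  rintro m -
  obtain ⟨z, rfl⟩ := Submodule.mkQ_surjective _ m
  induction z with
  | zero => simp
  | add x y hx hy => rw [map_add]; exact add_mem hx hy
  | tmul u v =>
    have h := h4 u _ (LinearMap.mem_range_self (s.ofFree σ) (1 ⊗ₜ v))
    have h5 := symMap_pow s.negι 0 0
    rw [pow_zero, pow_zero] at h5
    rwa [ofFree_tmul, h5, indMul_mkQ, mul_one] at h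

/-- The isomorphism between the induced module and the free field module. -/
def indEquiv : IndMod σ ≃ₗ[ℂ] SA W ⊗[ℂ] V :=
  { s.toFree σ with
    invFun := s.ofFree σ
    left_inv := by
      intro m
      obtain ⟨z, rfl⟩ := LinearMap.range_eq_top.mp (s.range_ofFree σ) m
      change s.ofFree σ (s.toFree σ _) = _
      rw [toFree_ofFree]
    right_inv := s.toFree_ofFree σ }

end Splitting

end Induced

/-! ### The finest linear topology -/

section LinearTopology

open Filter Topology

section Induced

variable {E E' : Type*} [AddCommGroup E] [Module ℂ E] [AddCommGroup E'] [Module ℂ E']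

theorem isLinearTopology_induced [t : TopologicalSpace E'] [IsLinearTopology ℂ E']
    (g : E →ₗ[ℂ] E') : @IsLinearTopology ℂ E _ _ _ (t.induced g) := by
  let := t.induced g
  refine IsLinearTopology.mk_of_hasBasis ℂ (ι := Submodule ℂ E') (S := Submodule ℂ E)
    (s := fun N : Submodule ℂ E' => N.comap g) (p := fun N => (N : Set E') ∈ 𝓝 0) ?_
  rw [nhds_induced, map_zero]
  exact (IsLinearTopology.hasBasis_submodule ℂ).comap g

end Induced

section Finest

variable {E : Type*} [AddCommGroup E] [Module ℂ E] {ι : Type*} {Y : ι → Type*}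
  [∀ i, TopologicalSpace (Y i)] {F : ∀ i, Y i → E}
  {E' : Type*} [AddCommGroup E'] [Module ℂ E'] [t' : TopologicalSpace E']
  [IsTopologicalAddGroup E'] [IsLinearTopology ℂ E']

/-- The universal property of the finest linear topology. -/
theorem continuous_of_finestLinear [t : TopologicalSpace E] (ht : t = finestLinear F)
    (g : E →ₗ[ℂ] E') (h : ∀ i, Continuous fun y => g (F i y)) : Continuous g := by
  subst ht
  rw [continuous_iff_le_induced]
  exact sInf_le ⟨topologicalAddGroup_induced g, isLinearTopology_induced g,
    fun i => continuous_induced_rng.mpr (h i)⟩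

/-- A subspace is open if the maps `F i` are locally constant modulo this subspace. -/
theorem isOpen_of_finestLinear [t : TopologicalSpace E] (ht : t = finestLinear F)
    (N : Submodule ℂ E) (h : ∀ i y₀, ∀ᶠ y in 𝓝 y₀, F i y - F i y₀ ∈ N) :
    IsOpen (N : Set E) := by
  let : TopologicalSpace (E ⧸ N) := ⊥
  have : DiscreteTopology (E ⧸ N) := ⟨rfl⟩
  have hc : Continuous N.mkQ := by
    refine continuous_of_finestLinear ht N.mkQ fun i => ?_
    rw [continuous_iff_continuousAt]
    intro y₀
    rw [ContinuousAt, nhds_discrete (E ⧸ N), tendsto_pure]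
    filter_upwards [h i y₀] with y hy
    rwa [Submodule.mkQ_apply, Submodule.mkQ_apply, Submodule.Quotient.eq]
  convert (isOpen_discrete ({0} : Set (E ⧸ N))).preimage hc
  ext x
  simp

/-- A bilinear map `L × E → E'`, where `E` carries the finest linear topology for which the maps
`F i` are continuous, is continuous if its compositions with the `F i` are. The hypothesis on `L`
is that it has a linearly compact open subspace `L₀`: this allows to pass from continuity in the
second variable to uniform continuity for parameters in `L₀`. -/
theorem continuous_bilin_of_finestLinear [t : TopologicalSpace E] (ht : t = finestLinear F)
    (hspan : Submodule.span ℂ (⋃ i, Set.range (F i)) = ⊤)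
    {L : Type*} [AddCommGroup L] [Module ℂ L] [TopologicalSpace L] [IsTopologicalAddGroup L]
    [IsLinearTopology ℂ L] [ContinuousConstSMul ℂ E'] {L₀ : Submodule ℂ L}
    (hL₀ : IsOpen (L₀ : Set L))
    (hcpt : ∀ U : Submodule ℂ L, IsOpen (U : Set L) →
      ∃ s : Set L, s.Finite ∧ L₀ ≤ Submodule.span ℂ s ⊔ U)
    (act : L →ₗ[ℂ] E →ₗ[ℂ] E') (h : ∀ i, Continuous fun p : L × Y i => act p.1 (F i p.2)) :
    Continuous fun p : L × E => act p.1 p.2 := by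
  have hE : IsTopologicalAddGroup E := by subst ht; exact isTopologicalAddGroup_finestLinear F
  have hright : ∀ a, Continuous (act a) := fun a =>
    continuous_of_finestLinear ht (act a) fun i =>
      (h i).comp (continuous_const.prodMk continuous_id)
  have hleft : ∀ e, Continuous fun a => act a e := by
    intro e
    have he : e ∈ Submodule.span ℂ (⋃ i, Set.range (F i)) := by rw [hspan]; trivial
    induction he using Submodule.span_induction with
    | mem e he =>
      obtain ⟨i, y, rfl⟩ := Set.mem_iUnion.mp he
      exact (h i).comp (continuous_id.prodMk continuous_const)
    | zero => simpa using continuous_const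
    | add x y _ _ hx hy => simp only [map_add]; exact hx.add hy
    | smul r x _ hx => simp only [map_smul]; exact hx.const_smul r
  rw [continuous_iff_continuousAt]
  rintro ⟨a₀, e₀⟩
  rw [ContinuousAt, ← tendsto_sub_nhds_zero_iff,
    (IsLinearTopology.hasBasis_open_submodule ℂ).tendsto_right_iff]
  intro N hN
  -- `N₁ = {e | ∀ a ∈ L₀, a e ∈ N}`
  let N₁ : Submodule ℂ E := ⨅ a : L₀, N.comap (act a)
  have hN₁ : ∀ e, e ∈ N₁ ↔ ∀ a ∈ L₀, act a e ∈ N := fun e => by simp [N₁]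
  have hN₁o : IsOpen (N₁ : Set E) := by
    refine isOpen_of_finestLinear ht N₁ fun i y₀ => ?_
    have hsub : ∀ a, ∀ᶠ y in 𝓝 y₀, act a (F i y) - act a (F i y₀) ∈ N := by
      intro a
      have hc : Continuous fun y => act a (F i y) :=
        (h i).comp (continuous_const.prodMk continuous_id)
      have := tendsto_sub_nhds_zero_iff.mpr (hc.tendsto y₀)
      exact this (hN.mem_nhds (zero_mem N))
    have h0 := (h i).tendsto (0, y₀)
    rw [map_zero, LinearMap.zero_apply, nhds_prod_eq] at h0
    obtain ⟨A, hA, B, hB, hAB⟩ := mem_prod_iff.mp (h0 (hN.mem_nhds (zero_mem N)))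
    obtain ⟨U, hU, hUA⟩ := (IsLinearTopology.hasBasis_open_submodule ℂ).mem_iff.mp hA
    obtain ⟨s, hs, hsU⟩ := hcpt U hU
    filter_upwards [hB, (hs.eventually_all (l := 𝓝 y₀)
      (p := fun a y => act a (F i y) - act a (F i y₀) ∈ N)).mpr fun a _ => hsub a] with y hy hy'
    rw [hN₁]
    intro a ha
    have hle : Submodule.span ℂ s ⊔ U ≤ N.comap (act.flip (F i y - F i y₀)) := by
      refine sup_le (Submodule.span_le.mpr fun a ha => ?_) fun a ha => ?_
      · rw [SetLike.mem_coe, Submodule.mem_comap, LinearMap.flip_apply, map_sub]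
        exact hy' a ha
      · rw [Submodule.mem_comap, LinearMap.flip_apply, map_sub]
        exact sub_mem (hAB (Set.mk_mem_prod (hUA ha) hy))
          (hAB (Set.mk_mem_prod (hUA ha) (mem_of_mem_nhds hB)))
    exact hle (hsU ha)
  have e1 : ∀ᶠ a in 𝓝 a₀, a - a₀ ∈ L₀ ∧ act a e₀ - act a₀ e₀ ∈ N := by
    refine Filter.Eventually.and ?_ ?_
    · have := tendsto_sub_nhds_zero_iff.mpr (tendsto_id (x := 𝓝 a₀))
      exact this (hL₀.mem_nhds (zero_mem L₀))
    · have := tendsto_sub_nhds_zero_iff.mpr ((hleft e₀).tendsto a₀)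
      exact this (hN.mem_nhds (zero_mem N))
  have e2 : ∀ᶠ e in 𝓝 e₀, e - e₀ ∈ N₁ ∧ act a₀ e - act a₀ e₀ ∈ N := by
    refine Filter.Eventually.and ?_ ?_
    · have := tendsto_sub_nhds_zero_iff.mpr (tendsto_id (x := 𝓝 e₀))
      exact this (hN₁o.mem_nhds (zero_mem N₁))
    · have := tendsto_sub_nhds_zero_iff.mpr ((hright a₀).tendsto e₀)
      exact this (hN.mem_nhds (zero_mem N))
  rw [nhds_prod_eq]
  filter_upwards [e1.prod_mk e2] with p hp
  obtain ⟨⟨h1, h2⟩, h3, h4⟩ := hp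
  have : act p.1 p.2 - act a₀ e₀ = act (p.1 - a₀) (p.2 - e₀) + (act p.1 e₀ - act a₀ e₀)
      + (act a₀ p.2 - act a₀ e₀) := by
    simp only [map_sub, LinearMap.sub_apply]
    abel
  rw [this]
  exact add_mem (add_mem ((hN₁ _).mp h3 _ h1) h2) h4

end Finest

/-- A finite-dimensional subspace of a Hausdorff linearly topologized space intersects some open
subspace trivially. -/
theorem exists_isOpen_inf_eq_bot {E : Type*} [AddCommGroup E] [Module ℂ E] [TopologicalSpace E]
    [IsTopologicalAddGroup E] [IsLinearTopology ℂ E] [T2Space E] (A : Submodule ℂ E)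
    [FiniteDimensional ℂ A] : ∃ N : Submodule ℂ E, IsOpen (N : Set E) ∧ A ⊓ N = ⊥ := by
  -- an open subspace with the intersection of least dimension
  have key : ∀ (n : ℕ) (N : Submodule ℂ E), IsOpen (N : Set E) →
      Module.finrank ℂ (A ⊓ N : Submodule ℂ E) ≤ n →
      ∃ N : Submodule ℂ E, IsOpen (N : Set E) ∧ A ⊓ N = ⊥ := by
    intro n
    induction n with
    | zero =>
      intro N hN h
      have : FiniteDimensional ℂ (A ⊓ N : Submodule ℂ E) :=
        Submodule.finiteDimensional_of_le inf_le_left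
      exact ⟨N, hN, Submodule.finrank_eq_zero.mp (Nat.le_zero.mp h)⟩
    | succ n ih =>
      intro N hN h
      by_cases hb : A ⊓ N = ⊥
      · exact ⟨N, hN, hb⟩
      obtain ⟨x, hx, hx0⟩ := Submodule.exists_mem_ne_zero_of_ne_bot hb
      obtain ⟨N', hN', hN'x⟩ := (IsLinearTopology.hasBasis_open_submodule ℂ).mem_iff.mp
        (isOpen_compl_singleton.mem_nhds (Set.mem_compl_singleton_iff.mpr (Ne.symm hx0)))
      have hlt : A ⊓ (N ⊓ N') < A ⊓ N := by
        refine lt_of_le_of_ne (inf_le_inf_left _ inf_le_left) fun h => ?_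
        rw [← h] at hx
        exact hN'x hx.2.2 rfl
      have : FiniteDimensional ℂ (A ⊓ N : Submodule ℂ E) :=
        Submodule.finiteDimensional_of_le inf_le_left
      have := Submodule.finrank_lt_finrank_of_lt hlt
      exact ih (N ⊓ N') (hN.inter hN') (by omega)
  exact key _ ⊤ isOpen_univ le_rfl

end LinearTopology

/-! ### Continuity of the two actions -/

section Continuity

open SymmetricAlgebra (ι)
open Topology

variable {W L : Type*} [AddCommGroup W] [Module ℂ W] [LieRing L] [LieAlgebra ℂ L]
  {P : LieSubalgebra ℂ L}
  {V : Type*} [AddCommGroup V] [Module ℂ V]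

/-- The map `((w_1, …, w_n), v) ↦ w_1 ⋯ w_n ⊗ v`. -/
def freeMon (W V : Type*) [AddCommGroup W] [Module ℂ W] [AddCommGroup V] [Module ℂ V]
    (n : ℕ) (x : (Fin n → W) × V) : SA W ⊗[ℂ] V :=
  (∏ i, ι ℂ W (x.1 i)) ⊗ₜ[ℂ] x.2

/-- The map `((a_1, …, a_n), v) ↦ a_1 ⋯ a_n ⊗ v`. -/
def indMon (σ : P →ₗ⁅ℂ⁆ Module.End ℂ V) (n : ℕ) (x : (Fin n → L) × V) : IndMod σ :=
  (indRelOf σ).mkQ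
    ((List.ofFn fun i => UniversalEnvelopingAlgebra.ι ℂ (x.1 i)).prod ⊗ₜ[ℂ] x.2)

/-- The map `((w_1, …, w_n), a, v) ↦ w_1 ⋯ w_n ⊗ a ⊗ v`. -/
def fieldMon (W L V : Type*) [AddCommGroup W] [Module ℂ W] [AddCommGroup L] [Module ℂ L]
    [AddCommGroup V] [Module ℂ V] (n : ℕ) (x : ((Fin n → W) × L) × V) :
    (SA W ⊗[ℂ] L) ⊗[ℂ] V :=
  ((∏ i, ι ℂ W (x.1.1 i)) ⊗ₜ[ℂ] x.1.2) ⊗ₜ[ℂ] x.2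

theorem span_prod_ι : Submodule.span ℂ (⋃ n, Set.range fun w : Fin n → W => ∏ i, ι ℂ W (w i))
    = ⊤ := by
  rw [eq_top_iff]
  rintro p -
  induction p using sa_pow_induction with
  | pow w n =>
    exact Submodule.subset_span (Set.mem_iUnion.mpr ⟨n, fun _ => w, by simp⟩)
  | smul r p hp => exact Submodule.smul_mem _ _ hp
  | add p q hp hq => exact add_mem hp hq

theorem span_freeMon : Submodule.span ℂ (⋃ n, Set.range (freeMon W V n)) = ⊤ := by
  rw [eq_top_iff]
  rintro z -
  induction z with
  | zero => exact Submodule.zero_mem _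
  | add x y hx hy => exact add_mem hx hy
  | tmul p v =>
    have hp : p ∈ Submodule.span ℂ (⋃ n, Set.range fun w : Fin n → W => ∏ i, ι ℂ W (w i)) := by
      rw [span_prod_ι]; trivial
    induction hp using Submodule.span_induction with
    | mem p hp =>
      obtain ⟨n, w, rfl⟩ := Set.mem_iUnion.mp hp
      exact Submodule.subset_span (Set.mem_iUnion.mpr ⟨n, (w, v), rfl⟩)
    | zero => rw [TensorProduct.zero_tmul]; exact Submodule.zero_mem _
    | add x y _ _ hx hy => rw [TensorProduct.add_tmul]; exact add_mem hx hy
    | smul r x _ hx => rw [← TensorProduct.smul_tmul']; exact Submodule.smul_mem _ _ hx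

theorem indMul_indMon (σ : P →ₗ⁅ℂ⁆ Module.End ℂ V) (a : L) (n : ℕ) (x : (Fin n → L) × V) :
    indMul σ (UniversalEnvelopingAlgebra.ι ℂ a) (indMon σ n x)
      = indMon σ (n + 1) (Fin.cons a x.1, x.2) := by
  rw [indMon, indMul_mkQ, indMon, List.ofFn_succ, List.prod_cons]
  rfl

theorem indMon_zero (σ : P →ₗ⁅ℂ⁆ Module.End ℂ V) (x : (Fin 0 → L) × V) :
    indMon σ 0 x = (indRelOf σ).mkQ (1 ⊗ₜ x.2) := by
  simp [indMon]

theorem span_indMon (s : Splitting W L P) (σ : P →ₗ⁅ℂ⁆ Module.End ℂ V) :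
    Submodule.span ℂ (⋃ n, Set.range (indMon σ n)) = ⊤ := by
  set M := Submodule.span ℂ (⋃ n, Set.range (indMon σ n)) with hM
  have hact : ∀ a : L, ∀ m ∈ M, indMul σ (UniversalEnvelopingAlgebra.ι ℂ a) m ∈ M := by
    intro a m hm
    induction hm using Submodule.span_induction with
    | mem m hm =>
      obtain ⟨n, x, rfl⟩ := Set.mem_iUnion.mp hm
      rw [indMul_indMon]
      exact Submodule.subset_span (Set.mem_iUnion.mpr ⟨n + 1, _, rfl⟩)
    | zero => rw [map_zero]; exact Submodule.zero_mem _
    | add x y _ _ hx hy => rw [map_add]; exact add_mem hx hy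
    | smul r x _ hx => rw [map_smul]; exact Submodule.smul_mem _ _ hx
  rw [eq_top_iff]
  rintro m -
  obtain ⟨z, rfl⟩ := LinearMap.range_eq_top.mp (s.range_ofFree σ) m
  induction z with
  | zero => rw [map_zero]; exact Submodule.zero_mem _
  | add x y hx hy => rw [map_add]; exact add_mem hx hy
  | tmul p v =>
    induction p using sa_pow_induction with
    | smul r p hp =>
      rw [← TensorProduct.smul_tmul', map_smul]; exact Submodule.smul_mem _ _ hp
    | add p q hp hq => rw [TensorProduct.add_tmul, map_add]; exact add_mem hp hq
    | pow w n =>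
      rw [s.ofFree_tmul, symMap_pow]
      induction n with
      | zero =>
        rw [pow_zero]
        exact Submodule.subset_span (Set.mem_iUnion.mpr ⟨0, (Fin.elim0, v), by rw [indMon_zero]⟩)
      | succ n ih =>
        have h := hact (-s.i w) _ ih
        rwa [indMul_mkQ, map_neg, ← s.negι_apply, ← pow_succ'] at h

theorem adOp_prod {s : Splitting W L P} (n : ℕ) (w : Fin (n + 1) → W) (a : L) : s.adOp ((∏ i, ι ℂ W (w i)) ⊗ₜ a)
    = -∑ i, (∏ k, ι ℂ W (w (i.succAbove k))) ⊗ₜ ⁅s.i (w i), a⁆ := by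
  simp [Splitting.adOp, symDiff_prod, TensorProduct.sum_tmul]


theorem continuous_evalSeries_rTensor {E : Type*} [AddCommGroup E] [Module ℂ E]
    [TopologicalSpace (E ⊗[ℂ] V)] [IsTopologicalAddGroup (E ⊗[ℂ] V)]
    [ContinuousConstSMul ℂ (E ⊗[ℂ] V)] (F : PowerSeries ℂ) {T : Module.End ℂ E}
    (hT : Continuous (T.rTensor V)) : Continuous ((evalSeries F T).rTensor V) := by
  have hpow : ∀ j, Continuous ((T ^ j).rTensor V) := by
    intro j
    induction j with
    | zero =>
      rw [pow_zero, Module.End.one_eq_id, LinearMap.rTensor_id]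
      exact continuous_id
    | succ j ih =>
      rw [pow_succ', Module.End.mul_eq_comp, LinearMap.rTensor_comp]
      exact hT.comp ih
  have e : ∀ z, (evalSeries F T).rTensor V z
      = ∑ j ∈ Finset.range (nilpotencyClass T),
        PowerSeries.coeff j F • (T ^ j).rTensor V z := by
    intro z
    rw [evalSeries]
    have h : ∀ t : Finset ℕ, (∑ j ∈ t, PowerSeries.coeff j F • T ^ j).rTensor V z
        = ∑ j ∈ t, PowerSeries.coeff j F • (T ^ j).rTensor V z := by
      intro t
      induction t using Finset.induction_on with
      | empty => simp
      | insert a t ha ih =>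
        rw [Finset.sum_insert ha, Finset.sum_insert ha, LinearMap.rTensor_add,
          LinearMap.rTensor_smul, LinearMap.add_apply, LinearMap.smul_apply, ih]
    exact h _
  simp only [funext e]
  exact continuous_finsetSum _ fun j _ => continuous_const_smul _ |>.comp (hpow j)

section

variable [TopologicalSpace L] [TopologicalSpace V] (σ : P →ₗ⁅ℂ⁆ Module.End ℂ V)

/-- The action of `L` on the induced module, as a bilinear map. -/
def indAct : L →ₗ[ℂ] Module.End ℂ (IndMod σ) where
  toFun a := indMul σ (UniversalEnvelopingAlgebra.ι ℂ a)
  map_add' a a' := Submodule.linearMap_qext _ (TensorProduct.ext' fun u v => by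
    change indMul σ _ ((indRelOf σ).mkQ _) = indMul σ _ ((indRelOf σ).mkQ _)
      + indMul σ _ ((indRelOf σ).mkQ _)
    rw [indMul_mkQ, indMul_mkQ, indMul_mkQ, map_add, add_mul, TensorProduct.add_tmul, map_add])
  map_smul' r a := Submodule.linearMap_qext _ (TensorProduct.ext' fun u v => by
    change indMul σ _ ((indRelOf σ).mkQ _) = r • indMul σ _ ((indRelOf σ).mkQ _)
    rw [indMul_mkQ, indMul_mkQ, map_smul, smul_mul_assoc, ← TensorProduct.smul_tmul', map_smul])

theorem continuous_indMon [t : TopologicalSpace (IndMod σ)] (ht : t = finestLinear (indMon σ))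
    (n : ℕ) : Continuous (indMon σ n) := by
  subst ht
  exact continuous_finestLinear (indMon σ) n

/-- The induced module is a continuous `L`-module. -/
theorem continuous_indMul (s : Splitting W L P)
    [IsTopologicalAddGroup L] [IsLinearTopology ℂ L] {L₀ : Submodule ℂ L}
    (hL₀ : IsOpen (L₀ : Set L))
    (hcpt : ∀ U : Submodule ℂ L, IsOpen (U : Set L) →
      ∃ s : Set L, s.Finite ∧ L₀ ≤ Submodule.span ℂ s ⊔ U)
    [t : TopologicalSpace (IndMod σ)] (ht : t = finestLinear (indMon σ)) :
    Continuous fun p : L × IndMod σ => indMul σ (UniversalEnvelopingAlgebra.ι ℂ p.1) p.2 := by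
  have : IsTopologicalAddGroup (IndMod σ) := by
    subst ht; exact isTopologicalAddGroup_finestLinear _
  have : IsLinearTopology ℂ (IndMod σ) := by
    subst ht; exact isLinearTopology_finestLinear _
  have : ContinuousConstSMul ℂ (IndMod σ) := by
    subst ht; exact continuousConstSMul_finestLinear _
  refine continuous_bilin_of_finestLinear ht (span_indMon s σ) hL₀ hcpt (indAct σ) fun n => ?_
  have : (fun p : L × ((Fin n → L) × V) => indAct σ p.1 (indMon σ n p.2))
      = fun p => indMon σ (n + 1) (Fin.cons p.1 p.2.1, p.2.2) :=
    funext fun p => indMul_indMon σ p.1 n p.2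
  rw [this]
  refine (continuous_indMon σ ht (n + 1)).comp (Continuous.prodMk ?_ (by fun_prop))
  exact Continuous.finCons (by fun_prop) (by fun_prop)

end

section

variable [TopologicalSpace W] [TopologicalSpace L] [TopologicalSpace V]
  (s : Splitting W L P) (σ : P →ₗ⁅ℂ⁆ Module.End ℂ V)

theorem continuous_fieldMon [t : TopologicalSpace ((SA W ⊗[ℂ] L) ⊗[ℂ] V)]
    (ht : t = finestLinear (fieldMon W L V)) (n : ℕ) : Continuous (fieldMon W L V n) := by
  subst ht
  exact continuous_finestLinear (fieldMon W L V) n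

theorem continuous_freeMon [t : TopologicalSpace (SA W ⊗[ℂ] V)]
    (ht : t = finestLinear (freeMon W V)) (n : ℕ) : Continuous (freeMon W V n) := by
  subst ht
  exact continuous_finestLinear (freeMon W V) n

variable {s}

/-- The continuity of the action of `L` on the free field module, on the spanning vectors. The
actions of all `a ∈ L` are obtained from linear maps on `SA W ⊗ L ⊗ V`, which are continuous for the
finest linear topology that makes the monomials of that space continuous. -/
theorem continuous_rep_freeMon (hi : Continuous s.i) (hq : Continuous s.q)
    (hpr : Continuous s.pr) (hlie : Continuous fun p : L × L => ⁅p.1, p.2⁆)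
    (hσ : Continuous fun x : P × V => σ x.1 x.2)
    [t : TopologicalSpace (SA W ⊗[ℂ] V)] (ht : t = finestLinear (freeMon W V)) (n : ℕ) :
    Continuous fun p : L × ((Fin n → W) × V) => s.rep σ p.1 (freeMon W V n p.2) := by
  have : IsTopologicalAddGroup (SA W ⊗[ℂ] V) := by
    subst ht; exact isTopologicalAddGroup_finestLinear _
  have : IsLinearTopology ℂ (SA W ⊗[ℂ] V) := by
    subst ht; exact isLinearTopology_finestLinear _
  let t₁ : TopologicalSpace ((SA W ⊗[ℂ] L) ⊗[ℂ] V) := finestLinear (fieldMon W L V)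
  have ht₁ : t₁ = finestLinear (fieldMon W L V) := rfl
  have : IsTopologicalAddGroup ((SA W ⊗[ℂ] L) ⊗[ℂ] V) := isTopologicalAddGroup_finestLinear _
  have : IsLinearTopology ℂ ((SA W ⊗[ℂ] L) ⊗[ℂ] V) := isLinearTopology_finestLinear _
  have : ContinuousConstSMul ℂ ((SA W ⊗[ℂ] L) ⊗[ℂ] V) := continuousConstSMul_finestLinear _
  have hmon := continuous_fieldMon (W := W) (L := L) (V := V) ht₁
  have had : Continuous (s.adOp.rTensor V) := by
    refine continuous_of_finestLinear ht₁ _ fun m => ?_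
    cases m with
    | zero =>
      have : (fun y => s.adOp.rTensor V (fieldMon W L V 0 y)) = fun _ => 0 := by
        funext y
        simp [fieldMon, s.adOp_one]
      rw [this]
      exact continuous_const
    | succ m =>
      have : (fun y => s.adOp.rTensor V (fieldMon W L V (m + 1) y)) = fun y => -∑ i : Fin (m + 1),
          fieldMon W L V m ((fun k => y.1.1 (i.succAbove k), ⁅s.i (y.1.1 i), y.1.2⁆), y.2) := by
        funext y
        simp [fieldMon, adOp_prod, TensorProduct.sum_tmul, TensorProduct.neg_tmul]
      rw [this]
      refine (continuous_finsetSum _ fun i _ => (hmon m).comp ?_).neg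
      have h1 : Continuous fun y : ((Fin (m + 1) → W) × L) × V => ⁅s.i (y.1.1 i), y.1.2⁆ :=
        hlie.comp ((hi.comp (by fun_prop)).prodMk (by fun_prop))
      fun_prop
  have hexp : Continuous (s.expOp.rTensor V) :=
    continuous_evalSeries_rTensor _ (by
      rw [LinearMap.rTensor_neg]
      exact had.neg)
  have htodd : Continuous (s.toddOp.rTensor V) := continuous_evalSeries_rTensor _ had
  have hproj : Continuous (((s.i ∘ₗ s.q).lTensor (SA W)).rTensor V) := by
    refine continuous_of_finestLinear ht₁ _ fun m => ?_
    have : (fun y => ((s.i ∘ₗ s.q).lTensor (SA W)).rTensor V (fieldMon W L V m y))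
        = fun y => fieldMon W L V m ((y.1.1, s.i (s.q y.1.2)), y.2) := by
      funext y
      simp [fieldMon]
    rw [this]
    exact (hmon m).comp (by fun_prop)
  have hmul : Continuous ((LinearMap.mul' ℂ (SA W) ∘ₗ (ι ℂ W ∘ₗ s.q).lTensor (SA W)).rTensor V) := by
    refine continuous_of_finestLinear ht₁ _ fun m => ?_
    have : (fun y => (LinearMap.mul' ℂ (SA W) ∘ₗ (ι ℂ W ∘ₗ s.q).lTensor (SA W)).rTensor V
        (fieldMon W L V m y))
        = fun y => freeMon W V (m + 1) (Fin.cons (s.q y.1.2) y.1.1, y.2) := by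
      funext y
      simp [fieldMon, freeMon, Fin.prod_univ_succ, mul_comm]
    rw [this]
    refine (continuous_freeMon ht (m + 1)).comp (Continuous.prodMk ?_ (by fun_prop))
    exact Continuous.finCons (by fun_prop) (by fun_prop)
  have hpar : Continuous ((TensorProduct.lift (σ.toLinearMap ∘ₗ s.pr)).lTensor (SA W) ∘ₗ
      (TensorProduct.assoc ℂ (SA W) L V).toLinearMap) := by
    refine continuous_of_finestLinear ht₁ _ fun m => ?_
    have : (fun y => ((TensorProduct.lift (σ.toLinearMap ∘ₗ s.pr)).lTensor (SA W) ∘ₗ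
      (TensorProduct.assoc ℂ (SA W) L V).toLinearMap) (fieldMon W L V m y))
        = fun y => freeMon W V m (y.1.1, σ (s.pr y.1.2) y.2) := by
      funext y
      simp [fieldMon, freeMon]
    rw [this]
    have h1 : Continuous fun y : ((Fin m → W) × L) × V => σ (s.pr y.1.2) y.2 :=
      hσ.comp ((hpr.comp (by fun_prop)).prodMk (by fun_prop))
    exact (continuous_freeMon ht m).comp (by fun_prop)
  have e : (fun p : L × ((Fin n → W) × V) => s.rep σ p.1 (freeMon W V n p.2)) = fun p =>
      -((LinearMap.mul' ℂ (SA W) ∘ₗ (ι ℂ W ∘ₗ s.q).lTensor (SA W)).rTensor V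
        (s.toddOp.rTensor V (((s.i ∘ₗ s.q).lTensor (SA W)).rTensor V
          (s.expOp.rTensor V (fieldMon W L V n ((p.2.1, p.1), p.2.2))))))
      + ((TensorProduct.lift (σ.toLinearMap ∘ₗ s.pr)).lTensor (SA W) ∘ₗ
        (TensorProduct.assoc ℂ (SA W) L V).toLinearMap)
          (s.expOp.rTensor V (fieldMon W L V n ((p.2.1, p.1), p.2.2))) := by
    funext p
    rw [s.rep_apply, Splitting.freeOp, LinearMap.add_apply, freeMon, fieldMon]
    simp [Splitting.vectorOp, Splitting.parOp]
  rw [e]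
  have h2 : Continuous fun p : L × ((Fin n → W) × V) =>
      s.expOp.rTensor V (fieldMon W L V n ((p.2.1, p.1), p.2.2)) :=
    hexp.comp ((hmon n).comp (by fun_prop))
  exact (hmul.comp (htodd.comp (hproj.comp h2))).neg.add (hpar.comp h2)

/-- The free field module is a continuous `L`-module. -/
theorem continuous_rep (hi : Continuous s.i) (hq : Continuous s.q)
    (hpr : Continuous s.pr) (hlie : Continuous fun p : L × L => ⁅p.1, p.2⁆)
    (hσ : Continuous fun x : P × V => σ x.1 x.2)
    [IsTopologicalAddGroup L] [IsLinearTopology ℂ L] {L₀ : Submodule ℂ L}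
    (hL₀ : IsOpen (L₀ : Set L))
    (hcpt : ∀ U : Submodule ℂ L, IsOpen (U : Set L) →
      ∃ s : Set L, s.Finite ∧ L₀ ≤ Submodule.span ℂ s ⊔ U)
    [t : TopologicalSpace (SA W ⊗[ℂ] V)] (ht : t = finestLinear (freeMon W V)) :
    Continuous fun p : L × (SA W ⊗[ℂ] V) => s.rep σ p.1 p.2 := by
  have : IsTopologicalAddGroup (SA W ⊗[ℂ] V) := by
    subst ht; exact isTopologicalAddGroup_finestLinear _
  have : IsLinearTopology ℂ (SA W ⊗[ℂ] V) := by
    subst ht; exact isLinearTopology_finestLinear _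
  have : ContinuousConstSMul ℂ (SA W ⊗[ℂ] V) := by
    subst ht; exact continuousConstSMul_finestLinear _
  exact continuous_bilin_of_finestLinear ht span_freeMon hL₀ hcpt (s.rep σ).toLinearMap
    (continuous_rep_freeMon σ hi hq hpr hlie hσ ht)

/-- A monomial of the induced module is obtained from `1 ⊗ v` by iterated action. -/
theorem continuous_toFree
    [t : TopologicalSpace (SA W ⊗[ℂ] V)] (ht : t = finestLinear (freeMon W V))
    (hrep : Continuous fun p : L × (SA W ⊗[ℂ] V) => s.rep σ p.1 p.2)
    [t' : TopologicalSpace (IndMod σ)] (ht' : t' = finestLinear (indMon σ)) :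
    Continuous (s.toFree σ) := by
  have : IsTopologicalAddGroup (SA W ⊗[ℂ] V) := by
    subst ht; exact isTopologicalAddGroup_finestLinear _
  have : IsLinearTopology ℂ (SA W ⊗[ℂ] V) := by
    subst ht; exact isLinearTopology_finestLinear _
  refine continuous_of_finestLinear ht' _ fun n => ?_
  induction n with
  | zero =>
    have : (fun y => s.toFree σ (indMon σ 0 y)) = fun y => freeMon W V 0 (Fin.elim0, y.2) := by
      funext y
      rw [indMon_zero, s.toFree_mkQ]
      simp [freeMon]
    rw [this]
    exact (continuous_freeMon ht 0).comp (by fun_prop)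
  | succ n ih =>
    have : (fun y => s.toFree σ (indMon σ (n + 1) y))
        = fun y => s.rep σ (y.1 0) (s.toFree σ (indMon σ n (Fin.tail y.1, y.2))) := by
      funext y
      rw [← s.toFree_indMul, indMul_indMon]
      simp only [Fin.cons_self_tail]
    rw [this]
    have h1 : Continuous fun y : (Fin (n + 1) → L) × V => (Fin.tail y.1, y.2) :=
      Continuous.prodMk (continuous_pi fun i => by unfold Fin.tail; fun_prop) (by fun_prop)
    have h2 : Continuous fun y : (Fin (n + 1) → L) × V => y.1 0 := by fun_prop
    have h3 : Continuous fun y : (Fin (n + 1) → L) × V =>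
        s.toFree σ (indMon σ n (Fin.tail y.1, y.2)) := ih.comp h1
    have h4 := h2.prodMk h3
    have h5 := hrep.comp h4
    exact h5

/-- Induction on the degree, by Euler's formula for symmetrization. -/
theorem continuous_ofFree (hi : Continuous s.i)
    [t : TopologicalSpace (SA W ⊗[ℂ] V)] (ht : t = finestLinear (freeMon W V))
    [t' : TopologicalSpace (IndMod σ)] (ht' : t' = finestLinear (indMon σ))
    (hact : Continuous fun p : L × IndMod σ =>
      indMul σ (UniversalEnvelopingAlgebra.ι ℂ p.1) p.2) :
    Continuous (s.ofFree σ) := by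
  have : IsTopologicalAddGroup (IndMod σ) := by
    subst ht'; exact isTopologicalAddGroup_finestLinear _
  have : IsLinearTopology ℂ (IndMod σ) := by
    subst ht'; exact isLinearTopology_finestLinear _
  have : ContinuousConstSMul ℂ (IndMod σ) := by
    subst ht'; exact continuousConstSMul_finestLinear _
  refine continuous_of_finestLinear ht _ fun n => ?_
  induction n with
  | zero =>
    have : (fun y => s.ofFree σ (freeMon W V 0 y)) = fun y => indMon σ 0 (Fin.elim0, y.2) := by
      funext y
      have h := symMap_pow s.negι 0 0
      rw [pow_zero, pow_zero] at h
      rw [indMon_zero, freeMon, s.ofFree_tmul]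
      simp [h]
    rw [this]
    exact (continuous_indMon σ ht' 0).comp (by fun_prop)
  | succ n ih =>
    have h3 : ((n : ℂ) + 1) ≠ 0 := by exact_mod_cast n.succ_ne_zero
    have : (fun y => s.ofFree σ (freeMon W V (n + 1) y)) = fun y => ((n : ℂ) + 1)⁻¹ •
        ∑ i, -indMul σ (UniversalEnvelopingAlgebra.ι ℂ (s.i (y.1 i)))
          (s.ofFree σ (freeMon W V n (fun k => y.1 (i.succAbove k), y.2))) := by
      funext y
      rw [eq_inv_smul_iff₀ h3, freeMon, s.ofFree_tmul, ← map_smul, TensorProduct.smul_tmul',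
        smul_symMap_prod, TensorProduct.sum_tmul, map_sum]
      refine Finset.sum_congr rfl fun i _ => ?_
      rw [freeMon, s.ofFree_tmul, indMul_mkQ, s.negι_apply, neg_mul, TensorProduct.neg_tmul,
        map_neg]
    rw [this]
    refine continuous_const_smul _ |>.comp (continuous_finsetSum _ fun i _ =>
      (hact.comp (Continuous.prodMk (hi.comp (by fun_prop)) (ih.comp ?_))).neg)
    fun_prop

end

/-! ### Separation -/

section Hausdorff

variable {W' V' : Type*} [AddCommGroup W'] [Module ℂ W'] [AddCommGroup V'] [Module ℂ V']

/-- The algebra map of symmetric algebras induced by a linear map. -/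
def saMap (f : W →ₗ[ℂ] W') : SA W →ₐ[ℂ] SA W' := SymmetricAlgebra.lift (ι ℂ W' ∘ₗ f)

theorem saMap_ι (f : W →ₗ[ℂ] W') (w : W) : saMap f (ι ℂ W w) = ι ℂ W' (f w) := by
  simp [saMap]

theorem saMap_comp {W'' : Type*} [AddCommGroup W''] [Module ℂ W''] (g : W' →ₗ[ℂ] W'')
    (f : W →ₗ[ℂ] W') (p : SA W) : saMap (g ∘ₗ f) p = saMap g (saMap f p) := by
  have : saMap (g ∘ₗ f) = (saMap g).comp (saMap f) :=
    SymmetricAlgebra.algHom_ext (LinearMap.ext fun w => by simp [saMap_ι])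
  rw [this]
  rfl

theorem saMap_id (p : SA W) : saMap (LinearMap.id : W →ₗ[ℂ] W) p = p := by
  have : saMap (LinearMap.id : W →ₗ[ℂ] W) = AlgHom.id ℂ _ :=
    SymmetricAlgebra.algHom_ext (LinearMap.ext fun w => by simp [saMap_ι])
  rw [this]
  rfl

/-- Every element of `S(W)` comes from a finite-dimensional subspace. -/
theorem exists_mem_range_saMap (p : SA W) : ∃ A : Submodule ℂ W, FiniteDimensional ℂ A ∧
    p ∈ LinearMap.range (saMap A.subtype).toLinearMap := by
  have hmono : ∀ {A B : Submodule ℂ W}, A ≤ B → ∀ {p}, p ∈ LinearMap.range (saMap A.subtype).toLinearMap →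
      p ∈ LinearMap.range (saMap B.subtype).toLinearMap := by
    rintro A B h _ ⟨q, rfl⟩
    exact ⟨saMap (Submodule.inclusion h) q, (saMap_comp _ _ _).symm⟩
  induction p using sa_pow_induction with
  | pow w n =>
    refine ⟨ℂ ∙ w, inferInstance, ι ℂ _ ⟨w, Submodule.mem_span_singleton_self w⟩ ^ n, ?_⟩
    simp [saMap_ι]
  | smul r p hp =>
    obtain ⟨A, hA, h⟩ := hp
    exact ⟨A, hA, Submodule.smul_mem _ _ h⟩
  | add p q hp hq =>
    obtain ⟨A, hA, h⟩ := hp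
    obtain ⟨B, hB, h'⟩ := hq
    exact ⟨A ⊔ B, inferInstance, add_mem (hmono le_sup_left h) (hmono le_sup_right h')⟩

theorem exists_mem_range_map_saMap (z : SA W ⊗[ℂ] V) :
    ∃ (A : Submodule ℂ W) (B : Submodule ℂ V), FiniteDimensional ℂ A ∧ FiniteDimensional ℂ B ∧
      z ∈ LinearMap.range (TensorProduct.map (saMap A.subtype).toLinearMap B.subtype) := by
  have hmono : ∀ {A A' : Submodule ℂ W} {B B' : Submodule ℂ V}, A ≤ A' → B ≤ B' →
      LinearMap.range (TensorProduct.map (saMap A.subtype).toLinearMap B.subtype) ≤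
      LinearMap.range (TensorProduct.map (saMap A'.subtype).toLinearMap B'.subtype) := by
    rintro A A' B B' h h' _ ⟨q, rfl⟩
    refine ⟨TensorProduct.map (saMap (Submodule.inclusion h)).toLinearMap
      (Submodule.inclusion h') q, ?_⟩
    rw [← LinearMap.comp_apply, ← TensorProduct.map_comp]
    congr 2
    exact LinearMap.ext fun p => (saMap_comp _ _ _).symm
  induction z with
  | zero => exact ⟨⊥, ⊥, inferInstance, inferInstance, Submodule.zero_mem _⟩
  | add x y hx hy =>
    obtain ⟨A, B, hA, hB, h⟩ := hx
    obtain ⟨A', B', hA', hB', h'⟩ := hy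
    exact ⟨A ⊔ A', B ⊔ B', inferInstance, inferInstance,
      add_mem (hmono le_sup_left le_sup_left h) (hmono le_sup_right le_sup_right h')⟩
  | tmul p v =>
    obtain ⟨A, hA, q, hq⟩ := exists_mem_range_saMap p
    exact ⟨A, ℂ ∙ v, hA, inferInstance, q ⊗ₜ ⟨v, Submodule.mem_span_singleton_self v⟩, by
      rw [TensorProduct.map_tmul, hq]; rfl⟩

theorem exists_leftInverse_mkQ_subtype {A N : Submodule ℂ W} (h : A ⊓ N = ⊥) :
    ∃ l : W ⧸ N →ₗ[ℂ] A, l ∘ₗ N.mkQ ∘ₗ A.subtype = LinearMap.id := by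
  refine LinearMap.exists_leftInverse_of_injective _ ?_
  rw [LinearMap.ker_eq_bot']
  intro x hx
  have h1 : (x : W) ∈ A ⊓ N := ⟨x.2, (Submodule.Quotient.mk_eq_zero N).mp hx⟩
  rw [h] at h1
  exact Subtype.ext ((Submodule.mem_bot ℂ).mp h1)

/-- The free field module is Hausdorff: an element that comes from finite-dimensional subspaces
`A` of `W` and `B` of `V` has a nonzero image in the discrete module `S(W / W₀) ⊗ V / V₀` for
suitable open subspaces `W₀` and `V₀`. -/
theorem t2Space_free [TopologicalSpace W] [IsTopologicalAddGroup W] [IsLinearTopology ℂ W]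
    [T2Space W] [TopologicalSpace V] [IsTopologicalAddGroup V] [IsLinearTopology ℂ V] [T2Space V]
    [t : TopologicalSpace (SA W ⊗[ℂ] V)] (ht : t = finestLinear (freeMon W V)) :
    T2Space (SA W ⊗[ℂ] V) := by
  refine ⟨fun x y hxy => ?_⟩
  obtain ⟨A, B, hA, hB, e, he⟩ := exists_mem_range_map_saMap (x - y)
  obtain ⟨W₀, hW₀, hAW⟩ := exists_isOpen_inf_eq_bot A
  obtain ⟨V₀, hV₀, hBV⟩ := exists_isOpen_inf_eq_bot B
  let : TopologicalSpace (SA (W ⧸ W₀) ⊗[ℂ] (V ⧸ V₀)) := ⊥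
  have : DiscreteTopology (SA (W ⧸ W₀) ⊗[ℂ] (V ⧸ V₀)) := ⟨rfl⟩
  let g := TensorProduct.map (saMap W₀.mkQ).toLinearMap V₀.mkQ
  have hg : Continuous g := by
    refine continuous_of_finestLinear ht g fun n => ?_
    have hd : DiscreteTopology (W ⧸ W₀) := QuotientAddGroup.discreteTopology hW₀
    have hd' : DiscreteTopology (V ⧸ V₀) := QuotientAddGroup.discreteTopology hV₀
    have : (fun y => g (freeMon W V n y))
        = (fun z : (Fin n → W ⧸ W₀) × (V ⧸ V₀) => freeMon (W ⧸ W₀) (V ⧸ V₀) n z) ∘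
          fun y => (fun k => W₀.mkQ (y.1 k), V₀.mkQ y.2) := by
      funext y
      simp [g, freeMon, map_prod, saMap_ι]
    rw [this]
    have h1 : Continuous W₀.mkQ := continuous_quot_mk
    have h2 : Continuous V₀.mkQ := continuous_quot_mk
    exact continuous_of_discreteTopology.comp (by fun_prop)
  refine separated_by_continuous hg fun h => hxy ?_
  obtain ⟨l, hl⟩ := exists_leftInverse_mkQ_subtype hAW
  obtain ⟨l', hl'⟩ := exists_leftInverse_mkQ_subtype hBV
  have h0 : g (x - y) = 0 := by rw [map_sub, h, sub_self]
  rw [← he] at h0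
  have h1 : TensorProduct.map (saMap l).toLinearMap l' (g (TensorProduct.map
      (saMap A.subtype).toLinearMap B.subtype e)) = e := by
    rw [← LinearMap.comp_apply, ← LinearMap.comp_apply, ← TensorProduct.map_comp,
      ← TensorProduct.map_comp, LinearMap.comp_assoc, LinearMap.comp_assoc, hl']
    have : (saMap l).toLinearMap ∘ₗ (saMap W₀.mkQ).toLinearMap ∘ₗ (saMap A.subtype).toLinearMap
        = LinearMap.id := LinearMap.ext fun p => by
      change saMap l (saMap W₀.mkQ (saMap A.subtype p)) = p
      rw [← saMap_comp, ← saMap_comp, LinearMap.comp_assoc, hl, saMap_id]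
    rw [this, TensorProduct.map_id]
    rfl
  rw [h0, map_zero] at h1
  rw [← h1, map_zero] at he
  exact sub_eq_zero.mp he.symm

end Hausdorff

end Continuity

/-! ### The decomposition of the affine algebra -/

section Decomposition

open LieAlgebra LieAlgebra.IsKilling LieModule Module

variable {𝔤 : Type*} [LieRing 𝔤] [LieAlgebra ℂ 𝔤]

theorem bracket_tmul_aux (f g : Laurent) (x y : 𝔤) :
    ⁅f ⊗ₜ[ℂ] x, g ⊗ₜ[ℂ] y⁆ = (f * g) ⊗ₜ[ℂ] ⁅x, y⁆ :=
  LieAlgebra.ExtendScalars.bracket_tmul ℂ Laurent 𝔤 𝔤 f g x y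

theorem lie_c (r : ℂ) (x : Affine 𝔤 r) : ⁅x, Affine.c 𝔤 r⁆ = 0 := by
  have h : Affine.loop 𝔤 r (Affine.c 𝔤 r) = 0 := rfl
  exact Affine.ext (by rw [Affine.loop_lie, h, lie_zero]; rfl)
    (by rw [Affine.level_lie, h, map_zero]; rfl)

variable [FiniteDimensional ℂ 𝔤] [LieAlgebra.IsSimple ℂ 𝔤]
  {H : LieSubalgebra ℂ 𝔤} [H.IsCartanSubalgebra] (b : (rootSystem H).Base) (S : Set b.support)

/-- The sum of the root spaces with `Σ`-height in `A`. -/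
def heightSpace (A : Set ℤ) : Submodule ℂ 𝔤 :=
  ⨆ χ ∈ heightSet b S A, (rootSpace H χ).toSubmodule

variable {b S}

theorem heightSet_add {A B C : Set ℤ} (h : ∀ m ∈ A, ∀ n ∈ B, m + n ∈ C) {χ χ' : H → ℂ}
    (hχ : χ ∈ heightSet b S A) (hχ' : χ' ∈ heightSet b S B) : χ + χ' ∈ heightSet b S C := by
  obtain ⟨l, rfl, m, hm, hl⟩ := hχ
  obtain ⟨l', rfl, n, hn, hl'⟩ := hχ'
  exact ⟨l + l', rfl, m + n, h m hm n hn, by rw [map_add, hl, hl']; push_cast; rfl⟩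

theorem eq_zero_mem_of_zero_mem_heightSet {A : Set ℤ} (h : (0 : H → ℂ) ∈ heightSet b S A) :
    (0 : ℤ) ∈ A := by
  obtain ⟨l, hl, n, hn, h⟩ := h
  have : l = 0 := by ext x; exact (congrFun hl x).symm
  rw [this, map_zero] at h
  have h0 : n = 0 := by exact_mod_cast h.symm
  exact h0 ▸ hn

theorem lie_mem_heightSpace {A B C : Set ℤ} (h : ∀ m ∈ A, ∀ n ∈ B, m + n ∈ C) {x y : 𝔤}
    (hx : x ∈ heightSpace b S A) (hy : y ∈ heightSpace b S B) : ⁅x, y⁆ ∈ heightSpace b S C := by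
  have h1 : heightSpace b S A ≤ (heightSpace b S C).comap
      ((LieModule.toEnd ℂ 𝔤 𝔤).toLinearMap.flip y) := by
    refine iSup₂_le fun χ hχ x hx => ?_
    have h2 : heightSpace b S B ≤ (heightSpace b S C).comap (LieModule.toEnd ℂ 𝔤 𝔤 x) := by
      refine iSup₂_le fun χ' hχ' y hy => ?_
      exact (le_iSup₂ (f := fun χ (_ : χ ∈ heightSet b S C) => (rootSpace H χ).toSubmodule)
        (χ + χ') (heightSet_add h hχ hχ')) (lie_mem_genWeightSpace_of_mem_genWeightSpace hx hy)
    exact h2 hy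
  exact h1 hx

theorem killingForm_eq_zero_of_mem_heightSpace {A B : Set ℤ} (h : ∀ m ∈ A, ∀ n ∈ B, m + n ≠ 0)
    {x y : 𝔤} (hx : x ∈ heightSpace b S A) (hy : y ∈ heightSpace b S B) :
    killingForm ℂ 𝔤 x y = 0 := by
  have h1 : heightSpace b S A ≤ LinearMap.ker ((killingForm ℂ 𝔤).flip y) := by
    refine iSup₂_le fun χ hχ x hx => ?_
    have h2 : heightSpace b S B ≤ LinearMap.ker (killingForm ℂ 𝔤 x) := by
      refine iSup₂_le fun χ' hχ' y hy => ?_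
      refine killingForm_apply_eq_zero_of_mem_rootSpace_of_add_ne_zero ℂ 𝔤 H hx hy fun h0 => ?_
      have := heightSet_add (C := {0}ᶜ) h hχ hχ'
      rw [h0] at this
      exact eq_zero_mem_of_zero_mem_heightSet this rfl
    exact h2 hy
  exact h1 hx

/-- Both sides are complements of the parabolic subalgebra, and one contains the other. -/
theorem oppNilradical_eq : oppNilradical b S = heightSpace b S {n | n < 0} := by
  have hle : oppNilradical b S ≤ heightSpace b S {n | n < 0} := by
    have := oppNilradical_le b S
    simp only [LieSubmodule.iSup_toSubmodule] at this
    exact this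
  refine le_antisymm hle fun x hx => ?_
  have hx' : x ∈ oppNilradical b S ⊔ (parabolic b S).toSubmodule := by
    rw [(isCompl_oppNilradical_parabolic b S).sup_eq_top]; trivial
  obtain ⟨u, hu, p, hp, rfl⟩ := Submodule.mem_sup.mp hx'
  have hd := (iSupIndep_genWeightSpace ℂ H 𝔤).disjoint_biSup_biSup (s := heightSet b S {n | n < 0})
    (t := heightSet b S {n | 0 ≤ n}) (by
      rw [Set.disjoint_left]
      rintro _ ⟨l, rfl, n, hn, hl⟩ ⟨l', hll, n', hn', hl'⟩
      have : l = l' := DFunLike.coe_injective hll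
      rw [← this, hl] at hl'
      have : n = n' := by exact_mod_cast hl'
      exact absurd (show n < 0 from hn) (not_lt.mpr (this ▸ show (0 : ℤ) ≤ n' from hn')))
  rw [← LieSubmodule.disjoint_toSubmodule] at hd
  have h1 : p ∈ (⨆ χ, ⨆ (_ : χ ∈ heightSet b S {n | n < 0}), rootSpace H χ).toSubmodule := by
    have := sub_mem hx (hle hu)
    rw [add_sub_cancel_left] at this
    simp only [LieSubmodule.iSup_toSubmodule]
    exact this
  have h2 : p ∈ (⨆ χ, ⨆ (_ : χ ∈ heightSet b S {n | 0 ≤ n}), rootSpace H χ).toSubmodule :=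
    (levi_sup_nilradical b S).le hp
  rw [Submodule.disjoint_def.mp hd p h1 h2, add_zero]
  exact hu

variable (b S) in
/-- The `Σ`-heights are bounded. -/
theorem exists_heightSpace_eq : ∃ M : ℤ, heightSpace b S {n | n < M} = ⊤ ∧
    heightSpace b S {n | n < -M} = ⊥ := by
  choose f hf hf1 hf2 using sigmaHeight_root b S
  obtain ⟨M₀, hM₀⟩ := (Set.finite_range fun α => |f α|).bddAbove
  have hM : ∀ α, |f α| ≤ M₀ := fun α => hM₀ ⟨α, rfl⟩
  refine ⟨max M₀ 0 + 1, ?_, ?_⟩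
  · have htop := iSup_genWeightSpace_eq_top' ℂ H 𝔤
    rw [← LieSubmodule.toSubmodule_inj, LieSubmodule.iSup_toSubmodule,
      LieSubmodule.top_toSubmodule] at htop
    rw [eq_top_iff, ← htop]
    refine iSup_le fun χ => ?_
    refine le_iSup₂ (f := fun χ (_ : χ ∈ heightSet b S {n | n < max M₀ 0 + 1}) =>
      (rootSpace H χ).toSubmodule) (χ : H → ℂ) ?_
    by_cases h0 : (χ : H → ℂ) = 0
    · rw [h0]
      exact ⟨0, rfl, 0, show (0 : ℤ) < max M₀ 0 + 1 by omega, by simp⟩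
    · obtain ⟨α, hα⟩ := exists_root_of_ne_bot χ.genWeightSpace_ne_bot h0
      rw [← hα]
      refine mem_heightSet_root b S α (f α) (hf α) _ (show f α < max M₀ 0 + 1 from ?_)
      have := le_abs_self (f α)
      have := hM α
      omega
  · rw [eq_bot_iff]
    refine iSup₂_le fun χ hχ => ?_
    by_contra hb
    have hb' : rootSpace H χ ≠ ⊥ := fun h => hb (by rw [h]; exact le_rfl)
    have h0 : χ ≠ 0 := by
      rintro rfl
      have : (0 : ℤ) < -(max M₀ 0 + 1) := eq_zero_mem_of_zero_mem_heightSet hχ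
      omega
    obtain ⟨α, rfl⟩ := exists_root_of_ne_bot hb' h0
    obtain ⟨l, hl, n, hn, hln⟩ := hχ
    have e : l = (rootSystem H).root α := by ext x; exact (congrFun hl x).symm
    rw [e, hf] at hln
    have hn' : f α = n := by exact_mod_cast hln
    have hn2 : n < -(max M₀ 0 + 1) := hn
    have := neg_abs_le (f α)
    have := hM α
    omega

variable (b S) (r : ℂ)

theorem loop_uIncl (w : UBar b S) :
    Affine.loop 𝔤 r (uIncl b S r w) = (oppNilradical b S).subtype.lTensor Laurent w := rfl

theorem uProj_uIncl (w : UBar b S) : uProj b S r (uIncl b S r w) = w := by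
  rw [uProj, LinearMap.comp_apply, loop_uIncl, ← LinearMap.lTensor_comp_apply]
  have : (oppNilradical b S).projectionOnto (parabolic b S).toSubmodule
      (isCompl_oppNilradical_parabolic b S) ∘ₗ (oppNilradical b S).subtype = LinearMap.id :=
    LinearMap.ext fun x => Submodule.projectionOnto_apply_left _ x
  rw [this, LinearMap.lTensor_id]
  rfl

theorem coe_pProj (x : Affine 𝔤 r) :
    (pProj b S r x : Affine 𝔤 r) = x - uIncl b S r (uProj b S r x) := rfl

theorem uProj_coe (x : pNat b S r) : uProj b S r x = 0 := by
  obtain ⟨y, hy⟩ := x.2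
  rw [uProj, LinearMap.comp_apply, ← hy, ← LinearMap.lTensor_comp_apply]
  have : (oppNilradical b S).projectionOnto (parabolic b S).toSubmodule
      (isCompl_oppNilradical_parabolic b S) ∘ₗ (parabolic b S).toSubmodule.subtype = 0 :=
    LinearMap.ext fun x => Submodule.projectionOnto_apply_right _ x
  rw [this, LinearMap.lTensor_zero]
  rfl

/-- `ū_nat` is a subalgebra. The cocycle vanishes on `ū((t))`, since `ū` is isotropic for the Killing form. -/
theorem exists_lie_uIncl (w w' : UBar b S) :
    ∃ w'', ⁅uIncl b S r w, uIncl b S r w'⁆ = uIncl b S r w'' := by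
  induction w using TensorProduct.induction_on with
  | zero => exact ⟨0, by simp⟩
  | add x y hx hy =>
    obtain ⟨x', hx⟩ := hx
    obtain ⟨y', hy⟩ := hy
    exact ⟨x' + y', by rw [map_add, add_lie, hx, hy, map_add]⟩
  | tmul f x =>
    induction w' using TensorProduct.induction_on with
    | zero => exact ⟨0, by simp⟩
    | add x y hx hy =>
      obtain ⟨x', hx⟩ := hx
      obtain ⟨y', hy⟩ := hy
      exact ⟨x' + y', by rw [map_add, lie_add, hx, hy, map_add]⟩
    | tmul g y =>
      have hx : (x : 𝔤) ∈ heightSpace b S {n | n < 0} := oppNilradical_eq.le x.2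
      have hy : (y : 𝔤) ∈ heightSpace b S {n | n < 0} := oppNilradical_eq.le y.2
      have hxy : ⁅(x : 𝔤), (y : 𝔤)⁆ ∈ oppNilradical b S :=
        oppNilradical_eq.ge (lie_mem_heightSpace
          (fun m (hm : m < 0) n (hn : n < 0) => add_neg hm hn) hx hy)
      refine ⟨(f * g) ⊗ₜ ⟨_, hxy⟩, Affine.ext ?_ ?_⟩
      · exact bracket_tmul_aux f g (x : 𝔤) (y : 𝔤)
      · refine (cocycle_tmul r f g (x : 𝔤) (y : 𝔤)).trans ?_
        rw [killingForm_eq_zero_of_mem_heightSpace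
          (fun m (hm : m < 0) n (hn : n < 0) => (add_neg hm hn).ne) hx hy]
        rw [mul_zero, zero_mul, neg_zero]
        rfl

theorem loop_lie_uIncl {m : ℤ} (w : UBar b S) {x : Affine 𝔤 r}
    (hx : Affine.loop 𝔤 r x ∈ LinearMap.range
      ((heightSpace b S {n | n < m}).subtype.lTensor Laurent)) :
    Affine.loop 𝔤 r ⁅uIncl b S r w, x⁆ ∈ LinearMap.range
      ((heightSpace b S {n | n < m - 1}).subtype.lTensor Laurent) := by
  obtain ⟨z, hz⟩ := hx
  rw [Affine.loop_lie, loop_uIncl, ← hz]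
  clear hz
  induction w using TensorProduct.induction_on with
  | zero => simp
  | add u v hu hv => rw [map_add, add_lie]; exact add_mem hu hv
  | tmul f x =>
    induction z with
    | zero => simp
    | add u v hu hv => rw [map_add, lie_add]; exact add_mem hu hv
    | tmul g y =>
      have hx : (x : 𝔤) ∈ heightSpace b S {n | n < 0} := oppNilradical_eq.le x.2
      have hxy : ⁅(x : 𝔤), (y : 𝔤)⁆ ∈ heightSpace b S {n | n < m - 1} :=
        lie_mem_heightSpace (fun k (hk : k < 0) n (hn : n < m) =>
          show k + n < m - 1 by omega) hx y.2
      exact ⟨(f * g) ⊗ₜ ⟨_, hxy⟩, (bracket_tmul_aux f g (x : 𝔤) (y : 𝔤)).symm⟩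

/-- The lower series `ĝ, [ū_nat, ĝ], [ū_nat, [ū_nat, ĝ]], …`. -/
def uSeries : ℕ → Submodule ℂ (Affine 𝔤 r)
  | 0 => ⊤
  | k + 1 => Submodule.span ℂ {y | ∃ w, ∃ x ∈ uSeries k, y = ⁅uIncl b S r w, x⁆}

/-- The lower series vanishes eventually: the `Σ`-height of the loop components decreases, and one
more step annihilates the multiples of `c`. -/
theorem exists_uSeries_eq_bot : ∃ n, uSeries b S r n = ⊥ := by
  obtain ⟨M, htop, hbot⟩ := exists_heightSpace_eq b S
  have key : ∀ k : ℕ, uSeries b S r k ≤ (LinearMap.range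
      ((heightSpace b S {n | n < M - k}).subtype.lTensor Laurent)).comap (Affine.loop 𝔤 r) := by
    intro k
    induction k with
    | zero =>
      rintro x -
      rw [Nat.cast_zero, sub_zero, htop, Submodule.mem_comap]
      induction Affine.loop 𝔤 r x with
      | zero => exact Submodule.zero_mem _
      | add x y hx hy => exact add_mem hx hy
      | tmul f x => exact ⟨f ⊗ₜ ⟨x, trivial⟩, rfl⟩
    | succ k ih =>
      refine Submodule.span_le.mpr ?_
      rintro _ ⟨w, x, hx, rfl⟩
      have := loop_lie_uIncl b S r w (ih hx)
      push_cast
      rwa [sub_sub] at this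
  have hk : uSeries b S r (2 * M).toNat ≤ LinearMap.ker (Affine.loop 𝔤 r) := by
    intro x hx
    obtain ⟨z, hz⟩ := key _ hx
    have h0 : heightSpace b S {n | n < M - ((2 * M).toNat : ℤ)} ≤ ⊥ := by
      rw [← hbot]
      refine biSup_mono ?_
      rintro _ ⟨l, rfl, n, hn, hl⟩
      refine ⟨l, rfl, n, ?_, hl⟩
      have : n < M - ((2 * M).toNat : ℤ) := hn
      show n < -M
      omega
    rw [LinearMap.mem_ker, ← hz]
    have h1 : (heightSpace b S {n | n < M - ((2 * M).toNat : ℤ)}).subtype = 0 :=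
      LinearMap.ext fun x => (Submodule.mem_bot ℂ).mp (h0 x.2)
    rw [h1, LinearMap.lTensor_zero]
    rfl
  refine ⟨(2 * M).toNat + 1, ?_⟩
  rw [eq_bot_iff]
  refine Submodule.span_le.mpr ?_
  rintro _ ⟨w, x, hx, rfl⟩
  have h := LinearMap.mem_ker.mp (hk hx)
  exact Affine.ext (by rw [Affine.loop_lie, h, lie_zero]; rfl)
    (by rw [Affine.level_lie, h, map_zero]; rfl)

/-- The decomposition `ĝ = ū_nat ⊕ 𝔭_nat`. -/
def affineSplitting : Splitting (UBar b S) (Affine 𝔤 r) (pNat b S r) where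
  i := uIncl b S r
  q := uProj b S r
  pr := pProj b S r
  q_i := uProj_uIncl b S r
  i_q_add_pr x := by rw [coe_pProj, add_sub_cancel]
  q_coe := uProj_coe b S r
  i_q_lie w w' := by
    obtain ⟨w'', h⟩ := exists_lie_uIncl b S r w w'
    rw [h, uProj_uIncl]
  nilpotent := ⟨uSeries b S r, rfl, fun k w x hx => Submodule.subset_span ⟨w, x, hx, rfl⟩,
    exists_uSeries_eq_bot b S r⟩

end Decomposition

/-! ### The `t`-adic topology -/

section Filtered

open Topology Filter

variable {E E' : Type*} [AddCommGroup E] [Module ℂ E] [AddCommGroup E'] [Module ℂ E']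

/-- The topology for which the members of a decreasing family of subspaces are a base of
neighbourhoods of zero. -/
abbrev filtTop (N : ℤ → Submodule ℂ E) : TopologicalSpace E :=
  ⨅ n, TopologicalSpace.induced (N n).mkQ ⊥

variable {N : ℤ → Submodule ℂ E} {N' : ℤ → Submodule ℂ E'}

theorem isTopologicalAddGroup_of_filtTop [t : TopologicalSpace E] (ht : t = filtTop N) :
    IsTopologicalAddGroup E := by
  subst ht
  refine topologicalAddGroup_iInf fun n => ?_
  let : TopologicalSpace (E ⧸ N n) := ⊥
  have : DiscreteTopology (E ⧸ N n) := ⟨rfl⟩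
  exact topologicalAddGroup_induced (N n).mkQ

theorem hasBasis_of_filtTop [t : TopologicalSpace E] (ht : t = filtTop N) (hN : Antitone N) :
    (𝓝 (0 : E)).HasBasis (fun _ : ℤ => True) fun n => (N n : Set E) := by
  have h : 𝓝 (0 : E) = ⨅ n, 𝓟 (N n : Set E) := by
    subst ht
    rw [nhds_iInf]
    refine iInf_congr fun n => ?_
    let : TopologicalSpace (E ⧸ N n) := ⊥
    have : DiscreteTopology (E ⧸ N n) := ⟨rfl⟩
    rw [nhds_induced, nhds_discrete (E ⧸ N n), map_zero, ← principal_singleton, comap_principal]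
    congr 1
    ext x
    simp
  rw [h]
  refine hasBasis_iInf_principal fun m n => ⟨max m n, ?_, ?_⟩
  · exact hN (le_max_left m n)
  · exact hN (le_max_right m n)

theorem isLinearTopology_of_filtTop [t : TopologicalSpace E] (ht : t = filtTop N)
    (hN : Antitone N) : IsLinearTopology ℂ E :=
  IsLinearTopology.mk_of_hasBasis ℂ (hasBasis_of_filtTop ht hN)

theorem isOpen_of_filtTop [t : TopologicalSpace E] (ht : t = filtTop N)
    (hN : Antitone N) (n : ℤ) : IsOpen (N n : Set E) :=
  have := isTopologicalAddGroup_of_filtTop ht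
  (N n).toAddSubgroup.isOpen_of_mem_nhds ((hasBasis_of_filtTop ht hN).mem_of_mem trivial)

theorem continuous_of_filtTop [t : TopologicalSpace E] (ht : t = filtTop N) (hN : Antitone N)
    [t' : TopologicalSpace E'] (ht' : t' = filtTop N') (hN' : Antitone N') (g : E →ₗ[ℂ] E')
    (h : ∀ n, ∃ m, N m ≤ (N' n).comap g) : Continuous g := by
  have := isTopologicalAddGroup_of_filtTop ht
  have := isTopologicalAddGroup_of_filtTop ht'
  refine continuous_of_continuousAt_zero g ?_
  rw [ContinuousAt, map_zero, (hasBasis_of_filtTop ht hN).tendsto_iff (hasBasis_of_filtTop ht' hN')]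
  rintro n -
  obtain ⟨m, hm⟩ := h n
  exact ⟨m, trivial, hm⟩

theorem t2Space_of_filtTop [t : TopologicalSpace E] (ht : t = filtTop N) (hN : Antitone N)
    (h : ∀ x, (∀ n, x ∈ N n) → x = 0) : T2Space E := by
  have := isTopologicalAddGroup_of_filtTop ht
  refine IsTopologicalAddGroup.t2Space_of_zero_sep fun x hx => ?_
  by_contra hc
  push Not at hc
  exact hx (h x fun n => hc _ ((hasBasis_of_filtTop ht hN).mem_of_mem trivial))

theorem continuous_lie_of_filtTop {L : Type*} [LieRing L] [LieAlgebra ℂ L] {N : ℤ → Submodule ℂ L}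
    [t : TopologicalSpace L] (ht : t = filtTop N) (hN : Antitone N)
    (h : ∀ n, ∃ m, ∀ x ∈ N m, ∀ y ∈ N m, (⁅x, y⁆ : L) ∈ N n)
    (h' : ∀ (x : L) n, ∃ m, ∀ y ∈ N m, (⁅x, y⁆ : L) ∈ N n) : Continuous fun p : L × L => ⁅p.1, p.2⁆ := by
  have := isTopologicalAddGroup_of_filtTop ht
  have hb := hasBasis_of_filtTop ht hN
  have hsub : ∀ (x : L) m, ∀ᶠ y in 𝓝 x, y - x ∈ N m := fun x m =>
    (tendsto_sub_nhds_zero_iff.mpr (tendsto_id (x := 𝓝 x))) (hb.mem_of_mem trivial)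
  rw [continuous_iff_continuousAt]
  rintro ⟨x₀, y₀⟩
  rw [ContinuousAt, ← tendsto_sub_nhds_zero_iff, hb.tendsto_right_iff, nhds_prod_eq]
  rintro n -
  obtain ⟨m, hm⟩ := h n
  obtain ⟨m₁, hm₁⟩ := h' x₀ n
  obtain ⟨m₂, hm₂⟩ := h' y₀ n
  filter_upwards [((hsub x₀ m).and (hsub x₀ m₂)).prod_mk ((hsub y₀ m).and (hsub y₀ m₁))]
    with p hp
  have e : ⁅p.1, p.2⁆ - ⁅x₀, y₀⁆ = ⁅p.1 - x₀, p.2 - y₀⁆ + ⁅x₀, p.2 - y₀⁆ - ⁅y₀, p.1 - x₀⁆ := by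
    rw [← lie_skew y₀ (p.1 - x₀)]
    simp only [sub_lie, lie_sub]
    abel
  rw [e]
  exact sub_mem (add_mem (hm _ hp.1.1 _ hp.2.1) (hm₁ _ hp.2.2)) (hm₂ _ hp.1.2)

end Filtered

section TAdic

open LieAlgebra LieModule Module

variable (M : Type*) [AddCommGroup M] [Module ℂ M]

/-- The subspace `M ⊗ t ^ n ℂ[[t]]` of `M((t))`. -/
def tFil (n : ℤ) : Submodule ℂ (Laurent ⊗[ℂ] M) :=
  Submodule.span ℂ {x | ∃ (f : Laurent) (a : M), (∀ m < n, Laurent.coeff m f = 0) ∧ x = f ⊗ₜ[ℂ] a}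

theorem tAdic_eq : tAdic M = filtTop (tFil M) := rfl

theorem antitone_tFil : Antitone (tFil M) := fun _ _ hmn =>
  Submodule.span_mono fun _ ⟨f, a, h, e⟩ => ⟨f, a, fun k hk => h k (hk.trans_le hmn), e⟩

variable {M}

theorem tFil_le_comap_lTensor {M' : Type*} [AddCommGroup M'] [Module ℂ M'] (g : M →ₗ[ℂ] M')
    (n : ℤ) : tFil M n ≤ (tFil M' n).comap (g.lTensor Laurent) := by
  refine Submodule.span_le.mpr ?_
  rintro _ ⟨f, a, h, rfl⟩
  exact Submodule.subset_span ⟨f, g a, h, rfl⟩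

theorem Laurent.ext_coeff {f : Laurent} (h : ∀ n, Laurent.coeff n f = 0) : f = 0 :=
  HahnSeries.ext (funext h)

theorem eq_zero_of_mem_tFil [FiniteDimensional ℂ M] (x : Laurent ⊗[ℂ] M)
    (h : ∀ n, x ∈ tFil M n) : x = 0 := by
  have h1 : ∀ φ : M →ₗ[ℂ] ℂ, φ.lTensor Laurent x = 0 := by
    intro φ
    have h2 : ∀ n, TensorProduct.rid ℂ Laurent (φ.lTensor Laurent x) ∈
        LinearMap.ker (Laurent.coeff n) := by
      intro n
      have h3 : tFil M (n + 1) ≤ (LinearMap.ker (Laurent.coeff n)).comap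
          ((TensorProduct.rid ℂ Laurent).toLinearMap ∘ₗ φ.lTensor Laurent) := by
        refine Submodule.span_le.mpr ?_
        rintro _ ⟨f, a, hf, rfl⟩
        simp [hf n (lt_add_one n)]
      exact h3 (h (n + 1))
    exact (LinearEquiv.map_eq_zero_iff _).mp (Laurent.ext_coeff h2)
  let e := Module.finBasis ℂ M
  have h4 : (LinearMap.id : M →ₗ[ℂ] M)
      = ∑ j, LinearMap.toSpanSingleton ℂ M (e j) ∘ₗ e.coord j := by
    refine e.ext fun k => ?_
    simp [Finsupp.single_apply]
  have h5 : x = (LinearMap.id : M →ₗ[ℂ] M).lTensor Laurent x := by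
    rw [LinearMap.lTensor_id]; rfl
  have h6 : ∀ s : Finset (Fin (Module.finrank ℂ M)),
      (∑ j ∈ s, LinearMap.toSpanSingleton ℂ M (e j) ∘ₗ e.coord j).lTensor Laurent x = 0 := by
    intro s
    induction s using Finset.induction_on with
    | empty => simp
    | insert a s ha ih =>
      rw [Finset.sum_insert ha, LinearMap.lTensor_add, LinearMap.add_apply, ih,
        LinearMap.lTensor_comp_apply, h1, map_zero, add_zero]
  rw [h5, h4]
  exact h6 _

theorem isLinearTopology_tAdic : @IsLinearTopology ℂ (Laurent ⊗[ℂ] M) _ _ _ (tAdic M) :=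
  @isLinearTopology_of_filtTop _ _ _ _ (tAdic M) rfl (antitone_tFil M)

theorem isTopologicalAddGroup_tAdic : @IsTopologicalAddGroup (Laurent ⊗[ℂ] M) (tAdic M) _ :=
  @isTopologicalAddGroup_of_filtTop _ _ _ _ (tAdic M) rfl

theorem t2Space_tAdic [FiniteDimensional ℂ M] : @T2Space (Laurent ⊗[ℂ] M) (tAdic M) :=
  @t2Space_of_filtTop _ _ _ _ (tAdic M) rfl (antitone_tFil M) eq_zero_of_mem_tFil

theorem Laurent.exists_order (f : Laurent) : ∃ n : ℤ, ∀ m < n, Laurent.coeff m f = 0 := by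
  refine ⟨HahnSeries.order (f : HahnSeries ℤ ℂ), fun m hm => ?_⟩
  exact HahnSeries.coeff_eq_zero_of_lt_order hm

theorem exists_mem_tFil (x : Laurent ⊗[ℂ] M) : ∃ n, x ∈ tFil M n := by
  induction x with
  | zero => exact ⟨0, Submodule.zero_mem _⟩
  | add x y hx hy =>
    obtain ⟨m, hm⟩ := hx
    obtain ⟨n, hn⟩ := hy
    exact ⟨min m n, add_mem (antitone_tFil M (min_le_left m n) hm)
      (antitone_tFil M (min_le_right m n) hn)⟩
  | tmul f a =>
    obtain ⟨n, hn⟩ := Laurent.exists_order f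
    exact ⟨n, Submodule.subset_span ⟨f, a, hn, rfl⟩⟩

/-- The monomial `t ^ n`. -/
def Laurent.T (n : ℤ) : Laurent := (HahnSeries.single n (1 : ℂ) : HahnSeries ℤ ℂ)

theorem Laurent.coeff_T (m n : ℤ) : Laurent.coeff m (Laurent.T n) = if m = n then 1 else 0 := by
  refine (HahnSeries.coeff_single (Γ := ℤ)).trans ?_
  congr

theorem Laurent.coeff_mul_eq_zero {f g : Laurent} {m n : ℤ} (hf : ∀ k < m, Laurent.coeff k f = 0)
    (hg : ∀ k < n, Laurent.coeff k g = 0) {k : ℤ} (hk : k < m + n) :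
    Laurent.coeff k (f * g) = 0 := by
  refine (HahnSeries.coeff_mul (x := (f : HahnSeries ℤ ℂ)) (y := (g : HahnSeries ℤ ℂ))).trans ?_
  refine Finset.sum_eq_zero fun ij hij => ?_
  have h : ij.1 + ij.2 = k := (Finset.mem_antidiagonal.mp hij).2.2
  rcases lt_or_ge ij.1 m with h1 | h1
  · exact mul_eq_zero_of_left (hf _ h1) _
  · exact mul_eq_zero_of_right _ (hg _ (by omega))

/-- `M[[t]]` is spanned by finitely many vectors modulo `t ^ n M[[t]]`. -/
theorem tFil_le_span_sup [FiniteDimensional ℂ M] (n : ℕ) : ∃ s : Set (Laurent ⊗[ℂ] M), s.Finite ∧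
    tFil M 0 ≤ Submodule.span ℂ s ⊔ tFil M n := by
  induction n with
  | zero => exact ⟨∅, Set.finite_empty, le_sup_right⟩
  | succ n ih =>
    obtain ⟨s, hs, h⟩ := ih
    let e := Module.finBasis ℂ M
    refine ⟨s ∪ Set.range fun j => Laurent.T n ⊗ₜ[ℂ] e j, hs.union (Set.finite_range _), ?_⟩
    rw [Submodule.span_union, sup_assoc]
    refine h.trans (sup_le_sup_left (Submodule.span_le.mpr ?_) _)
    rintro _ ⟨f, a, hf, rfl⟩
    have hT : ∀ a : M, Laurent.T n ⊗ₜ[ℂ] a ∈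
        Submodule.span ℂ (Set.range fun j => Laurent.T n ⊗ₜ[ℂ] e j) := by
      intro a
      rw [← e.sum_repr a, TensorProduct.tmul_sum]
      refine Submodule.sum_mem _ fun j _ => ?_
      rw [TensorProduct.tmul_smul]
      exact Submodule.smul_mem _ _ (Submodule.subset_span ⟨j, rfl⟩)
    have e1 : f ⊗ₜ[ℂ] a = Laurent.coeff n f • (Laurent.T n ⊗ₜ[ℂ] a)
        + (f - Laurent.coeff n f • Laurent.T n) ⊗ₜ[ℂ] a := by
      rw [TensorProduct.sub_tmul, TensorProduct.smul_tmul', add_sub_cancel]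
    rw [SetLike.mem_coe, e1]
    refine Submodule.add_mem_sup (Submodule.smul_mem _ _ (hT a))
      (Submodule.subset_span ⟨_, a, fun m hm => ?_, rfl⟩)
    rw [map_sub, map_smul, Laurent.coeff_T]
    by_cases hmn : m = n
    · simp [hmn]
    · rw [if_neg hmn, smul_zero, sub_zero]
      push_cast at hm
      exact hf m (by omega)

end TAdic

section AffineTopology

open LieAlgebra LieAlgebra.IsKilling LieModule Module

variable {𝔤 : Type*} [LieRing 𝔤] [LieAlgebra ℂ 𝔤] (r : ℂ)

theorem affine_topology_eq :
    (inferInstance : TopologicalSpace (Affine 𝔤 r)) = filtTop (Affine.filtration r) := rfl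

theorem filtration_eq (n : ℤ) :
    Affine.filtration (𝔤 := 𝔤) r n = (tFil 𝔤 n).map (Affine.incl 𝔤 r) := by
  rw [Affine.filtration, tFil, Submodule.map_span]
  congr 1
  ext x
  constructor
  · rintro ⟨f, a, h, rfl⟩
    exact ⟨_, ⟨f, a, h, rfl⟩, rfl⟩
  · rintro ⟨_, ⟨f, a, h, rfl⟩, rfl⟩
    exact ⟨f, a, h, rfl⟩

theorem antitone_filtration : Antitone (Affine.filtration (𝔤 := 𝔤) r) := fun m n h => by
  rw [filtration_eq, filtration_eq]
  exact Submodule.map_mono (antitone_tFil 𝔤 h)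

instance : IsTopologicalAddGroup (Affine 𝔤 r) :=
  isTopologicalAddGroup_of_filtTop (affine_topology_eq r)

instance : IsLinearTopology ℂ (Affine 𝔤 r) :=
  isLinearTopology_of_filtTop (affine_topology_eq r) (antitone_filtration r)

theorem lie_mem_tFil {m n : ℤ} {x y : Laurent ⊗[ℂ] 𝔤} (hx : x ∈ tFil 𝔤 m) (hy : y ∈ tFil 𝔤 n) :
    ⁅x, y⁆ ∈ tFil 𝔤 (m + n) := by
  induction hx using Submodule.span_induction with
  | zero => rw [zero_lie]; exact Submodule.zero_mem _
  | add x x' _ _ hx hx' => rw [add_lie]; exact add_mem hx hx'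
  | smul c x _ hx => rw [smul_lie]; exact Submodule.smul_mem _ _ hx
  | mem x hx =>
    obtain ⟨f, a, hf, rfl⟩ := hx
    induction hy using Submodule.span_induction with
    | zero => rw [lie_zero]; exact Submodule.zero_mem _
    | add x x' _ _ hx hx' => rw [lie_add]; exact add_mem hx hx'
    | smul c x _ hx => rw [lie_smul]; exact Submodule.smul_mem _ _ hx
    | mem y hy =>
      obtain ⟨g, a', hg, rfl⟩ := hy
      rw [bracket_tmul_aux]
      exact Submodule.subset_span ⟨f * g, _, fun k hk => Laurent.coeff_mul_eq_zero hf hg hk, rfl⟩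

/-- `Res (f dg) = 0` if `f` and `g` have orders whose sum is positive. -/
theorem cocycle_eq_zero {m n : ℤ} (hmn : 0 < m + n) {x y : Laurent ⊗[ℂ] 𝔤}
    (hx : x ∈ tFil 𝔤 m) (hy : y ∈ tFil 𝔤 n) : cocycle 𝔤 r x y = 0 := by
  induction hx using Submodule.span_induction with
  | zero => rw [map_zero, LinearMap.zero_apply]
  | add x x' _ _ hx hx' => rw [map_add, LinearMap.add_apply, hx, hx', add_zero]
  | smul c x _ hx => rw [map_smul, LinearMap.smul_apply, hx, smul_zero]
  | mem x hx =>
    obtain ⟨f, a, hf, rfl⟩ := hx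
    induction hy using Submodule.span_induction with
    | zero => rw [map_zero]
    | add x x' _ _ hx hx' => rw [map_add, hx, hx', add_zero]
    | smul c x _ hx => rw [map_smul, hx, smul_zero]
    | mem y hy =>
      obtain ⟨g, a', hg, rfl⟩ := hy
      have hg' : ∀ k < n - 1, Laurent.coeff k (Laurent.deriv g) = 0 := fun k hk => by
        rw [Laurent.coeff_deriv, hg (k + 1) (by omega), mul_zero]
      rw [cocycle_tmul, Laurent.resPairing_apply,
        Laurent.coeff_mul_eq_zero hf hg' (by omega), mul_zero, neg_zero]

theorem lie_mem_filtration {m n k : ℤ} (h0 : 0 < m + n) (hk : k ≤ m + n) {x y : Affine 𝔤 r}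
    (hx : Affine.loop 𝔤 r x ∈ tFil 𝔤 m) (hy : y ∈ Affine.filtration r n) :
    ⁅x, y⁆ ∈ Affine.filtration r k := by
  rw [filtration_eq] at hy
  obtain ⟨y, hy, rfl⟩ := hy
  refine antitone_filtration r hk ?_
  rw [filtration_eq]
  refine ⟨_, lie_mem_tFil hx hy, Affine.ext rfl ?_⟩
  exact (cocycle_eq_zero r h0 hx hy).symm

/-- The order of the pole of the first factor enters through `lie_mem_filtration`; the cocycle
vanishes if the orders have a positive sum, hence the bounds `max 1 n`. -/
theorem continuous_lie_affine :
    Continuous fun p : Affine 𝔤 r × Affine 𝔤 r => ⁅p.1, p.2⁆ := by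
  refine continuous_lie_of_filtTop (affine_topology_eq r) (antitone_filtration r) ?_ ?_
  · intro n
    refine ⟨max 1 n, fun x hx y hy => ?_⟩
    rw [filtration_eq] at hx
    obtain ⟨x, hx, rfl⟩ := hx
    exact lie_mem_filtration r (by omega) (by omega)
      (show Affine.loop 𝔤 r (Affine.incl 𝔤 r x) ∈ tFil 𝔤 (max 1 n) from hx) hy
  · intro x n
    obtain ⟨m, hm⟩ := exists_mem_tFil (Affine.loop 𝔤 r x)
    exact ⟨max 1 n - m, fun y hy => lie_mem_filtration r (by omega) (by omega) hm hy⟩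

/-- `𝔤[[t]]` is linearly compact. -/
theorem filtration_le_span_sup [FiniteDimensional ℂ 𝔤] (U : Submodule ℂ (Affine 𝔤 r))
    (hU : IsOpen (U : Set (Affine 𝔤 r))) :
    ∃ s : Set (Affine 𝔤 r), s.Finite ∧ Affine.filtration r 0 ≤ Submodule.span ℂ s ⊔ U := by
  obtain ⟨n, -, hn⟩ := (hasBasis_of_filtTop (affine_topology_eq r)
    (antitone_filtration r)).mem_iff.mp (hU.mem_nhds (zero_mem U))
  obtain ⟨s, hs, h⟩ := tFil_le_span_sup (M := 𝔤) n.toNat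
  refine ⟨Affine.incl 𝔤 r '' s, hs.image _, ?_⟩
  rw [filtration_eq, Submodule.span_image]
  refine (Submodule.map_mono h).trans ?_
  rw [Submodule.map_sup, ← filtration_eq]
  exact sup_le_sup_left ((antitone_filtration r (Int.self_le_toNat n)).trans hn) _

variable [FiniteDimensional ℂ 𝔤] [LieAlgebra.IsSimple ℂ 𝔤]
  {H : LieSubalgebra ℂ 𝔤} [H.IsCartanSubalgebra] (b : (rootSystem H).Base) (S : Set b.support)

theorem continuous_uIncl : @Continuous _ _ (tAdic (oppNilradical b S)) _ (uIncl b S r) := by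
  let : TopologicalSpace (UBar b S) := tAdic (oppNilradical b S)
  refine continuous_of_filtTop (tAdic_eq _) (antitone_tFil _) (affine_topology_eq r)
    (antitone_filtration r) _ fun n => ⟨n, ?_⟩
  rw [filtration_eq]
  exact fun x hx => ⟨_, tFil_le_comap_lTensor _ n hx, rfl⟩

theorem continuous_uProj : @Continuous _ _ _ (tAdic (oppNilradical b S)) (uProj b S r) := by
  let : TopologicalSpace (UBar b S) := tAdic (oppNilradical b S)
  refine continuous_of_filtTop (affine_topology_eq r) (antitone_filtration r) (tAdic_eq _)
    (antitone_tFil _) _ fun n => ⟨n, ?_⟩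
  rw [filtration_eq]
  rintro _ ⟨x, hx, rfl⟩
  exact tFil_le_comap_lTensor _ n hx

theorem continuous_pProj : Continuous (pProj b S r) := by
  let : TopologicalSpace (UBar b S) := tAdic (oppNilradical b S)
  refine continuous_induced_rng.mpr ?_
  exact continuous_id.sub ((continuous_uIncl r b S).comp (continuous_uProj r b S))

end AffineTopology

end FreeField

end

theorem mainTheorem3 {𝔤 : Type*} [LieRing 𝔤] [LieAlgebra ℂ 𝔤] [FiniteDimensional ℂ 𝔤]
    [LieAlgebra.IsSimple ℂ 𝔤] (H : LieSubalgebra ℂ 𝔤) [H.IsCartanSubalgebra]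
    (b : (LieAlgebra.IsKilling.rootSystem H).Base) (S : Set b.support) (θ : H.root)
    (hθ : ∀ α : H.root,
      (LieAlgebra.IsKilling.rootSystem H).root θ - (LieAlgebra.IsKilling.rootSystem H).root α ∈
        AddSubmonoid.closure ((LieAlgebra.IsKilling.rootSystem H).root '' b.support))
    {V : Type*} [AddCommGroup V] [Module ℂ V] [TopologicalSpace V] [IsTopologicalAddGroup V]
    [ContinuousConstSMul ℂ V] (k : ℂ)
    (σ : FreeField.pNat b S (FreeField.normalization θ) →ₗ⁅ℂ⁆ Module.End ℂ V)
    (hσ : Continuous fun x : FreeField.pNat b S (FreeField.normalization θ) × V => σ x.1 x.2)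
    (hk : ∀ v, σ (FreeField.pCentral b S (FreeField.normalization θ)) v = k • v) :
    ∃ ρ : FreeField.Affine 𝔤 (FreeField.normalization θ) →ₗ⁅ℂ⁆
        Module.End ℂ (FreeField.FreeFieldModule b S (FreeField.normalization θ) σ),
      (∀ a, ρ a = FreeField.FreeFieldModule.op b S (FreeField.normalization θ) σ a) ∧
      (∀ m, ρ (FreeField.Affine.c 𝔤 (FreeField.normalization θ)) m = k • m) ∧
      (Continuous fun x : FreeField.Affine 𝔤 (FreeField.normalization θ) ×
          FreeField.FreeFieldModule b S (FreeField.normalization θ) σ => ρ x.1 x.2) ∧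
      (Continuous fun x : FreeField.Affine 𝔤 (FreeField.normalization θ) ×
          FreeField.ImaginaryVerma b S (FreeField.normalization θ) σ =>
            FreeField.ImaginaryVerma.act b S (FreeField.normalization θ) σ x.1 x.2) ∧
      (∃ Φ : FreeField.ImaginaryVerma b S (FreeField.normalization θ) σ ≃L[ℂ]
          FreeField.FreeFieldModule b S (FreeField.normalization θ) σ,
        ∀ a m, Φ (FreeField.ImaginaryVerma.act b S (FreeField.normalization θ) σ a m) =
          ρ a (Φ m)) ∧
      (T2Space V → IsLinearTopology ℂ V →
        T2Space (FreeField.ImaginaryVerma b S (FreeField.normalization θ) σ) ∧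
        T2Space (FreeField.FreeFieldModule b S (FreeField.normalization θ) σ)) := by
  open FreeField in
  let r := normalization θ
  -- the modules and operators attached to `s` unfold to those of the statement
  let s := affineSplitting b S r
  let tU : TopologicalSpace (UBar b S) := tAdic (oppNilradical b S)
  let t₁ : TopologicalSpace (SA (UBar b S) ⊗[ℂ] V) := finestLinear (freeMon (UBar b S) V)
  let t₂ : TopologicalSpace (IndMod σ) := finestLinear (indMon σ)
  have hrep : Continuous fun p : Affine 𝔤 r × (SA (UBar b S) ⊗[ℂ] V) => s.rep σ p.1 p.2 :=
    continuous_rep (s := s) σ (continuous_uIncl r b S) (continuous_uProj r b S)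
      (continuous_pProj r b S) (continuous_lie_affine r) hσ
      (isOpen_of_filtTop (affine_topology_eq r) (antitone_filtration r) 0)
      (filtration_le_span_sup r) rfl
  have hact : Continuous fun p : Affine 𝔤 r × IndMod σ =>
      indMul σ (UniversalEnvelopingAlgebra.ι ℂ p.1) p.2 :=
    continuous_indMul σ s (isOpen_of_filtTop (affine_topology_eq r) (antitone_filtration r) 0)
      (filtration_le_span_sup r) rfl
  have hto : Continuous (s.toFree σ) := continuous_toFree σ rfl hrep rfl
  have hof : Continuous (s.ofFree σ) :=
    continuous_ofFree σ (continuous_uIncl r b S) rfl rfl hact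
  let Φ : IndMod σ ≃L[ℂ] SA (UBar b S) ⊗[ℂ] V :=
    { s.indEquiv σ with
      continuous_toFun := hto
      continuous_invFun := hof }
  refine ⟨s.rep σ, fun a => rfl, fun m => ?_, hrep, hact, ⟨Φ, s.toFree_indMul σ⟩, fun h2 hl => ?_⟩
  · have h : σ (pCentral b S r) = k • LinearMap.id := LinearMap.ext hk
    refine (s.rep_central σ (x := pCentral b S r) (lie_c r) m).trans ?_
    rw [h, LinearMap.lTensor_smul, LinearMap.lTensor_id]
    rfl
  · have : IsTopologicalAddGroup (UBar b S) := isTopologicalAddGroup_tAdic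
    have : IsLinearTopology ℂ (UBar b S) := isLinearTopology_tAdic
    have : T2Space (UBar b S) := t2Space_tAdic
    have hfree : T2Space (SA (UBar b S) ⊗[ℂ] V) := t2Space_free rfl
    exact ⟨Φ.toHomeomorph.symm.t2Space, hfree⟩
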